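/- Let $n\ge 3$, let $\zeta_n$ be a primitive $n$th root of unity, $\mathcal O_n=\mathbb Z[\zeta_n]\subset\mathbb C=\mathbb R^2$, $K_n=\mathbb Q(\zeta_n)$ and $k=\phi(n)/2-1$. Choose one automorphism from each pair of complex conjugate elements of $\mathrm{Gal}(K_n/\mathbb Q)$, namely $\sigma_1=\mathrm{id},\sigma_2,\dots,\sigma_{k+1}$, and let $z^\star=(\sigma_2(z),\dots,\sigma_{k+1}(z))\in(\mathbb R^2)^k$ for $z\in\mathcal O_n$. Let $W=\{x\in(\mathbb R^2)^k : Ax\le b\}$, with a real matrix $A$ and a real vector $b$, be a window, i.e. $\varnothing\ne W^\circ\subset W\subset\overline{W^\circ}$ with $\overline{W^\circ}$ compact. The $W^\circ$-sets are the sets $t+\{z\in\mathcal O_n : z^\star\in\tau+W^\circ\}$ with $t\in\mathbb R^2$, $\tau\in(\mathbb R^2)^k$. Let $o_1,\dots,o_m\in\mathcal O_n\setminus\{0\}$, $m\ge2$, be pairwise non-parallel. The X-ray $X_{o}F$ of a finite set $F\subset\mathbb R^2$ is the function that maps each line $\ell$ parallel to $o$ to $\operatorname{card}(F\cap\ell)$.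 All of $n$, the star map, $W$ and the $o_i$ are fixed. Consider the following problems. Consistency: given functions $p_i$ from the lines parallel to $o_i$ to $\mathbb N_0$ ($1\le i\le m$), with finite supports consisting of lines that meet $\mathcal O_n$, decide whether there is a finite subset $F$ of a $W^\circ$-set with $X_{o_i}F=p_i$ for all $i$. Reconstruction: in addition, construct one such $F$ if there is one. Uniqueness: given a finite subset $F$ of a $W^\circ$-set, decide whether there is a finite subset $F'\ne F$ of a $W^\circ$-set with $X_{o_i}F'=X_{o_i}F$ for all $i$. The anchored versions of the three problems ask the same questions for arbitrary planar data with a prescribed set $S\subset\mathbb R^2$: given $s\in\mathbb N_0$, functions $p_i$ with supports of at most $s$ lines (respectively, a finite set $F\subset\mathbb R^2$ whose X-rays have supports of at most $s$ lines) and a set $S$ of at most $s^2$ points, decide whether there is $F\subset S$ with $X_{o_i}F=p_i$ for all $i$; in addition, construct one such $F$ if there is one; respectively, decide whether there is $F'\subset S$ with $F'\ne F$ and $X_{o_i}F'=X_{o_i}F$ for all $i$. The model of computation is the real RAM, in which the arithmetic operations on reals, comparisons, the test whether a real number is an integer, and memory access through integer addresses have unit cost. Module lines in the input are given by the $\mathbb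 Z$-coordinates, with respect to $1,\zeta_n,\dots,\zeta_n^{\phi(n)-1}$, of a point of $\mathcal O_n$ on them, and the set $F$ in Uniqueness by some $t\in\mathbb R^2$ and the $\mathbb Z$-coordinates of the points of $F-t\subset\mathcal O_n$; other points and lines are given by planar real coordinates. Theorem. Each of Consistency, Reconstruction and Uniqueness can be solved by a real RAM program that uses an arbitrary oracle for the anchored version of the same problem, and whose numbers of operations and of oracle calls are bounded by a polynomial in $s$, the maximum of the cardinalities of the supports of the X-ray data $p_i$ (for Uniqueness, of $X_{o_i}F$). Every oracle call is made for an anchored instance with parameter at most $s$, hence with a candidate set of at most $s^2$ points. -/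

import Mathlib

noncomputable section

namespace RealRAM

/-! ### A real random access machine with an oracle

Real numbers are stored in finitely many unbounded arrays, addressed by natural-number index
registers. Programs are finite; they may contain real constants. Every elementary operation costs
one unit. -/

/-- Memory contents: the index registers, and the real cells `mem a i` (cell `i` of array `a`). -/
@[ext] structure State where
  reg : ℕ → ℕ
  mem : ℕ → ℕ → ℝ

/-- Index arithmetic (subtraction is truncated). -/
inductive NExp where
  | const (k : ℕ)
  | reg (r : ℕ)
  | add (e f : NExp)
  | sub (e f : NExp)
  | mul (e f : NExp)

def NExp.eval (σ : State) : NExp → ℕ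
  | .const k => k
  | .reg r => σ.reg r
  | .add e f => e.eval σ + f.eval σ
  | .sub e f => e.eval σ - f.eval σ
  | .mul e f => e.eval σ * f.eval σ

/-- Number of elementary operations needed to evaluate the expression. -/
def NExp.size : NExp → ℕ
  | .const _ => 1
  | .reg _ => 1
  | .add e f => e.size + f.size + 1
  | .sub e f => e.size + f.size + 1
  | .mul e f => e.size + f.size + 1

/-- Real arithmetic. The cell `i` of array `a` is accessed with a computed index `i` (indirect
addressing); `ofNat` regards an index as a real number. Division by zero yields zero. -/
inductive RExp where
  | const (c : ℝ)
  | cell (a : ℕ) (i : NExp)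
  | ofNat (e : NExp)
  | add (e f : RExp)
  | sub (e f : RExp)
  | mul (e f : RExp)
  | div (e f : RExp)

def RExp.eval (σ : State) : RExp → ℝ
  | .const c => c
  | .cell a i => σ.mem a (i.eval σ)
  | .ofNat e => (e.eval σ : ℝ)
  | .add e f => e.eval σ + f.eval σ
  | .sub e f => e.eval σ - f.eval σ
  | .mul e f => e.eval σ * f.eval σ
  | .div e f => e.eval σ / f.eval σ

def RExp.size : RExp → ℕ
  | .const _ => 1
  | .cell _ i => i.size + 1
  | .ofNat e => e.size + 1
  | .add e f => e.size + f.size + 1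
  | .sub e f => e.size + f.size + 1
  | .mul e f => e.size + f.size + 1
  | .div e f => e.size + f.size + 1

/-- Tests: comparisons of indices and of reals, and the test whether a real is an integer. -/
inductive Test where
  | natLt (e f : NExp)
  | natEq (e f : NExp)
  | realLt (e f : RExp)
  | realEq (e f : RExp)
  | isInt (e : RExp)
  | not (c : Test)
  | and (c d : Test)

def Test.holds (σ : State) : Test → Prop
  | .natLt e f => e.eval σ < f.eval σ
  | .natEq e f => e.eval σ = f.eval σ
  | .realLt e f => e.eval σ < f.eval σ
  | .realEq e f => e.eval σ = f.eval σ
  | .isInt e => ∃ k : ℤ, e.eval σ = (k : ℝ)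
  | .not c => ¬ c.holds σ
  | .and c d => c.holds σ ∧ d.holds σ

def Test.size : Test → ℕ
  | .natLt e f => e.size + f.size + 1
  | .natEq e f => e.size + f.size + 1
  | .realLt e f => e.size + f.size + 1
  | .realEq e f => e.size + f.size + 1
  | .isInt e => e.size + 1
  | .not c => c.size + 1
  | .and c d => c.size + d.size + 1

/-- Programs. `call len r` submits the first `len` cells of array `2` to the oracle, which writes
its answer to the beginning of array `3` and the length of the answer to register `r`. -/
inductive Prog where
  | skip
  | setReg (r : ℕ) (e : NExp)
  | setCell (a : ℕ) (i : NExp) (e : RExp)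
  | seq (p q : Prog)
  | ite (c : Test) (p q : Prog)
  | loop (c : Test) (p : Prog)
  | call (len : NExp) (r : ℕ)

def State.setReg (σ : State) (r v : ℕ) : State :=
  { σ with reg := Function.update σ.reg r v }

def State.setCell (σ : State) (a i : ℕ) (x : ℝ) : State :=
  { σ with mem := Function.update σ.mem a (Function.update (σ.mem a) i x) }

/-- The first `k` cells of array `a`. -/
def State.read (σ : State) (a k : ℕ) : List ℝ := (List.range k).map (σ.mem a)

/-- Write the word `w` to the beginning of array `a`. -/
def State.write (σ : State) (a : ℕ) (w : List ℝ) : State :=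
  { σ with mem := Function.update σ.mem a (fun i => w.getD i (σ.mem a i)) }

/-- `Run O p σ T qs σ'`: with oracle `O`, the program `p` started in the state `σ` halts in the
state `σ'` after `T` elementary operations, having submitted the queries `qs` in this order. -/
inductive Run (O : List ℝ → List ℝ) :
    Prog → State → ℕ → List (List ℝ) → State → Prop where
  | skip (σ : State) : Run O .skip σ 0 [] σ
  | setReg (r : ℕ) (e : NExp) (σ : State) :
      Run O (.setReg r e) σ (e.size + 1) [] (σ.setReg r (e.eval σ))
  | setCell (a : ℕ) (i : NExp) (e : RExp) (σ : State) :
      Run O (.setCell a i e) σ (i.size + e.size + 1) [] (σ.setCell a (i.eval σ) (e.eval σ))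
  | seq {p q : Prog} {σ₁ σ₂ σ₃ : State} {T₁ T₂ : ℕ} {qs₁ qs₂ : List (List ℝ)} :
      Run O p σ₁ T₁ qs₁ σ₂ → Run O q σ₂ T₂ qs₂ σ₃ →
      Run O (.seq p q) σ₁ (T₁ + T₂) (qs₁ ++ qs₂) σ₃
  | ite_true {c : Test} {p q : Prog} {σ₁ σ₂ : State} {T : ℕ} {qs : List (List ℝ)} :
      c.holds σ₁ → Run O p σ₁ T qs σ₂ → Run O (.ite c p q) σ₁ (c.size + T) qs σ₂
  | ite_false {c : Test} {p q : Prog} {σ₁ σ₂ : State} {T : ℕ} {qs : List (List ℝ)} :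
      ¬ c.holds σ₁ → Run O q σ₁ T qs σ₂ → Run O (.ite c p q) σ₁ (c.size + T) qs σ₂
  | loop_true {c : Test} {p : Prog} {σ₁ σ₂ σ₃ : State} {T₁ T₂ : ℕ}
      {qs₁ qs₂ : List (List ℝ)} :
      c.holds σ₁ → Run O p σ₁ T₁ qs₁ σ₂ → Run O (.loop c p) σ₂ T₂ qs₂ σ₃ →
      Run O (.loop c p) σ₁ (c.size + T₁ + T₂) (qs₁ ++ qs₂) σ₃
  | loop_false {c : Test} {p : Prog} {σ : State} :
      ¬ c.holds σ → Run O (.loop c p) σ c.size [] σ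
  | call (len : NExp) (r : ℕ) (σ : State) (q : List ℝ) :
      q = σ.read 2 (len.eval σ) →
      Run O (.call len r) σ (len.size + 1 + q.length + (O q).length) [q]
        ((σ.write 3 (O q)).setReg r (O q).length)

/-- Initial state: the input word is in array `0`, its length in register `0`; all else is `0`. -/
def State.init (w : List ℝ) : State where
  reg := fun r => if r = 0 then w.length else 0
  mem := fun a i => if a = 0 then w.getD i 0 else 0

/-- The output word: the first cells of array `1`, as many as register `1` says. -/
def State.output (σ : State) : List ℝ := σ.read 1 (σ.reg 1)

/-- A computational problem: instances with a size, the words that describe an instance, and the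
words that are correct answers. -/
structure Problem where
  Inst : Type
  size : Inst → ℕ
  Describes : List ℝ → Inst → Prop
  Answers : List ℝ → Inst → Prop

/-- `O` answers every correctly described instance of `Q` correctly. -/
def Problem.SolvedBy (Q : Problem) (O : List ℝ → List ℝ) : Prop :=
  ∀ (J : Q.Inst) (w : List ℝ), Q.Describes w J → Q.Answers (O w) J

/-- One program solves `P` with any oracle for `Q`, with polynomially many (in the size of the
instance) operations and polynomially many oracle calls, each of them on an instance of `Q`
whose size is at most that of the given instance. -/
def PolySolvableWithOracle (P Q : Problem) : Prop :=
  ∃ (prog : Prog) (C k : ℕ), ∀ O : List ℝ → List ℝ, Q.SolvedBy O →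
    ∀ (I : P.Inst) (w : List ℝ), P.Describes w I →
      ∃ (T : ℕ) (qs : List (List ℝ)) (σ : State),
        Run O prog (State.init w) T qs σ ∧
        P.Answers σ.output I ∧
        T ≤ C * (P.size I + 1) ^ k ∧
        qs.length ≤ C * (P.size I + 1) ^ k ∧
        ∀ q ∈ qs, ∃ J : Q.Inst, Q.Describes q J ∧ Q.size J ≤ P.size I

end RealRAM

namespace ModelSet

open RealRAM

/-! ### Cyclotomic model sets -/

/-- The ring `ℤ[ζ]`. -/
def ringO (ζ : ℂ) : Subalgebra ℤ ℂ := Algebra.adjoin ℤ {ζ}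

/-- The field `ℚ(ζ)`. -/
abbrev fieldK (ζ : ℂ) : IntermediateField ℚ ℂ := IntermediateField.adjoin ℚ {ζ}

/-- The identity together with `σ` contains exactly one member of each pair of complex conjugate
automorphisms of `ℚ(ζ)`. -/
def IsStarChoice (ζ : ℂ) {k : ℕ} (σ : Fin k → (fieldK ζ ≃ₐ[ℚ] fieldK ζ)) : Prop :=
  ∀ g : fieldK ζ ≃ₐ[ℚ] fieldK ζ, ∃! j : Option (Fin k),
    (∀ x, ((j.elim AlgEquiv.refl σ : fieldK ζ ≃ₐ[ℚ] fieldK ζ) x : ℂ) = (g x : ℂ)) ∨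
    (∀ x, ((j.elim AlgEquiv.refl σ : fieldK ζ ≃ₐ[ℚ] fieldK ζ) x : ℂ) = star (g x : ℂ))

/-- The internal space `(ℝ²)ᵏ`. -/
abbrev Internal (k : ℕ) : Type := Fin k × Fin 2 → ℝ

/-- The star map, with `ℂ = ℝ²`. -/
def starMap {ζ : ℂ} {k : ℕ} (σ : Fin k → (fieldK ζ ≃ₐ[ℚ] fieldK ζ)) (z : fieldK ζ) :
    Internal k :=
  fun j => ![((σ j.1 z : fieldK ζ) : ℂ).re, ((σ j.1 z : fieldK ζ) : ℂ).im] j.2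

/-- Windows: `∅ ≠ W° ⊆ W ⊆ closure W°`, and `closure W°` is compact. -/
def IsWindow {k : ℕ} (W : Set (Internal k)) : Prop :=
  (interior W).Nonempty ∧ W ⊆ closure (interior W) ∧ IsCompact (closure (interior W))

/-- The polyhedron `{x | A x ≤ b}`. -/
def polyhedron {k l : ℕ} (A : Matrix (Fin l) (Fin k × Fin 2) ℝ) (b : Fin l → ℝ) :
    Set (Internal k) :=
  {x | ∀ i, (A.mulVec x) i ≤ b i}

/-- The model set `Λ(t, W) = t + {z ∈ ℤ[ζ] | z⋆ ∈ W}`. -/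
def modelSet {ζ : ℂ} {k : ℕ} (σ : Fin k → (fieldK ζ ≃ₐ[ℚ] fieldK ζ)) (t : ℂ)
    (W : Set (Internal k)) : Set ℂ :=
  {x | ∃ z : fieldK ζ, (z : ℂ) ∈ ringO ζ ∧ starMap σ z ∈ W ∧ x = t + (z : ℂ)}

/-- The `W°`-sets: the sets `Λ(t, τ + W°)`. -/
def IsWSet {ζ : ℂ} {k : ℕ} (σ : Fin k → (fieldK ζ ≃ₐ[ℚ] fieldK ζ)) (W : Set (Internal k))
    (Λ : Set ℂ) : Prop :=
  ∃ (t : ℂ) (τ : Internal k), Λ = modelSet σ t ((fun x => τ + x) '' interior W)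

/-! ### X-rays -/

/-- The line `t + ℝ o`. -/
def line (t o : ℂ) : Set ℂ := {z | ∃ r : ℝ, z = t + (r : ℂ) * o}

/-- The lines in direction `o`. -/
abbrev LineIn (o : ℂ) : Type := {ℓ : Set ℂ // ∃ t : ℂ, ℓ = line t o}

/-- The line in direction `o` through `t`. -/
def lineThrough (t o : ℂ) : LineIn o := ⟨line t o, t, rfl⟩

/-- The discrete parallel X-ray of `F` in direction `o`. -/
def xray (o : ℂ) (F : Finset ℂ) (ℓ : LineIn o) : ℕ := ((F : Set ℂ) ∩ ℓ.1).ncard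

/-- The maximum of the cardinalities of the supports of X-ray data. -/
def maxSupport {m : ℕ} {o : Fin m → ℂ} (p : ∀ i, LineIn (o i) → ℕ) : ℕ :=
  Finset.univ.sup fun i => (Function.support (p i)).ncard

/-! ### Description of the data by real words -/

/-- The list `L` enumerates the finite set `F` without repetition. -/
def Enumerates (L : List ℂ) (F : Finset ℂ) : Prop := L.Nodup ∧ ∀ z, z ∈ L ↔ z ∈ F

/-- The list `L` gives the data function `p`: each line of the support of `p` is listed once,
through one of its points, together with the value of `p`. -/
def ListsData {o : ℂ} (L : List (ℂ × ℕ)) (p : LineIn o → ℕ) : Prop :=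
  (L.map fun e => lineThrough e.1 o).Nodup ∧ (∀ e ∈ L, e.2 ≠ 0) ∧
    ∀ (ℓ : LineIn o) (v : ℕ), v ≠ 0 → (p ℓ = v ↔ ∃ e ∈ L, lineThrough e.1 o = ℓ ∧ e.2 = v)

/-- The element of `ℤ[ζ]` with given coordinates with respect to `1, ζ, …, ζ^(d-1)`. -/
def ofCoords (ζ : ℂ) {d : ℕ} (c : Fin d → ℤ) : ℂ := ∑ j, (c j : ℂ) * ζ ^ (j : ℕ)

/-- Points of the plane as pairs of reals. -/
def encPoints (L : List ℂ) : List ℝ := L.flatMap fun z => [z.re, z.im]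

def encCoords {d : ℕ} (c : Fin d → ℤ) : List ℝ := List.ofFn fun j => (c j : ℝ)

/-- X-ray data in one direction, lines being given by a point in the plane. -/
def encData (L : List (ℂ × ℕ)) : List ℝ :=
  (L.length : ℝ) :: L.flatMap fun e => [e.1.re, e.1.im, (e.2 : ℝ)]

/-- X-ray data in one direction, lines being given by the coordinates of a point of `ℤ[ζ]`. -/
def encCoordData {d : ℕ} (L : List ((Fin d → ℤ) × ℕ)) : List ℝ :=
  (L.length : ℝ) :: L.flatMap fun e => encCoords e.1 ++ [(e.2 : ℝ)]

/-- The answer `1` (yes) or `0` (no) to a decision problem. -/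
def Decides (w : List ℝ) (yes : Prop) : Prop := (yes ∧ w = [1]) ∨ (¬ yes ∧ w = [0])

/-- The answer to a construction problem: `1` followed by the points of a solution, or `0` if
there is no solution. -/
def Constructs (w : List ℝ) (sol : Finset ℂ → Prop) : Prop :=
  (∃ (F : Finset ℂ) (L : List ℂ), sol F ∧ Enumerates L F ∧ w = 1 :: encPoints L) ∨
    ((¬ ∃ F, sol F) ∧ w = [0])

/-! ### The tomographic problems for fixed `ζ`, star map, window and directions -/

/-- X-ray data with finite supports consisting of module lines. -/
structure ModuleData (ζ : ℂ) {m : ℕ} (o : Fin m → ℂ) where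
  p : ∀ i, LineIn (o i) → ℕ
  finite : ∀ i, (Function.support (p i)).Finite
  module_lines : ∀ i, ∀ ℓ ∈ Function.support (p i), ∃ t ∈ ringO ζ, ℓ = lineThrough t (o i)

/-- Module data are given by module points on the lines, in integer coordinates. -/
def ModuleData.IsDescribed (d : ℕ) {ζ : ℂ} {m : ℕ} {o : Fin m → ℂ} (w : List ℝ)
    (I : ModuleData ζ o) : Prop :=
  ∃ L : Fin m → List ((Fin d → ℤ) × ℕ),
    (∀ i, ListsData ((L i).map fun e => (ofCoords ζ e.1, e.2)) (I.p i)) ∧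
    w = (List.ofFn fun i => encCoordData (L i)).flatten

/-- `F` is contained in a `W°`-set and has the X-rays `p`. -/
def IsSolution {ζ : ℂ} {k : ℕ} (σ : Fin k → (fieldK ζ ≃ₐ[ℚ] fieldK ζ)) (W : Set (Internal k))
    {m : ℕ} {o : Fin m → ℂ} (p : ∀ i, LineIn (o i) → ℕ) (F : Finset ℂ) : Prop :=
  (∃ Λ, IsWSet σ W Λ ∧ (F : Set ℂ) ⊆ Λ) ∧ ∀ i, xray (o i) F = p i

/-- Consistency; `d` is the number of coordinates that are used for `ℤ[ζ]`. -/
def consistency (d : ℕ) {ζ : ℂ} {k : ℕ} (σ : Fin k → (fieldK ζ ≃ₐ[ℚ] fieldK ζ))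
    (W : Set (Internal k)) {m : ℕ} (o : Fin m → ℂ) : Problem where
  Inst := ModuleData ζ o
  size := fun I => maxSupport I.p
  Describes := fun w I => I.IsDescribed d w
  Answers := fun w I => Decides w (∃ F, IsSolution σ W I.p F)

/-- Reconstruction. -/
def reconstruction (d : ℕ) {ζ : ℂ} {k : ℕ} (σ : Fin k → (fieldK ζ ≃ₐ[ℚ] fieldK ζ))
    (W : Set (Internal k)) {m : ℕ} (o : Fin m → ℂ) : Problem where
  Inst := ModuleData ζ o
  size := fun I => maxSupport I.p
  Describes := fun w I => I.IsDescribed d w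
  Answers := fun w I => Constructs w (IsSolution σ W I.p)

/-- Uniqueness: is there a different set with the same X-rays? The given set `F` lives on
`ℤ[ζ]`; it is described by a translation vector `t` and the integer coordinates of the points of
`F - t ⊆ ℤ[ζ]`. -/
def uniqueness (d : ℕ) {ζ : ℂ} {k : ℕ} (σ : Fin k → (fieldK ζ ≃ₐ[ℚ] fieldK ζ))
    (W : Set (Internal k)) {m : ℕ} (o : Fin m → ℂ) : Problem where
  Inst := {F : Finset ℂ // ∃ Λ, IsWSet σ W Λ ∧ (F : Set ℂ) ⊆ Λ}
  size := fun F => maxSupport fun i => xray (o i) F.1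
  Describes := fun w F => ∃ (t : ℂ) (L : List (Fin d → ℤ)),
    Enumerates (L.map fun c => t + ofCoords ζ c) F.1 ∧
    w = t.re :: t.im :: (L.length : ℝ) :: L.flatMap encCoords
  Answers := fun w F =>
    Decides w (∃ F' : Finset ℂ, F' ≠ F.1 ∧ IsSolution σ W (fun i => xray (o i) F.1) F')

/-! ### The anchored problems: the solution is sought in a given finite set `S` of the plane -/

/-- X-ray data with supports of cardinality at most `s`, and at most `s²` candidate points. -/
structure AnchoredData {m : ℕ} (o : Fin m → ℂ) where
  s : ℕ
  p : ∀ i, LineIn (o i) → ℕ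
  finite : ∀ i, (Function.support (p i)).Finite
  card_le : ∀ i, (Function.support (p i)).ncard ≤ s
  S : Finset ℂ
  card_S_le : S.card ≤ s ^ 2

def AnchoredData.IsDescribed {m : ℕ} {o : Fin m → ℂ} (w : List ℝ) (J : AnchoredData o) : Prop :=
  ∃ (L : Fin m → List (ℂ × ℕ)) (P : List ℂ),
    (∀ i, ListsData (L i) (J.p i)) ∧ Enumerates P J.S ∧
    w = (J.s : ℝ) :: ((List.ofFn fun i => encData (L i)).flatten ++
      (P.length : ℝ) :: encPoints P)

def AnchoredData.IsSolution {m : ℕ} {o : Fin m → ℂ} (J : AnchoredData o) (F : Finset ℂ) : Prop :=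
  F ⊆ J.S ∧ ∀ i, xray (o i) F = J.p i

/-- Anchored consistency. -/
def anchoredConsistency {m : ℕ} (o : Fin m → ℂ) : Problem where
  Inst := AnchoredData o
  size := fun J => J.s
  Describes := fun w J => J.IsDescribed w
  Answers := fun w J => Decides w (∃ F, J.IsSolution F)

/-- Anchored reconstruction. -/
def anchoredReconstruction {m : ℕ} (o : Fin m → ℂ) : Problem where
  Inst := AnchoredData o
  size := fun J => J.s
  Describes := fun w J => J.IsDescribed w
  Answers := fun w J => Constructs w J.IsSolution

/-- A finite set `F` whose X-rays have supports of cardinality at most `s`, and at most `s²`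
candidate points. -/
structure AnchoredSet {m : ℕ} (o : Fin m → ℂ) where
  s : ℕ
  F : Finset ℂ
  card_le : ∀ i, (Function.support (xray (o i) F)).ncard ≤ s
  S : Finset ℂ
  card_S_le : S.card ≤ s ^ 2

/-- Anchored uniqueness: is there a set in `S`, different from `F`, with the X-rays of `F`? -/
def anchoredUniqueness {m : ℕ} (o : Fin m → ℂ) : Problem where
  Inst := AnchoredSet o
  size := fun J => J.s
  Describes := fun w J => ∃ L P : List ℂ, Enumerates L J.F ∧ Enumerates P J.S ∧
    w = (J.s : ℝ) :: (L.length : ℝ) :: (encPoints L ++ (P.length : ℝ) :: encPoints P)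
  Answers := fun w J => Decides w
    (∃ F' : Finset ℂ, F' ≠ J.F ∧ F' ⊆ J.S ∧ ∀ i, xray (o i) F' = xray (o i) J.F)

end ModelSet

end

/-!
Every point of a solution is the intersection of two lines, in two fixed directions, from the
supports of the data. So the solutions lie in a grid `G` of at most `s ^ 2` points. The grid is
computable because, for two directions in `ℚ(ζ)`, the projection along one of them to the other
maps the field `ℚ(ζ)` to itself, if this field is closed under complex conjugation.

A finite set `F ⊆ G` is contained in a `W°`-set if and only if its points are congruent modulo
`ℤ[ζ]` to one of them, `v 0`, and `F⋆` fits into a translate of the interior of the polyhedron. The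
second condition depends only on the values of the `l` linear forms `z ↦ (A z⋆) i` at points
`v (i + 1)` of `F` where they are maximal: it is the feasibility of a system of strict linear
inequalities in the translation vector, whose left hand side does not depend on the data, so that
elimination reduces it to a fixed list of inequalities. For each of the at most `s ^ (2 * (l + 1))`
tuples `v` of points of `G` that pass this test, the points `z` of `G` with `z - v 0 ∈ ℤ[ζ]` and
`(A z⋆) i ≤ (A (v (i + 1))⋆) i` for all `i` form a subset of a `W°`-set, and every solution is a
subset of one of these sets. So it suffices to call the oracle once for each of them.
-/

noncomputable section

namespace RealRAM

/-! ### Polynomial growth -/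

/-- Functions of at most polynomial growth. -/
def PolyBounded (f : ℕ → ℕ) : Prop := ∃ C k : ℕ, ∀ s, f s ≤ C * (s + 1) ^ k

namespace PolyBounded

variable {f g : ℕ → ℕ}

theorem const (c : ℕ) : PolyBounded fun _ => c :=
  ⟨c, 0, fun s => by simp⟩

theorem id : PolyBounded fun s => s :=
  ⟨1, 1, fun s => by simp⟩

theorem add (hf : PolyBounded f) (hg : PolyBounded g) : PolyBounded fun s => f s + g s := by
  obtain ⟨C, k, hC⟩ := hf
  obtain ⟨D, l, hD⟩ := hg
  refine ⟨C + D, k + l, fun s => ?_⟩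
  calc f s + g s ≤ C * (s + 1) ^ k + D * (s + 1) ^ l := add_le_add (hC s) (hD s)
    _ ≤ C * (s + 1) ^ (k + l) + D * (s + 1) ^ (k + l) := by gcongr <;> omega
    _ = (C + D) * (s + 1) ^ (k + l) := by ring

theorem mul (hf : PolyBounded f) (hg : PolyBounded g) : PolyBounded fun s => f s * g s := by
  obtain ⟨C, k, hC⟩ := hf
  obtain ⟨D, l, hD⟩ := hg
  refine ⟨C * D, k + l, fun s => ?_⟩
  calc f s * g s ≤ (C * (s + 1) ^ k) * (D * (s + 1) ^ l) := Nat.mul_le_mul (hC s) (hD s)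
    _ = C * D * (s + 1) ^ (k + l) := by ring

theorem comp (hf : PolyBounded f) (hg : PolyBounded g) : PolyBounded fun s => f (g s) := by
  obtain ⟨C, k, hC⟩ := hf
  obtain ⟨D, l, hD⟩ := hg
  refine ⟨C * (D + 1) ^ k, l * k, fun s => ?_⟩
  have hone : 1 ≤ (s + 1) ^ l := Nat.one_le_pow _ _ (by omega)
  calc f (g s) ≤ C * (g s + 1) ^ k := hC _
    _ ≤ C * ((D + 1) * (s + 1) ^ l) ^ k := by
        gcongr
        linarith [hD s]
    _ = C * (D + 1) ^ k * (s + 1) ^ (l * k) := by rw [mul_pow, ← pow_mul, mul_assoc]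

end PolyBounded

/-! ### Frames -/

/-- The registers that a program may change. -/
def Prog.regs : Prog → Set ℕ
  | .skip => ∅
  | .setReg r _ => {r}
  | .setCell _ _ _ => ∅
  | .seq p q => p.regs ∪ q.regs
  | .ite _ p q => p.regs ∪ q.regs
  | .loop _ p => p.regs
  | .call _ r => {r}

/-- The arrays that a program may change. -/
def Prog.arrays : Prog → Set ℕ
  | .skip => ∅
  | .setReg _ _ => ∅
  | .setCell a _ _ => {a}
  | .seq p q => p.arrays ∪ q.arrays
  | .ite _ p q => p.arrays ∪ q.arrays
  | .loop _ p => p.arrays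
  | .call _ _ => {3}

namespace State

@[simp] theorem setReg_mem (σ : State) (r v : ℕ) : (σ.setReg r v).mem = σ.mem := rfl

@[simp] theorem setReg_reg (σ : State) (r v r' : ℕ) :
    (σ.setReg r v).reg r' = if r' = r then v else σ.reg r' := by
  simp [setReg, Function.update_apply]

@[simp] theorem setCell_reg (σ : State) (a i : ℕ) (x : ℝ) : (σ.setCell a i x).reg = σ.reg := rfl

@[simp] theorem setCell_mem (σ : State) (a i : ℕ) (x : ℝ) (a' : ℕ) :
    (σ.setCell a i x).mem a' = if a' = a then Function.update (σ.mem a) i x else σ.mem a' := by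
  simp [setCell, Function.update_apply]

@[simp] theorem write_reg (σ : State) (a : ℕ) (w : List ℝ) : (σ.write a w).reg = σ.reg := rfl

@[simp] theorem write_mem (σ : State) (a : ℕ) (w : List ℝ) (a' : ℕ) :
    (σ.write a w).mem a' = if a' = a then (fun i => w.getD i (σ.mem a i)) else σ.mem a' := by
  simp [write, Function.update_apply]

@[simp] theorem eval_setCell (σ : State) (a i : ℕ) (x : ℝ) (e : NExp) :
    e.eval (σ.setCell a i x) = e.eval σ := by
  induction e <;> simp_all [NExp.eval]

/-- The states `σ` and `τ` differ at most in the registers `R` and in the arrays `A`: the frame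
condition of a program that runs from `σ` to `τ`. -/
structure EqOutside (R A : Set ℕ) (σ τ : State) : Prop where
  reg : ∀ r ∉ R, τ.reg r = σ.reg r
  mem : ∀ a ∉ A, τ.mem a = σ.mem a

namespace EqOutside

variable {R R' A A' : Set ℕ} {σ τ υ : State}

theorem refl (σ : State) : EqOutside R A σ σ := ⟨fun _ _ => rfl, fun _ _ => rfl⟩

theorem mono (h : EqOutside R A σ τ) (hR : R ⊆ R') (hA : A ⊆ A') : EqOutside R' A' σ τ :=
  ⟨fun r hr => h.reg r fun h' => hr (hR h'), fun a ha => h.mem a fun h' => ha (hA h')⟩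

theorem trans (h : EqOutside R A σ τ) (h' : EqOutside R A τ υ) : EqOutside R A σ υ :=
  ⟨fun r hr => (h'.reg r hr).trans (h.reg r hr), fun a ha => (h'.mem a ha).trans (h.mem a ha)⟩

theorem setReg {r : ℕ} (hr : r ∈ R) (σ : State) (v : ℕ) : EqOutside R A σ (σ.setReg r v) :=
  ⟨fun r' hr' => by simp [show r' ≠ r by rintro rfl; exact hr' hr], fun _ _ => rfl⟩

theorem setCell {a : ℕ} (ha : a ∈ A) (σ : State) (i : ℕ) (x : ℝ) :
    EqOutside R A σ (σ.setCell a i x) :=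
  ⟨fun _ _ => rfl, fun a' ha' => by simp [show a' ≠ a by rintro rfl; exact ha' ha]⟩

theorem write {a : ℕ} (ha : a ∈ A) (σ : State) (w : List ℝ) : EqOutside R A σ (σ.write a w) :=
  ⟨fun _ _ => rfl, fun a' ha' => by simp [show a' ≠ a by rintro rfl; exact ha' ha]⟩

end EqOutside

end State

namespace Run

variable {O : List ℝ → List ℝ} {p : Prog} {σ τ : State} {T : ℕ} {qs : List (List ℝ)}

theorem eqOutside (h : Run O p σ T qs τ) : State.EqOutside p.regs p.arrays σ τ := by
  induction h with
  | skip σ => exact .refl σ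
  | setReg r e σ => exact .setReg (Set.mem_singleton _) σ _
  | setCell a i e σ => exact .setCell (Set.mem_singleton _) σ _ _
  | seq _ _ hp hq =>
    exact (hp.mono Set.subset_union_left Set.subset_union_left).trans
      (hq.mono Set.subset_union_right Set.subset_union_right)
  | ite_true _ _ hp => exact hp.mono Set.subset_union_left Set.subset_union_left
  | ite_false _ _ hq => exact hq.mono Set.subset_union_right Set.subset_union_right
  | loop_true _ _ _ hp hl => exact hp.trans hl
  | loop_false _ => exact .refl _
  | call len r σ q _ =>
    exact (State.EqOutside.write (Set.mem_singleton _) σ _).trans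
      (.setReg (Set.mem_singleton _) _ _)

theorem length_le (h : Run O p σ T qs τ) : qs.length ≤ T := by
  induction h <;> try simp only [List.length_append, List.length_nil, List.length_cons]
  all_goals omega

end Run

/-! ### A program logic with built-in time bounds -/

/-- The number of operations of a program whose loops make at most `B` iterations each and whose
oracle calls have questions and answers of total length at most `B` each. -/
def Prog.cost (B : ℕ) : Prog → ℕ
  | .skip => 0
  | .setReg _ e => e.size + 1
  | .setCell _ i e => i.size + e.size + 1
  | .seq p q => p.cost B + q.cost B
  | .ite c p q => c.size + (p.cost B + q.cost B)
  | .loop c p => B * (c.size + p.cost B) + c.size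
  | .call len _ => len.size + 1 + B

theorem Prog.polyBounded_cost (p : Prog) : PolyBounded fun B => p.cost B := by
  induction p with
  | skip => exact .const _
  | setReg => exact .const _
  | setCell => exact .const _
  | seq _ _ hp hq => exact hp.add hq
  | ite _ _ _ hp hq => exact (PolyBounded.const _).add (hp.add hq)
  | loop _ _ hp => exact (PolyBounded.id.mul ((PolyBounded.const _).add hp)).add (.const _)
  | call => exact (PolyBounded.const _).add .id

/-- A weakest precondition for total correctness within bounded resources: from `σ`, the program `p`
halts in a state with property `Q` after at most `p.cost B` operations, and all its queries have
property `G`. -/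
def Wp (O : List ℝ → List ℝ) (G : List ℝ → Prop) (B : ℕ) (p : Prog) (Q : State → Prop)
    (σ : State) : Prop :=
  ∃ T qs τ, Run O p σ T qs τ ∧ T ≤ p.cost B ∧ (∀ q ∈ qs, G q) ∧ Q τ

/-- Consecutive execution of the programs in a list. -/
def Prog.block (ps : List Prog) : Prog := ps.foldr .seq .skip

/-- Run the register `r` from `0` to the content of the register `n`. -/
def Prog.count (r n : ℕ) (p : Prog) : Prog :=
  .seq (.setReg r (.const 0))
    (.loop (.natLt (.reg r) (.reg n)) (.seq p (.setReg r (.add (.reg r) (.const 1)))))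

/-- Write the values of a list of expressions to the array `a`, starting at the address `i`. -/
def Prog.store (a : ℕ) (i : NExp) : List RExp → Prog
  | [] => .skip
  | e :: es => .seq (.setCell a i e) (.store a (.add i (.const 1)) es)

/-- Set the register `r` to the natural number that is stored in the cell `i` of the array `a`.
Since index arithmetic cannot access real cells, this takes a loop. -/
def Prog.readNat (r a : ℕ) (i : NExp) : Prog :=
  .seq (.setReg r (.const 0))
    (.loop (.realLt (.ofNat (.reg r)) (.cell a i)) (.setReg r (.add (.reg r) (.const 1))))

namespace Prog

@[simp] theorem regs_count (r n : ℕ) (p : Prog) : (count r n p).regs = insert r p.regs := by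
  ext; simp [count, regs]

@[simp] theorem arrays_count (r n : ℕ) (p : Prog) : (count r n p).arrays = p.arrays := by
  simp [count, arrays]

@[simp] theorem regs_store (a : ℕ) (i : NExp) (es : List RExp) : (store a i es).regs = ∅ := by
  induction es generalizing i <;> simp_all [store, regs]

theorem arrays_store (a : ℕ) (i : NExp) (es : List RExp) : (store a i es).arrays ⊆ {a} := by
  induction es generalizing i with
  | nil => simp [store, arrays]
  | cons e es ih => exact Set.union_subset subset_rfl (ih _)

@[simp] theorem regs_readNat (r a : ℕ) (i : NExp) : (readNat r a i).regs = {r} := by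
  simp [readNat, regs]

@[simp] theorem arrays_readNat (r a : ℕ) (i : NExp) : (readNat r a i).arrays = ∅ := by
  simp [readNat, arrays]

end Prog

namespace Wp

variable {O : List ℝ → List ℝ} {G : List ℝ → Prop} {B : ℕ} {σ : State} {Q Q' : State → Prop}
  {p q : Prog} {c : Test}

theorem mono (h : Wp O G B p Q σ) (hQ : ∀ τ, Q τ → Q' τ) : Wp O G B p Q' σ := by
  obtain ⟨T, qs, τ, hrun, hT, hG, hτ⟩ := h
  exact ⟨T, qs, τ, hrun, hT, hG, hQ _ hτ⟩

theorem frame (h : Wp O G B p Q σ) :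
    Wp O G B p (fun τ => Q τ ∧ State.EqOutside p.regs p.arrays σ τ) σ := by
  obtain ⟨T, qs, τ, hrun, hT, hG, hτ⟩ := h
  exact ⟨T, qs, τ, hrun, hT, hG, hτ, hrun.eqOutside⟩

theorem skip (h : Q σ) : Wp O G B .skip Q σ :=
  ⟨_, _, _, .skip σ, le_rfl, by simp, h⟩

theorem setReg {r : ℕ} {e : NExp} (h : Q (σ.setReg r (e.eval σ))) :
    Wp O G B (.setReg r e) Q σ :=
  ⟨_, _, _, .setReg r e σ, le_rfl, by simp, h⟩

theorem setCell {a : ℕ} {i : NExp} {e : RExp} (h : Q (σ.setCell a (i.eval σ) (e.eval σ))) :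
    Wp O G B (.setCell a i e) Q σ :=
  ⟨_, _, _, .setCell a i e σ, le_rfl, by simp, h⟩

theorem seq (h : Wp O G B p (Wp O G B q Q) σ) : Wp O G B (.seq p q) Q σ := by
  obtain ⟨T, qs, τ, hrun, hT, hG, T', qs', τ', hrun', hT', hG', hτ'⟩ := h
  exact ⟨_, _, _, .seq hrun hrun', add_le_add hT hT',
    fun x hx => (List.mem_append.1 hx).elim (hG x) (hG' x), hτ'⟩

theorem ite (h1 : c.holds σ → Wp O G B p Q σ) (h2 : ¬ c.holds σ → Wp O G B q Q σ) :
    Wp O G B (.ite c p q) Q σ := by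
  by_cases hc : c.holds σ
  · obtain ⟨T, qs, τ, hrun, hT, hG, hτ⟩ := h1 hc
    exact ⟨_, _, _, .ite_true hc hrun, by simp only [Prog.cost]; omega, hG, hτ⟩
  · obtain ⟨T, qs, τ, hrun, hT, hG, hτ⟩ := h2 hc
    exact ⟨_, _, _, .ite_false hc hrun, by simp only [Prog.cost]; omega, hG, hτ⟩

theorem call {len : NExp} {r : ℕ} {w : List ℝ} (hw : σ.read 2 (len.eval σ) = w) (hG : G w)
    (hB : w.length + (O w).length ≤ B)
    (h : Q ((σ.write 3 (O w)).setReg r (O w).length)) : Wp O G B (.call len r) Q σ := by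
  refine ⟨_, _, _, .call len r σ w hw.symm, ?_, by simpa using hG, h⟩
  simp only [Prog.cost]; omega

theorem block_cons {ps : List Prog} (h : Wp O G B p (Wp O G B (.block ps) Q) σ) :
    Wp O G B (.block (p :: ps)) Q σ := .seq h

theorem block_ofFn {m : ℕ} {ps : Fin m → Prog} (Inv : ℕ → State → Prop)
    (hp : ∀ i : Fin m, ∀ σ, Inv i σ → Wp O G B (ps i) (Inv (i + 1)) σ) (h₀ : Inv 0 σ) :
    Wp O G B (.block (List.ofFn ps)) (Inv m) σ := by
  induction m generalizing σ Inv with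
  | zero => exact .skip h₀
  | succ m ih =>
    rw [List.ofFn_succ]
    refine block_cons ((hp 0 σ h₀).mono fun τ h => ?_)
    exact ih (fun i => Inv (i + 1)) (fun i => hp i.succ) h

theorem loop {N : ℕ} (Inv : ℕ → State → Prop) (hN : N ≤ B)
    (hc : ∀ i ≤ N, ∀ σ, Inv i σ → (c.holds σ ↔ i < N))
    (hp : ∀ i < N, ∀ σ, Inv i σ → Wp O G B p (Inv (i + 1)) σ) (h₀ : Inv 0 σ) :
    Wp O G B (.loop c p) (Inv N) σ := by
  have remaining : ∀ j ≤ N, ∀ σ, Inv (N - j) σ → ∃ T qs τ, Run O (.loop c p) σ T qs τ ∧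
      T ≤ j * (c.size + p.cost B) + c.size ∧ (∀ q ∈ qs, G q) ∧ Inv N τ := by
    intro j
    induction j with
    | zero =>
      intro _ σ h
      exact ⟨_, _, _, .loop_false (by rw [hc N le_rfl σ h]; simp), by simp, by simp, h⟩
    | succ j ih =>
      intro hj σ h
      obtain ⟨T, qs, τ, hrun, hT, hG, hτ⟩ := hp (N - (j + 1)) (by omega) σ h
      rw [show N - (j + 1) + 1 = N - j by omega] at hτ
      obtain ⟨T', qs', τ', hrun', hT', hG', hτ'⟩ := ih (by omega) τ hτ
      exact ⟨_, _, _, .loop_true ((hc _ (by omega) σ h).2 (by omega)) hrun hrun',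
        by rw [add_mul, one_mul]; omega,
        fun x hx => (List.mem_append.1 hx).elim (hG x) (hG' x), hτ'⟩
  obtain ⟨T, qs, τ, hrun, hT, hG, hτ⟩ := remaining N le_rfl σ (by simpa using h₀)
  refine ⟨T, qs, τ, hrun, hT.trans ?_, hG, hτ⟩
  simp only [Prog.cost]
  gcongr

theorem count {r n N : ℕ} (Inv : ℕ → State → Prop) (hN : N ≤ B) (hn : σ.reg n = N) (hnr : n ≠ r)
    (hr : r ∉ p.regs) (hnp : n ∉ p.regs)
    (hInv : ∀ i ≤ N, ∀ τ v, Inv i τ → Inv i (τ.setReg r v))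
    (hp : ∀ i < N, ∀ τ, τ.reg r = i → State.EqOutside (insert r p.regs) p.arrays σ τ → Inv i τ →
      Wp O G B p (Inv (i + 1)) τ) (h₀ : Inv 0 σ) :
    Wp O G B (.count r n p) (Inv N) σ := by
  have hn' : ∀ {τ}, State.EqOutside (insert r p.regs) p.arrays σ τ → τ.reg n = N := fun h =>
    (h.reg n (by simp [hnr, hnp])).trans hn
  refine .seq (.setReg ((Wp.loop (fun i τ => τ.reg r = i ∧
    State.EqOutside (insert r p.regs) p.arrays σ τ ∧ Inv i τ) hN ?_ ?_ ?_).mono fun τ h => h.2.2))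
  · rintro i - τ ⟨hi, hτ, -⟩
    simp only [Test.holds, NExp.eval, hi, hn' hτ]
  · rintro i hi τ ⟨rfl, hτ, h⟩
    refine .seq ((hp _ hi τ rfl hτ h).frame.mono fun υ ⟨hυ, hf⟩ => .setReg ?_)
    simp only [NExp.eval, hf.reg r hr]
    exact ⟨by simp, (hτ.trans (hf.mono (Set.subset_insert _ _) subset_rfl)).trans
      (.setReg (Set.mem_insert _ _) _ _), hInv _ hi _ _ hυ⟩
  · exact ⟨by simp [NExp.eval], .setReg (Set.mem_insert _ _) _ _, hInv 0 (Nat.zero_le _) _ _ h₀⟩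

theorem readNat {r a n : ℕ} {i : NExp} (hn : n ≤ B) (hi : ∀ v, i.eval (σ.setReg r v) = i.eval σ)
    (h : σ.mem a (i.eval σ) = n) :
    Wp O G B (.readNat r a i) (fun τ => τ = σ.setReg r n) σ := by
  refine .seq (.setReg (Wp.loop (fun k τ => τ = σ.setReg r k) hn ?_ ?_ (by simp [NExp.eval])))
  · rintro k - τ rfl
    simp [Test.holds, RExp.eval, NExp.eval, hi, h]
  · rintro k - τ rfl
    exact .setReg (by ext <;> simp [NExp.eval]; split_ifs <;> rfl)

end Wp

theorem polySolvableWithOracle_of_wp {P Q : Problem} {prog : Prog} {f : ℕ → ℕ}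
    (hf : PolyBounded f)
    (h : ∀ O : List ℝ → List ℝ, Q.SolvedBy O → ∀ (I : P.Inst) (w : List ℝ), P.Describes w I →
      Wp O (fun q => ∃ J : Q.Inst, Q.Describes q J ∧ Q.size J ≤ P.size I) (f (P.size I)) prog
        (fun τ => P.Answers τ.output I) (State.init w)) : PolySolvableWithOracle P Q := by
  obtain ⟨C, k, hC⟩ := prog.polyBounded_cost.comp hf
  refine ⟨prog, C, k, fun O hO I w hw => ?_⟩
  obtain ⟨T, qs, τ, hrun, hT, hG, hτ⟩ := h O hO I w hw
  exact ⟨T, qs, τ, hrun, hτ, hT.trans (hC _), hrun.length_le.trans (hT.trans (hC _)), hG⟩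

/-! ### Words in memory -/

/-- The word `w` stands in the array with contents `f`, from cell `off` on. -/
def Stored (f : ℕ → ℝ) (off : ℕ) (w : List ℝ) : Prop :=
  ∀ k < w.length, f (off + k) = w.getD k 0

section Stored

variable {f g : ℕ → ℝ} {off : ℕ} {v w : List ℝ} {x : ℝ}

@[simp] theorem stored_nil : Stored f off [] := by simp [Stored]

@[simp] theorem stored_cons :
    Stored f off (x :: w) ↔ f off = x ∧ Stored f (off + 1) w := by
  simp only [Stored, List.length_cons, Nat.forall_lt_succ_left, List.getD_cons_zero,
    List.getD_cons_succ, add_zero]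
  exact and_congr_right' (forall₂_congr fun k _ => by rw [add_right_comm, add_assoc])

theorem stored_append :
    Stored f off (v ++ w) ↔ Stored f off v ∧ Stored f (off + v.length) w := by
  induction v generalizing off with
  | nil => simp
  | cons y v ih => simp [ih, and_assoc, add_assoc, add_comm 1]

theorem Stored.congr (h : Stored f off w)
    (hfg : ∀ i, off ≤ i → i < off + w.length → g i = f i) : Stored g off w := fun k hk => by
  rw [hfg _ (by omega) (by omega), h k hk]

theorem Stored.update {i : ℕ} (h : Stored f off w) (x : ℝ) (hi : off + w.length ≤ i ∨ i < off) :
    Stored (Function.update f i x) off w :=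
  h.congr fun j _ _ => Function.update_of_ne (by omega) _ _

theorem Stored.update_append {i : ℕ} (h : Stored f off (v ++ x :: w)) (y : ℝ)
    (hi : i = off + v.length) : Stored (Function.update f i y) off (v ++ y :: w) := by
  subst hi
  simp only [stored_append, stored_cons, Function.update_self, true_and] at h ⊢
  exact ⟨h.1.update _ (by omega), h.2.2.update _ (by omega)⟩

theorem Stored.flatMap_getElem {α : Type*} {k i : ℕ} {L : List α} {e : α → List ℝ}
    (h : Stored f off (L.flatMap e)) (he : ∀ x, (e x).length = k) (hi : i < L.length) :
    Stored f (off + k * i) (e L[i]) := by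
  induction L generalizing off i with
  | nil => simp at hi
  | cons x L ih =>
    rw [List.flatMap_cons, stored_append, he] at h
    cases i with
    | zero => simpa using h.1
    | succ i => simpa [mul_add, add_assoc, add_comm k] using ih h.2 (by simpa using hi)

theorem Stored.ofFn_eq {d : ℕ} (h : Stored f off w) (hd : w.length = d) :
    (List.ofFn fun j : Fin d => f (off + j)) = w := by
  subst hd
  exact List.ext_getElem (by simp) fun i _ hi => by simpa [hi] using h i hi

theorem stored_write (σ : State) (a : ℕ) (w : List ℝ) : Stored ((σ.write a w).mem a) 0 w :=
  fun k hk => by simp [hk]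

theorem stored_init (w : List ℝ) : Stored ((State.init w).mem 0) 0 w :=
  fun k _ => by simp [State.init]

theorem State.read_eq_of_stored {σ : State} {a k : ℕ} (h : Stored (σ.mem a) 0 w)
    (hk : k = w.length) : σ.read a k = w := by
  subst hk
  refine List.ext_getElem (by simp [State.read]) fun i _ hi => ?_
  simpa [State.read, hi] using h i hi

end Stored

theorem Wp.store {O : List ℝ → List ℝ} {G : List ℝ → Prop} {B : ℕ} {σ : State} {a : ℕ} {i : NExp}
    {es : List RExp} {w xs : List ℝ} (hw : Stored (σ.mem a) 0 w) (hi : i.eval σ = w.length)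
    (hes : ∀ τ, State.EqOutside ∅ {a} σ τ → es.map (RExp.eval τ) = xs) :
    Wp O G B (.store a i es)
      (fun τ => Stored (τ.mem a) 0 (w ++ xs) ∧ State.EqOutside ∅ {a} σ τ) σ := by
  suffices h : Wp O G B (.store a i es) (fun τ => Stored (τ.mem a) 0 (w ++ xs)) σ from
    h.frame.mono fun τ h => ⟨h.1, h.2.mono (by simp) (Prog.arrays_store a i es)⟩
  induction es generalizing σ i w xs with
  | nil =>
    obtain rfl : [] = xs := hes σ (.refl σ)
    exact .skip (by simpa using hw)
  | cons e es ih =>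
    obtain rfl : e.eval σ :: es.map (RExp.eval σ) = xs := hes σ (.refl σ)
    have hσ : State.EqOutside ∅ {a} σ (σ.setCell a (i.eval σ) (e.eval σ)) :=
      .setCell (Set.mem_singleton _) _ _ _
    refine .seq (.setCell ?_)
    rw [List.append_cons]
    refine ih ?_ ?_ fun τ hτ => ?_
    · simp [stored_append, hi, hw.update]
    · simp [NExp.eval, hi]
    · exact (List.cons.inj (hes τ (hσ.trans hτ))).2

/-! ### Compound expressions -/

/-- The sum of a finite family of expressions. -/
def RExp.sum {d : ℕ} (f : Fin d → RExp) : RExp := (List.ofFn f).foldr .add (.const 0)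

@[simp] theorem RExp.eval_sum {d : ℕ} (f : Fin d → RExp) (σ : State) :
    (RExp.sum f).eval σ = ∑ i, (f i).eval σ := by
  rw [← List.sum_ofFn, RExp.sum, ← Function.comp_def (RExp.eval σ) f, ← List.map_ofFn]
  induction List.ofFn f with
  | nil => simp [RExp.eval]
  | cons a t ih => simp [RExp.eval, ih]

/-- The conjunction of a list of tests. -/
def Test.all (L : List Test) : Test := L.foldr .and (.natEq (.const 0) (.const 0))

@[simp] theorem Test.holds_all (L : List Test) (σ : State) :
    (Test.all L).holds σ ↔ ∀ c ∈ L, c.holds σ := by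
  unfold Test.all
  induction L with
  | nil => simp [Test.holds, NExp.eval]
  | cons a t ih => simp [Test.holds, ih]

variable {O : List ℝ → List ℝ} {G : List ℝ → Prop} {B : ℕ} {σ : State}

theorem State.EqOutside.output_eq {R A : Set ℕ} {τ : State} (h : State.EqOutside R A σ τ)
    (hR : 1 ∉ R) (hA : 1 ∉ A) : τ.output = σ.output := by
  simp only [State.output, State.read, h.reg 1 hR, h.mem 1 hA]

end RealRAM

namespace ModelSet

open RealRAM

/-! ### Exhaustive search with an oracle

The search programs keep to the following conventions. The array 2 holds the prefix `pre` of all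
queries, followed by the candidate points of the current query. Register 2 holds the length of
`pre`, register 3 the number `N` of indices, and the registers `20, 21, …` hold a tuple of indices.
Register 10 is the index of a point, 11 the number of candidates, 12 the length of an answer. -/

/-- Write those of the points `(x, y)` behind the query prefix that pass the test `c`, where the
register 10 runs through the indices. One cell is left free for the number of these points. -/
def collect (c : Test) (x y : RExp) : Prog :=
  .seq (.setReg 11 (.const 0)) (.count 10 3 (.ite c
    (.seq (.store 2 (.add (.add (.reg 2) (.const 1)) (.mul (.const 2) (.reg 11))) [x, y])
      (.setReg 11 (.add (.reg 11) (.const 1)))) .skip))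

/-- Make the answer of the oracle the output. -/
def copyAnswer : Prog :=
  .seq (.count 13 12 (.store 1 (.reg 13) [.cell 3 (.reg 13)])) (.setReg 1 (.reg 12))

/-- Query the oracle for the points `(x, y)` that pass the test `c`; keep a positive answer. -/
def query (c : Test) (x y : RExp) : Prog :=
  .seq (collect c x y) (.seq (.setCell 2 (.reg 2) (.ofNat (.reg 11)))
    (.seq (.call (.add (.add (.reg 2) (.const 1)) (.mul (.const 2) (.reg 11))) 12)
      (.ite (.realEq (.cell 3 (.const 0)) (.const 1)) copyAnswer .skip)))

/-- Run `p` for all `K`-tuples of indices. -/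
def nest (p : Prog) : ℕ → Prog
  | 0 => p
  | K + 1 => .count (20 + K) 3 (nest p K)

/-- Query the oracle for the empty set, and for the sets that are selected by `K`-tuples of
indices. -/
def search (K : ℕ) (c : Test) (x y : RExp) : Prog :=
  .seq (.setCell 1 (.const 0) (.const 0)) (.seq (.setReg 1 (.const 1))
    (.seq (query (.natLt (.const 0) (.const 0)) x y) (nest (query c x y) K)))

open Classical in
/-- The list of the points `pt i` for the indices `i < N` with property `M`. -/
def points (pt : ℕ → ℂ) (M : ℕ → Prop) (N : ℕ) : List ℂ :=
  ((List.range N).filter fun i => M i).map pt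

/-- The query with prefix `pre` and candidate points `P`. -/
def queryWord (pre : List ℝ) (P : List ℂ) : List ℝ := pre ++ (P.length : ℝ) :: encPoints P

/-- Both decision and construction problems are answered by a word with first entry `1` if and only
if there is a solution. -/
def Positive (w : List ℝ) : Prop := w.head? = some 1

theorem length_encPoints (L : List ℂ) : (encPoints L).length = 2 * L.length := by
  simp [encPoints, mul_comm]

theorem length_queryWord (pre : List ℝ) (P : List ℂ) :
    (queryWord pre P).length = pre.length + 1 + 2 * P.length := by
  simp [queryWord, length_encPoints]
  ring

section points

variable {pt : ℕ → ℂ} {M : ℕ → Prop} {N : ℕ}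

theorem mem_points {z : ℂ} : z ∈ points pt M N ↔ ∃ i < N, M i ∧ pt i = z := by
  simp [points, and_assoc]

@[simp] theorem points_false : points pt (fun _ => False) N = [] := by
  simp [points]

theorem points_succ_of_pos (h : M N) : points pt M (N + 1) = points pt M N ++ [pt N] := by
  simp [points, List.range_succ, h]

theorem points_succ_of_neg (h : ¬ M N) : points pt M (N + 1) = points pt M N := by
  simp [points, List.range_succ, h]

theorem length_points_le : (points pt M N).length ≤ N := by
  simpa [points] using List.length_filter_le _ (List.range N)

end points

theorem regs_collect (c : Test) (x y : RExp) : (collect c x y).regs = {10, 11} := by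
  ext; simp [collect, Prog.regs]

theorem arrays_collect (c : Test) (x y : RExp) : (collect c x y).arrays = {2} := by
  simp [collect, Prog.arrays, Prog.store]

theorem regs_query (c : Test) (x y : RExp) : (query c x y).regs = {1, 10, 11, 12, 13} := by
  ext; simp [query, copyAnswer, Prog.regs, regs_collect]; tauto

theorem arrays_query (c : Test) (x y : RExp) : (query c x y).arrays = {1, 2, 3} := by
  ext; simp [query, copyAnswer, Prog.arrays, arrays_collect, Prog.store]; tauto

variable {O : List ℝ → List ℝ} {G : List ℝ → Prop} {B N : ℕ} {σ : State} {pre : List ℝ}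
  {pt : ℕ → ℂ} {c : Test} {x y : RExp}

/-- The prefix of the queries and the number of indices are in their places. -/
structure SearchInput (pre : List ℝ) (N : ℕ) (σ : State) : Prop where
  stored : Stored (σ.mem 2) 0 pre
  reg_two : σ.reg 2 = pre.length
  reg_three : σ.reg 3 = N

/-- In all states that differ from `σ` only in the registers `R` and in the arrays 1, 2, 3, and have
an index `i < N` in the register 10, the test `c` decides whether `i` has property `M`, and if so,
the expressions `x` and `y` give the point `pt i`. -/
def Selects (R : Set ℕ) (σ : State) (N : ℕ) (c : Test) (x y : RExp) (pt : ℕ → ℂ) (M : ℕ → Prop) :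
    Prop :=
  ∀ τ, State.EqOutside R {1, 2, 3} σ τ → τ.reg 10 < N → (c.holds τ ↔ M (τ.reg 10)) ∧
    (M (τ.reg 10) → x.eval τ = (pt (τ.reg 10)).re ∧ y.eval τ = (pt (τ.reg 10)).im)

theorem SearchInput.eqOutside {R A : Set ℕ} {τ : State} (h : SearchInput pre N σ)
    (hτ : State.EqOutside R A σ τ) (h2 : 2 ∉ R) (h3 : 3 ∉ R) (hpre : Stored (τ.mem 2) 0 pre) :
    SearchInput pre N τ :=
  ⟨hpre, by rw [hτ.reg 2 h2, h.reg_two], by rw [hτ.reg 3 h3, h.reg_three]⟩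

/-- The query prefix and the candidate points `P` are in array 2, with one free cell in between. -/
structure Collected (pre : List ℝ) (P : List ℂ) (σ : State) : Prop where
  stored : ∃ free, Stored (σ.mem 2) 0 (pre ++ free :: encPoints P)
  reg_eleven : σ.reg 11 = P.length

theorem wp_collect {M : ℕ → Prop} (hσ : SearchInput pre N σ) (hN : N ≤ B)
    (hsel : Selects {10, 11} σ N c x y pt M) :
    Wp O G B (collect c x y) (Collected pre (points pt M N)) σ := by
  refine .seq (.setReg (.count (fun i τ => Collected pre (points pt M i) τ) hN ?_ (by simp)
    (by simp [Prog.regs]) (by simp [Prog.regs]) ?_ ?_ ?_))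
  · simp [hσ.reg_three]
  · exact fun i _ τ v h => ⟨h.stored, by simp [h.reg_eleven]⟩
  · rintro i hi τ rfl hτ ⟨⟨free, hstored⟩, h11⟩
    replace hτ : State.EqOutside {10, 11} {2} σ τ :=
      (State.EqOutside.setReg (by simp) σ _).trans (hτ.mono (by simp [Prog.regs])
        (by simp [Prog.arrays, Prog.store]))
    have hτ' : State.EqOutside {10, 11} {1, 2, 3} σ τ := hτ.mono subset_rfl (by simp)
    obtain ⟨hM, -⟩ := hsel τ hτ' hi
    refine .ite (fun hc => ?_) fun hc => ?_
    · have hstore : Wp O G B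
          (.store 2 (.add (.add (.reg 2) (.const 1)) (.mul (.const 2) (.reg 11))) [x, y])
          (fun υ => Stored (υ.mem 2) 0 ((pre ++ free :: encPoints (points pt M (τ.reg 10))) ++
            [(pt (τ.reg 10)).re, (pt (τ.reg 10)).im]) ∧ State.EqOutside ∅ {2} τ υ) τ := by
        refine .store hstored ?_ fun υ hυ => ?_
        · simp [NExp.eval, hτ.reg 2 (by simp), hσ.reg_two, h11, length_encPoints]
          ring
        · have h10 : υ.reg 10 = τ.reg 10 := hυ.reg 10 (by simp)
          obtain ⟨hx, hy⟩ := (hsel υ (hτ'.trans (hυ.mono (by simp) (by simp))) (h10 ▸ hi)).2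
            (h10 ▸ hM.1 hc)
          simp [hx, hy, h10]
      refine .seq (hstore.mono fun υ ⟨hυ, hf⟩ => .setReg ?_)
      rw [points_succ_of_pos (hM.1 hc)]
      refine ⟨⟨free, ?_⟩, by simp [NExp.eval, hf.reg 11, h11]⟩
      simpa [encPoints] using hυ
    · rw [points_succ_of_neg (mt hM.2 hc)]
      exact .skip ⟨⟨free, hstored⟩, h11⟩
  · exact ⟨⟨σ.mem 2 pre.length, by simp [stored_append, points, encPoints, hσ.stored]⟩,
      by simp [points, NExp.eval]⟩

theorem wp_copyAnswer {w : List ℝ} (hw : Stored (σ.mem 3) 0 w) (h : σ.reg 12 = w.length)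
    (hB : w.length ≤ B) : Wp O G B copyAnswer (fun τ => τ.output = w) σ := by
  refine .seq (Wp.mono (Wp.count (fun i τ => Stored (τ.mem 1) 0 (w.take i)) hB h (by simp)
    (by simp) (by simp) (fun _ _ _ _ h => h) ?_ (by simp)).frame fun τ ⟨hτ, hf⟩ => .setReg ?_)
  · rintro i hi τ rfl hτ hstored
    refine (Wp.store (xs := [w[τ.reg 13]]) hstored ?_ fun υ hυ => ?_).mono fun υ hυ => ?_
    · simp [NExp.eval, hi.le]
    · have h3 : υ.mem 3 = σ.mem 3 :=
        (hυ.mem 3 (by simp)).trans (hτ.mem 3 (by simp [Prog.store, Prog.arrays]))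
      have := hw (τ.reg 13) hi
      simp_all [RExp.eval, NExp.eval, hυ.reg 13 (by simp)]
    · rw [List.take_add_one, List.getElem?_eq_getElem hi]
      exact hυ.1
  · refine State.read_eq_of_stored (by simpa using hτ) ?_
    simp [NExp.eval, hf.reg 12, h]

/-- The output after queries for the sets in `C`: either `0`, and all answers were negative, or one
of the positive answers. -/
def SearchState (O : List ℝ → List ℝ) (pre : List ℝ) (C : Set (List ℂ)) (σ : State) : Prop :=
  (σ.output = [0] ∧ ∀ P ∈ C, ¬ Positive (O (queryWord pre P))) ∨
    ∃ P ∈ C, Positive (O (queryWord pre P)) ∧ σ.output = O (queryWord pre P)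

theorem wp_query {M : ℕ → Prop} {C : Set (List ℂ)} (hσ : SearchInput pre N σ) (hN : N ≤ B)
    (hsel : Selects {10, 11} σ N c x y pt M) (hC : SearchState O pre C σ)
    (hG : G (queryWord pre (points pt M N))) (hO : O (queryWord pre (points pt M N)) ≠ [])
    (hB : (queryWord pre (points pt M N)).length + (O (queryWord pre (points pt M N))).length ≤ B) :
    Wp O G B (query c x y)
      (fun τ => SearchInput pre N τ ∧ SearchState O pre (insert (points pt M N) C) τ) σ := by
  suffices h : Wp O G B (query c x y) (fun τ => Stored (τ.mem 2) 0 pre ∧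
      SearchState O pre (insert (points pt M N) C) τ) σ from h.frame.mono fun τ ⟨hτ, hf⟩ =>
    ⟨hσ.eqOutside hf (by simp [regs_query]) (by simp [regs_query]) hτ.1, hτ.2⟩
  have hcollect := (wp_collect (O := O) (G := G) (B := B) hσ hN hsel).frame
  generalize points pt M N = P at *
  refine .seq (hcollect.mono fun τ ⟨⟨⟨free, hτ⟩, h11⟩, hf⟩ => ?_)
  obtain ⟨a, t, ha⟩ := List.exists_cons_of_ne_nil hO
  have h2 : τ.reg 2 = pre.length := (hf.reg 2 (by simp [regs_collect])).trans hσ.reg_two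
  have hq : Stored (Function.update (τ.mem 2) pre.length (P.length : ℝ)) 0 (queryWord pre P) :=
    hτ.update_append _ (by simp)
  refine .seq (.setCell (.seq (.call (w := queryWord pre P) ?_ hG hB
    (.ite (fun h => ?_) fun h => .skip ⟨?_, ?_⟩))))
  · refine State.read_eq_of_stored ?_ ?_
    · simpa [NExp.eval, RExp.eval, h2, h11] using hq
    · simp [NExp.eval, h2, h11, length_queryWord]
  · have ha1 : a = 1 := by simpa [Test.holds, RExp.eval, NExp.eval, ha] using h
    refine (wp_copyAnswer (by exact stored_write _ 3 _) (by simp) (by omega)).frame.mono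
      fun υ ⟨hυ, hf⟩ => ⟨?_, .inr ⟨P, Set.mem_insert _ _, by simp [Positive, ha, ha1], hυ⟩⟩
    rw [hf.mem 2 (by simp [copyAnswer, Prog.store, Prog.arrays])]
    simpa [NExp.eval, RExp.eval, h2, h11] using (stored_append.1 hq).1
  · simpa [NExp.eval, RExp.eval, h2, h11] using (stored_append.1 hq).1
  · have ha1 : a ≠ 1 := by simpa [Test.holds, RExp.eval, NExp.eval, ha] using h
    have hneg : ¬ Positive (O (queryWord pre P)) := by simp [Positive, ha, ha1]
    have hout : τ.output = σ.output :=
      hf.output_eq (by simp [regs_collect]) (by simp [arrays_collect])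
    refine hC.imp (fun hC => ⟨.trans ?_ hC.1, Set.forall_mem_insert.2 ⟨hneg, hC.2⟩⟩)
      fun ⟨P', hP', hpos, heq⟩ => ⟨P', .inr hP', hpos, .trans ?_ heq⟩
    all_goals simpa [State.output, State.read] using hout

theorem regs_nest (p : Prog) (K : ℕ) : (nest p K).regs = p.regs ∪ Set.Ico 20 (20 + K) := by
  induction K with
  | zero => simp [nest]
  | succ K ih =>
    ext r
    simp only [nest, Prog.regs_count, ih, Set.mem_insert_iff, Set.mem_union, Set.mem_Ico]
    grind

theorem arrays_nest (p : Prog) (K : ℕ) : (nest p K).arrays = p.arrays := by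
  induction K <;> simp_all [nest]

theorem setOf_lt_succ_eq_union_snoc {K i : ℕ} (hi : i < N) :
    {v : Fin (K + 1) → ℕ | (∀ k, v k < N) ∧ v (Fin.last K) < i + 1} =
      {v | (∀ k, v k < N) ∧ v (Fin.last K) < i} ∪
        (fun w : Fin K → ℕ => Fin.snoc (α := fun _ => ℕ) w i) '' {w | ∀ k, w k < N} := by
  ext v
  induction v using Fin.snocCases with
  | snoc w j =>
    simp [Fin.forall_fin_succ', Fin.snoc_inj]
    grind

theorem wp_nest {p : Prog} {K : ℕ} (Inv : Set (Fin K → ℕ) → State → Prop) (hN : N ≤ B)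
    (h3 : σ.reg 3 = N) (hp3 : 3 ∉ p.regs) (hp20 : ∀ r ∈ p.regs, r < 20)
    (hInv : ∀ T τ r i, 20 ≤ r → Inv T τ → Inv T (τ.setReg r i))
    (hp : ∀ T v τ, (∀ k, v k < N) → (∀ k : Fin K, τ.reg (20 + k) = v k) →
      State.EqOutside (nest p K).regs p.arrays σ τ → Inv T τ → Wp O G B p (Inv (insert v T)) τ)
    (h₀ : Inv ∅ σ) : Wp O G B (nest p K) (Inv {v | ∀ k, v k < N}) σ := by
  induction K generalizing σ with
  | zero =>
    refine (hp ∅ finZeroElim σ finZeroElim finZeroElim (.refl σ) h₀).mono fun τ hτ => ?_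
    convert hτ
    ext v
    simp [Subsingleton.elim v finZeroElim]
  | succ K ih =>
    have hregs : ∀ {r}, r ∈ (nest p K).regs → r ∈ p.regs ∨ 20 ≤ r ∧ r < 20 + K := by
      simp [regs_nest]
    have h20 : 20 + K ∉ (nest p K).regs := fun h => by grind
    have h3K : 3 ∉ (nest p K).regs := fun h => by grind
    refine (Wp.count (fun i => Inv {v | (∀ k, v k < N) ∧ v (Fin.last K) < i}) hN h3 (by omega)
      h20 h3K (fun i _ τ v => hInv _ _ _ _ (by omega)) ?_ (by simpa using h₀)).mono fun τ hτ => ?_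
    · rintro i hi τ hτi hτ h
      rw [setOf_lt_succ_eq_union_snoc hi]
      refine ih (fun T => Inv ({v | (∀ k, v k < N) ∧ v (Fin.last K) < i} ∪
        (fun w => Fin.snoc (α := fun _ => ℕ) w i) '' T)) ?_ (fun T => hInv _) ?_ (by simpa using h)
      · rw [hτ.reg 3 (by simp [h3K]; omega), h3]
      · intro T w υ hw hreg hυ hT
        rw [Set.image_insert_eq, Set.union_insert]
        have hυ' : State.EqOutside (nest p (K + 1)).regs p.arrays τ υ :=
          hυ.mono (by simp [nest]) subset_rfl
        refine hp _ _ υ ?_ ?_ (.trans (by simpa [nest, arrays_nest] using hτ) hυ') hT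
        · simp [Fin.forall_fin_succ', hw, hi]
        · simp [Fin.forall_fin_succ', hreg, hυ.reg _ h20, hτi]
    · convert hτ using 1
      ext v
      exact ⟨fun h => ⟨h, h _⟩, And.left⟩

theorem wp_search {K : ℕ} {M : (Fin K → ℕ) → ℕ → Prop} (hσ : SearchInput pre N σ) (hN : N ≤ B)
    (hsel : ∀ v τ, (∀ k, v k < N) → (∀ k : Fin K, τ.reg (20 + k) = v k) →
      State.EqOutside ({1, 10, 11, 12, 13} ∪ Set.Ico 20 (20 + K)) {1, 2, 3} σ τ →
      Selects {10, 11} τ N c x y pt (M v))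
    (hG : ∀ M, G (queryWord pre (points pt M N)))
    (hO : ∀ M, O (queryWord pre (points pt M N)) ≠ [])
    (hB : ∀ M, (queryWord pre (points pt M N)).length +
      (O (queryWord pre (points pt M N))).length ≤ B) :
    Wp O G B (search K c x y) (SearchState O pre
      (insert [] ((fun v => points pt (M v) N) '' {v | ∀ k, v k < N}))) σ := by
  refine .seq (.setCell (.seq (.setReg (.seq ?_))))
  set τ := State.setReg _ 1 _ with hτ_def
  have hτ : State.EqOutside {1} {1} σ τ := (State.EqOutside.setCell (by simp) _ _ _).trans
    (.setReg (by simp) _ _)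
  have hout : SearchState O pre ∅ τ := .inl (by simp [hτ_def, State.output, State.read, NExp.eval,
    RExp.eval])
  refine (wp_query (hσ.eqOutside hτ (by simp) (by simp) ?_) hN (M := fun _ => False)
    (fun υ _ _ => ?_) hout (hG _) (hO _) (hB _)).frame.mono fun υ ⟨⟨hυ, hfirst⟩, hf⟩ => ?_
  · rw [hτ.mem 2 (by simp)]
    exact hσ.stored
  · simp [Test.holds, NExp.eval]
  refine (wp_nest (fun T τ => SearchInput pre N τ ∧ SearchState O pre
    (insert [] ((fun v => points pt (M v) N) '' T)) τ) hN hυ.reg_three (by simp [regs_query])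
    (by simp [regs_query]) ?_ ?_ ⟨hυ, by simpa using hfirst⟩).mono fun _ h => h.2
  · rintro T τ r i hr ⟨hτ, h⟩
    have hf : State.EqOutside {r} ∅ τ (τ.setReg r i) := .setReg (by simp) _ _
    refine ⟨hτ.eqOutside hf (by grind) (by grind) hτ.stored, ?_⟩
    rwa [SearchState, hf.output_eq (by grind) (by simp)]
  · rintro T v τ' hv hreg hτ' ⟨hin, hstate⟩
    rw [regs_nest, regs_query, arrays_query] at hτ'
    rw [regs_query, arrays_query] at hf
    have hframe := ((hτ.mono (by simp) (by simp)).trans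
      (hf.mono Set.subset_union_left subset_rfl)).trans hτ'
    refine (wp_query hin hN (hsel v τ' hv hreg hframe) hstate (hG _) (hO _) (hB _)).mono
      fun _ ⟨hin', h⟩ => ⟨hin', ?_⟩
    rwa [Set.image_insert_eq, Set.insert_comm]

/-! ### Systems of strict linear inequalities -/

section Elimination

variable {𝕜 E : Type*} [Field 𝕜] [LinearOrder 𝕜] [IsStrictOrderedRing 𝕜] [AddCommGroup E]
  [Module 𝕜 E]

/-- Fourier–Motzkin elimination of the direction `d`: the inequalities in which `d` does not
occur, and the combinations of two inequalities in which `d` cancels. -/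
def eliminate (d : E) (Ls : List (E →ₗ[𝕜] 𝕜)) : List (E →ₗ[𝕜] 𝕜) :=
  Ls.filter (fun φ => φ d = 0) ++ (Ls.filter fun φ => 0 < φ d).flatMap fun φ =>
    (Ls.filter fun φ' => φ' d < 0).map fun φ' => φ d • φ' - φ' d • φ

theorem forall_mem_eliminate {d x : E} {Ls : List (E →ₗ[𝕜] 𝕜)} :
    (∀ ψ ∈ eliminate d Ls, ψ x < 0) ↔ (∀ φ ∈ Ls, φ d = 0 → φ x < 0) ∧
      ∀ φ ∈ Ls, 0 < φ d → ∀ φ' ∈ Ls, φ' d < 0 → φ d * φ' x < φ' d * φ x := by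
  simp only [eliminate, List.forall_mem_append, List.forall_mem_flatMap, List.forall_mem_map,
    List.forall_mem_filter, decide_eq_true_eq, LinearMap.sub_apply, LinearMap.smul_apply,
    smul_eq_mul, sub_neg]

theorem forall_mem_eliminate_iff_exists (d x : E) (Ls : List (E →ₗ[𝕜] 𝕜)) :
    (∀ ψ ∈ eliminate d Ls, ψ x < 0) ↔ ∃ t : 𝕜, ∀ φ ∈ Ls, φ (x + t • d) < 0 := by
  rw [forall_mem_eliminate]
  simp only [map_add, map_smul, smul_eq_mul]
  constructor
  · rintro ⟨hzero, hpair⟩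
    obtain ⟨t, hlower, hupper⟩ := Order.exists_between_finsets
      ((Ls.filter fun φ' => φ' d < 0).map fun φ' => -φ' x / φ' d).toFinset
      ((Ls.filter fun φ => 0 < φ d).map fun φ => -φ x / φ d).toFinset <| by
        simp only [List.mem_toFinset, List.mem_map, List.mem_filter, decide_eq_true_eq]
        rintro - ⟨φ', ⟨hφ', hneg⟩, rfl⟩ - ⟨φ, ⟨hφ, hpos⟩, rfl⟩
        rw [lt_div_iff₀ hpos, div_mul_eq_mul_div, div_lt_iff_of_neg hneg]
        linarith [hpair φ hφ hpos φ' hφ' hneg]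
    simp only [List.mem_toFinset, List.mem_map, List.mem_filter, decide_eq_true_eq,
      forall_exists_index, and_imp] at hlower hupper
    refine ⟨t, fun φ hφ => ?_⟩
    rcases lt_trichotomy (φ d) 0 with hd | hd | hd
    · linarith [(div_lt_iff_of_neg hd).1 (hlower _ φ hφ hd rfl)]
    · simpa [hd] using hzero φ hφ hd
    · linarith [(lt_div_iff₀ hd).1 (hupper _ φ hφ hd rfl)]
  · rintro ⟨t, ht⟩
    refine ⟨fun φ hφ hd => by simpa [hd] using ht φ hφ, fun φ hφ hpos φ' hφ' hneg => ?_⟩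
    have h : φ d * (φ' x + t * φ' d) < φ' d * (φ x + t * φ d) :=
      (mul_neg_of_pos_of_neg hpos (ht φ' hφ')).trans (mul_pos_of_neg_of_neg hneg (ht φ hφ))
    linarith

theorem exists_elimination (P : Submodule 𝕜 E) (hP : P.FG) (Ls : List (E →ₗ[𝕜] 𝕜)) :
    ∃ Ls' : List (E →ₗ[𝕜] 𝕜), ∀ x,
      (∀ ψ ∈ Ls', ψ x < 0) ↔ ∃ y ∈ P, ∀ φ ∈ Ls, φ (x + y) < 0 := by
  induction P, hP using Submodule.fg_induction generalizing Ls with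
  | singleton d =>
    exact ⟨eliminate d Ls, fun x => by
      simp [forall_mem_eliminate_iff_exists, Submodule.mem_span_singleton]⟩
  | sup P₁ P₂ _ _ h₁ h₂ =>
    obtain ⟨Ls₁, h₁⟩ := h₁ Ls
    obtain ⟨Ls₂, h₂⟩ := h₂ Ls₁
    refine ⟨Ls₂, fun x => ?_⟩
    simp only [h₂, h₁, Submodule.mem_sup]
    constructor
    · rintro ⟨y₂, hy₂, y₁, hy₁, h⟩
      exact ⟨_, ⟨y₁, hy₁, y₂, hy₂, rfl⟩, by simpa only [add_assoc, add_comm y₁ y₂] using h⟩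
    · rintro ⟨_, ⟨y₁, hy₁, y₂, hy₂, rfl⟩, h⟩
      exact ⟨y₂, hy₂, y₁, hy₁, by simpa only [add_assoc, add_comm y₁ y₂] using h⟩

theorem exists_feasibility_test {ι κ : Type*} [Fintype ι] [Fintype κ] (A : Matrix ι κ 𝕜) :
    ∃ Λ : List (ι → 𝕜), ∀ u : ι → 𝕜,
      (∀ c ∈ Λ, c ⬝ᵥ u < 0) ↔ ∃ τ : κ → 𝕜, ∀ i, u i < A.mulVec τ i := by
  classical
  obtain ⟨Ls, h⟩ := exists_elimination (LinearMap.range A.mulVecLin)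
    (IsNoetherian.noetherian _) (Finset.univ.toList.map fun i : ι => LinearMap.proj i)
  refine ⟨Ls.map (dotProductEquiv 𝕜 ι).symm, fun u => ?_⟩
  have hφ (φ : (ι → 𝕜) →ₗ[𝕜] 𝕜) : (dotProductEquiv 𝕜 ι).symm φ ⬝ᵥ u = φ u :=
    LinearMap.congr_fun ((dotProductEquiv 𝕜 ι).apply_symm_apply φ) u
  simp only [List.forall_mem_map, hφ, h]
  constructor
  · rintro ⟨_, ⟨τ, rfl⟩, hτ⟩
    exact ⟨-τ, fun i => by simpa [Matrix.mulVec_neg, ← sub_neg, add_comm] using hτ i (by simp)⟩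
  · rintro ⟨τ, hτ⟩
    exact ⟨_, ⟨-τ, rfl⟩, fun i _ => by simpa [Matrix.mulVec_neg] using hτ i⟩

end Elimination

/-! ### The interior of a polyhedron -/

section Interior

variable {κ : Type*} [Fintype κ]

theorem interior_halfSpace {a : κ → ℝ} (ha : a ≠ 0) (c : ℝ) :
    interior {x | a ⬝ᵥ x ≤ c} = {x | a ⬝ᵥ x < c} := by
  classical
  let f : (κ → ℝ) →ₗ[ℝ] ℝ := dotProductEquiv ℝ κ a
  have hf : Function.Surjective f :=
    LinearMap.surjective ((dotProductEquiv ℝ κ).map_ne_zero_iff.2 ha)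
  have hopen := f.isOpenMap_of_finiteDimensional hf
  have h := hopen.preimage_interior_eq_interior_preimage f.continuous_of_finiteDimensional
    (Set.Iic c)
  rw [interior_Iic] at h
  exact h.symm

/-- Right-hand sides that describe the interior of the polyhedron `A x ≤ b` by strict
inequalities. If a row of `A` vanishes, its inequality holds either everywhere or nowhere. -/
def interiorBound {ι : Type*} (A : Matrix ι κ ℝ) (b : ι → ℝ) (i : ι) : ℝ :=
  open Classical in if A i = 0 then (if 0 ≤ b i then 1 else 0) else b i

theorem mem_interior_polyhedron {k l : ℕ} {A : Matrix (Fin l) (Fin k × Fin 2) ℝ} {b : Fin l → ℝ}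
    {x : Internal k} :
    x ∈ interior (polyhedron A b) ↔ ∀ i, A.mulVec x i < interiorBound A b i := by
  have h (i : Fin l) : interior {x | A i ⬝ᵥ x ≤ b i} = {x | A i ⬝ᵥ x < interiorBound A b i} := by
    unfold interiorBound
    split_ifs with h0 hb
    · simp [h0, hb]
    · simp [h0, hb]
    · exact interior_halfSpace h0 _
  rw [polyhedron, Set.ofPred_forall, interior_iInter_of_finite, Set.mem_iInter]
  exact forall_congr' fun i => Set.ext_iff.1 (h i) x

end Interior

/-! ### Coordinates -/

section Coordinates

variable {ζ : ℂ} {d : ℕ}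

theorem ringO_le_fieldK {x : ℂ} (hx : x ∈ ringO ζ) : x ∈ fieldK ζ := by
  have h : ringO ζ ≤ (fieldK ζ).toSubalgebra.restrictScalars ℤ :=
    Algebra.adjoin_singleton_le (IntermediateField.mem_adjoin_simple_self ℚ ζ)
  exact h hx

theorem star_mem_fieldK (hζ : star ζ ∈ fieldK ζ) {x : ℂ} (hx : x ∈ fieldK ζ) :
    star x ∈ fieldK ζ := by
  have h : fieldK ζ ≤ (fieldK ζ).comap (Complex.conjAe.toAlgHom.restrictScalars ℚ) :=
    IntermediateField.adjoin_simple_le_iff.2 hζ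
  exact h hx

/-- The basis `1, ζ, …, ζ ^ (d - 1)` of the field `ℚ(ζ)`, where `ζ` is an algebraic integer of
degree `d`. -/
def coordBasis (hζ : IsIntegral ℤ ζ) (hd : (minpoly ℤ ζ).natDegree = d) :
    Module.Basis (Fin d) ℚ (fieldK ζ) :=
  (IntermediateField.adjoin.powerBasis (K := ℚ) hζ.tower_top).basis.reindex <| finCongr <| by
    rw [IntermediateField.adjoin.powerBasis_dim, ← hd,
      minpoly.isIntegrallyClosed_eq_field_fractions' ℚ hζ,
      (minpoly.monic hζ).natDegree_map]

theorem coe_coordBasis (hζ : IsIntegral ℤ ζ) (hd : (minpoly ℤ ζ).natDegree = d) (j : Fin d) :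
    (coordBasis hζ hd j : ℂ) = ζ ^ (j : ℕ) := by
  simp [coordBasis, IntermediateField.adjoin.powerBasis_gen]

theorem ofCoords_mem_ringO (c : Fin d → ℤ) : ofCoords ζ c ∈ ringO ζ := by
  refine Subalgebra.sum_mem _ fun j _ => Subalgebra.mul_mem _ ?_ (Subalgebra.pow_mem _ ?_ _)
  · exact_mod_cast (ringO ζ).algebraMap_mem (c j)
  · exact Algebra.subset_adjoin rfl

theorem exists_ofCoords (hζ : IsIntegral ℤ ζ) (hd : (minpoly ℤ ζ).natDegree = d) {x : ℂ}
    (hx : x ∈ ringO ζ) : ∃ c : Fin d → ℤ, x = ofCoords ζ c := by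
  subst hd
  let pb := Algebra.adjoin.powerBasis' hζ
  have hgen : (pb.gen : ℂ) = ζ := by rw [Algebra.adjoin.powerBasis'_gen]
  refine ⟨fun j => pb.basis.repr ⟨x, hx⟩ j, ?_⟩
  refine (congrArg Subtype.val (pb.basis.sum_repr ⟨x, hx⟩)).symm.trans ?_
  simp only [ofCoords, AddSubmonoidClass.coe_finsetSum]
  refine Finset.sum_congr rfl fun j _ => ?_
  simp [hgen]

variable (hζ : IsIntegral ℤ ζ) (hd : (minpoly ℤ ζ).natDegree = d)

/-- The point of `ℤ[ζ]` with coordinates `c`, as an element of `ℚ(ζ)`. -/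
def modulePoint (ζ : ℂ) (c : Fin d → ℤ) : fieldK ζ :=
  ⟨ofCoords ζ c, ringO_le_fieldK (ofCoords_mem_ringO c)⟩

theorem modulePoint_eq_sum (c : Fin d → ℤ) :
    modulePoint ζ c = ∑ j, (c j : ℚ) • coordBasis hζ hd j :=
  Subtype.ext (by simp [modulePoint, ofCoords, coe_coordBasis, Algebra.smul_def])

theorem repr_modulePoint (c : Fin d → ℤ) (j : Fin d) :
    (coordBasis hζ hd).repr (modulePoint ζ c) j = c j := by
  rw [modulePoint_eq_sum hζ hd, Module.Basis.repr_sum_self]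

theorem mem_ringO_iff {z : fieldK ζ} :
    (z : ℂ) ∈ ringO ζ ↔ ∀ j, ∃ k : ℤ, (coordBasis hζ hd).repr z j = k := by
  constructor
  · intro h j
    obtain ⟨c, hc⟩ := exists_ofCoords hζ hd h
    rw [show z = modulePoint ζ c from Subtype.ext hc, repr_modulePoint]
    exact ⟨c j, rfl⟩
  · intro h
    choose c hc using h
    have hz : z = modulePoint ζ c :=
      (coordBasis hζ hd).ext_elem fun j => by rw [hc, repr_modulePoint]
    exact hz ▸ ofCoords_mem_ringO c

end Coordinates

/-! ### Lines -/

section Lines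

variable {o o' a b x y z s t : ℂ} {F : Finset ℂ} {ℓ : LineIn o}

theorem mem_line_self (t o : ℂ) : t ∈ line t o := ⟨0, by simp⟩

theorem mem_line_comm : x ∈ line y o ↔ y ∈ line x o := by
  constructor <;> rintro ⟨r, rfl⟩ <;> exact ⟨-r, by push_cast; ring⟩

theorem mem_line_trans (hx : x ∈ line y o) (hy : y ∈ line z o) : x ∈ line z o := by
  obtain ⟨r, rfl⟩ := hx
  obtain ⟨r', rfl⟩ := hy
  exact ⟨r' + r, by push_cast; ring⟩

theorem mem_line_iff_eq_lineThrough : z ∈ ℓ.1 ↔ lineThrough z o = ℓ := by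
  obtain ⟨_, t, rfl⟩ := ℓ
  exact ⟨fun h => Subtype.ext (Set.ext fun w => ⟨fun hw => mem_line_trans hw h, fun hw =>
    mem_line_trans hw (mem_line_comm.1 h)⟩), fun h => congrArg Subtype.val h ▸ mem_line_self z o⟩

theorem lineThrough_eq_iff : lineThrough z o = lineThrough t o ↔ z ∈ line t o :=
  mem_line_iff_eq_lineThrough.symm

theorem add_mem_line_add_iff : s + z ∈ line (s + t) o ↔ z ∈ line t o := by
  simp only [line, Set.mem_ofPred_eq, add_assoc, add_right_inj]

theorem mem_line_iff_im_eq_zero (ho : o ≠ 0) : z ∈ line t o ↔ ((z - t) * star o).im = 0 := by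
  constructor
  · rintro ⟨r, rfl⟩
    simp
    ring
  · intro h
    obtain ⟨r, hr⟩ : ∃ r : ℝ, (z - t) * star o = r := ⟨_, (Complex.ext rfl (by simpa using h))⟩
    refine ⟨r / Complex.normSq o, ?_⟩
    have hstar : star o ≠ 0 := star_ne_zero.2 ho
    have hnorm : (Complex.normSq o : ℂ) = star o * o := Complex.normSq_eq_conj_mul_self
    push_cast
    rw [hnorm, ← hr]
    field_simp
    ring

theorem im_mul_star_ne_zero (h : LinearIndependent ℝ ![o, o']) : (o * star o').im ≠ 0 := by
  obtain ⟨ho', hpar⟩ := linearIndependent_fin2.1 h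
  intro him
  obtain ⟨r, hr⟩ := (mem_line_iff_im_eq_zero (z := o) (t := 0) ho').2 (by simpa using him)
  exact hpar r (by simpa using hr.symm)

theorem eq_of_mem_lines (h : LinearIndependent ℝ ![o, o']) (hxa : x ∈ line a o)
    (hxb : x ∈ line b o') (hya : y ∈ line a o) (hyb : y ∈ line b o') : x = y := by
  obtain ⟨r, hr⟩ := mem_line_trans hxa (mem_line_comm.1 hya)
  obtain ⟨r', hr'⟩ := mem_line_trans hxb (mem_line_comm.1 hyb)
  obtain ⟨rfl, -⟩ := LinearIndependent.pair_iff.1 h r (-r') (by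
    simp only [Complex.real_smul]
    push_cast
    linear_combination hr' - hr)
  simpa using hr

theorem xray_ne_zero_iff : xray o F ℓ ≠ 0 ↔ ∃ z ∈ F, lineThrough z o = ℓ := by
  rw [xray, Ne, Set.ncard_eq_zero (F.finite_toSet.inter_of_left _), ← Ne,
    ← Set.nonempty_iff_ne_empty]
  simp only [← mem_line_iff_eq_lineThrough]
  rfl

theorem support_xray (o : ℂ) (F : Finset ℂ) :
    Function.support (xray o F) = (fun z => lineThrough z o) '' (F : Set ℂ) :=
  Set.ext fun _ => xray_ne_zero_iff

end Lines

section Projection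

variable {ζ o o' : ℂ}

theorem ofReal_im_div_im_mem_fieldK (hζ : star ζ ∈ fieldK ζ) {x y : ℂ} (hx : x ∈ fieldK ζ)
    (hy : y ∈ fieldK ζ) : ((x.im / y.im : ℝ) : ℂ) ∈ fieldK ζ := by
  have him : ∀ z : ℂ, z - star z = (2 * z.im : ℝ) * Complex.I := Complex.sub_conj
  have h : ((x.im / y.im : ℝ) : ℂ) = (x - star x) / (y - star y) := by
    rw [him, him, mul_div_mul_right _ _ Complex.I_ne_zero, ← Complex.ofReal_div,
      mul_div_mul_left _ _ two_ne_zero]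
  rw [h]
  exact div_mem (sub_mem hx (star_mem_fieldK hζ hx)) (sub_mem hy (star_mem_fieldK hζ hy))

/-- The projection to `ℝ o` along `ℝ o'`, where `o` and `o'` are in the field `ℚ(ζ)`, which is
assumed to be closed under complex conjugation. -/
def projection (hζ : star ζ ∈ fieldK ζ) (ho : o ∈ fieldK ζ) (ho' : o' ∈ fieldK ζ) :
    fieldK ζ →ₗ[ℚ] fieldK ζ where
  toFun x := ⟨(((x : ℂ) * star o').im / (o * star o').im : ℝ) * o,
    mul_mem (ofReal_im_div_im_mem_fieldK hζ (mul_mem x.2 (star_mem_fieldK hζ ho'))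
      (mul_mem ho (star_mem_fieldK hζ ho'))) ho⟩
  map_add' x y := Subtype.ext (by simp [add_mul, add_div])
  map_smul' q x := Subtype.ext (by
    simp [Algebra.smul_def]
    ring)

variable {hζ : star ζ ∈ fieldK ζ} {ho : o ∈ fieldK ζ} {ho' : o' ∈ fieldK ζ}

theorem projection_mem_lines (h : LinearIndependent ℝ ![o, o']) (x : fieldK ζ) :
    (projection hζ ho ho' x : ℂ) ∈ line 0 o ∧ (projection hζ ho ho' x : ℂ) ∈ line x o' := by
  have ho'₀ : o' ≠ 0 := (linearIndependent_fin2.1 h).1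
  refine ⟨⟨_, (zero_add _).symm⟩, (mem_line_iff_im_eq_zero ho'₀).2 ?_⟩
  rw [sub_mul, Complex.sub_im, projection, LinearMap.coe_mk, AddHom.coe_mk, mul_assoc,
    Complex.im_ofReal_mul, div_mul_cancel₀ _ (im_mul_star_ne_zero h), sub_self]

/-- The intersection of the line in direction `o` through `a` with the line in direction `o'`
through `b`. -/
def intersection (hζ : star ζ ∈ fieldK ζ) (ho : o ∈ fieldK ζ) (ho' : o' ∈ fieldK ζ)
    (a b : fieldK ζ) : fieldK ζ := a + projection hζ ho ho' (b - a)

theorem intersection_mem_lines (h : LinearIndependent ℝ ![o, o']) (a b : fieldK ζ) :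
    (intersection hζ ho ho' a b : ℂ) ∈ line a o ∧ (intersection hζ ho ho' a b : ℂ) ∈ line b o' := by
  obtain ⟨h₁, h₂⟩ := projection_mem_lines (hζ := hζ) (ho := ho) (ho' := ho') h (b - a)
  rw [intersection, IntermediateField.coe_add]
  exact ⟨by simpa using (add_mem_line_add_iff (s := a)).2 h₁,
    by simpa using (add_mem_line_add_iff (s := a)).2 h₂⟩

theorem repr_intersection {d : ℕ} (B : Module.Basis (Fin d) ℚ (fieldK ζ)) (a b : fieldK ζ)
    (j : Fin d) : B.repr (intersection hζ ho ho' a b) j = B.repr a j +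
      ∑ j', B.repr (projection hζ ho ho' (B j')) j * (B.repr b j' - B.repr a j') := by
  have h := congrFun (LinearMap.toMatrix_mulVec_repr B B (projection hζ ho ho') (b - a)) j
  simp only [Matrix.mulVec, dotProduct, map_sub, Finsupp.sub_apply, LinearMap.toMatrix_apply] at h
  rw [intersection, map_add, Finsupp.add_apply, h, map_sub, map_sub, Finsupp.sub_apply]

end Projection

/-! ### Candidate sets -/

section Candidates

variable {ζ : ℂ} {k l : ℕ} (σ : Fin k → (fieldK ζ ≃ₐ[ℚ] fieldK ζ))
  (A : Matrix (Fin l) (Fin k × Fin 2) ℝ) (b : Fin l → ℝ)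

theorem starMap_add (z w : fieldK ζ) : starMap σ (z + w) = starMap σ z + starMap σ w := by
  ext ⟨j, i⟩
  fin_cases i <;> simp [starMap]

/-- The linear form `z ↦ (A z⋆) i`. -/
def starForm (i : Fin l) : fieldK ζ →ₗ[ℚ] ℝ :=
  (AddMonoidHom.mk' (fun z => A.mulVec (starMap σ z) i) fun z w => by
    rw [starMap_add, Matrix.mulVec_add, Pi.add_apply]).toRatLinearMap

theorem mulVec_starMap (z : fieldK ζ) (i : Fin l) :
    A.mulVec (starMap σ z) i = starForm σ A i z := rfl

/-- A translate of the interior of the polyhedron contains all `z⋆` such that `(A z⋆) i` is at most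
`(A w⋆) i` for all `i`, where `w` is the entry `i + 1` of `v`. -/
def Feasible (v : Fin (l + 1) → fieldK ζ) : Prop :=
  ∃ τ : Internal k, ∀ i : Fin l, starForm σ A i (v i.succ) - interiorBound A b i < A.mulVec τ i

/-- The point `z` is in the module coset of the first entry of `v`, and its linear forms do not
exceed those of the other entries of `v`. -/
def Selected (v : Fin (l + 1) → fieldK ζ) (z : fieldK ζ) : Prop :=
  ((z - v 0 : fieldK ζ) : ℂ) ∈ ringO ζ ∧ ∀ i : Fin l, starForm σ A i z ≤ starForm σ A i (v i.succ)

variable {σ A b} {t : ℂ}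

theorem exists_isWSet_of_feasible {v : Fin (l + 1) → fieldK ζ} (hv : Feasible σ A b v) :
    ∃ Λ, IsWSet σ (polyhedron A b) Λ ∧ ∀ z, Selected σ A v z → t + (z : ℂ) ∈ Λ := by
  obtain ⟨τ, hτ⟩ := hv
  refine ⟨_, ⟨t + v 0, τ - starMap σ (v 0), rfl⟩, fun z ⟨hmod, hle⟩ => ?_⟩
  refine ⟨z - v 0, hmod, ⟨starMap σ z - τ, mem_interior_polyhedron.2 fun i => ?_, ?_⟩, ?_⟩
  · rw [Matrix.mulVec_sub, Pi.sub_apply, mulVec_starMap]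
    linarith [hτ i, hle i]
  · have h := starMap_add σ (z - v 0) (v 0)
    rw [sub_add_cancel] at h
    simp only [h]
    abel
  · rw [AddSubgroupClass.coe_sub]
    ring

/-- The first entry of `v` may be any point of the set; entry `i + 1` is one with maximal
`(A z⋆) i`. -/
theorem exists_feasible_of_isWSet {F : Finset (fieldK ζ)} (hF : F.Nonempty) {Λ : Set ℂ}
    (hΛ : IsWSet σ (polyhedron A b) Λ) (hFΛ : ∀ z ∈ F, t + (z : ℂ) ∈ Λ) :
    ∃ v : Fin (l + 1) → fieldK ζ, (∀ q, v q ∈ F) ∧ Feasible σ A b v ∧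
      ∀ z ∈ F, Selected σ A v z := by
  obtain ⟨t', τ, rfl⟩ := hΛ
  choose! w hw hwτ heq using hFΛ
  have hbound : ∀ z ∈ F, ∀ i, starForm σ A i (w z) < A.mulVec τ i + interiorBound A b i := by
    intro z hz i
    obtain ⟨x, hx, hxz⟩ := hwτ z hz
    rw [← mulVec_starMap, ← hxz]
    simpa only [Matrix.mulVec_add, Pi.add_apply, add_lt_add_iff_left] using
      mem_interior_polyhedron.1 hx i
  have hsub : ∀ z ∈ F, ∀ z' ∈ F, z - z' = w z - w z' := fun z hz z' hz' => Subtype.ext (by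
    simp only [AddSubgroupClass.coe_sub]
    linear_combination heq z hz - heq z' hz')
  obtain ⟨z₀, hz₀⟩ := hF
  choose zmax hmem hmax using fun i => F.exists_max_image (starForm σ A i) ⟨z₀, hz₀⟩
  refine ⟨Fin.cons z₀ zmax, Fin.forall_fin_succ.2 ⟨hz₀, hmem⟩,
    ⟨τ + starMap σ (z₀ - w z₀), fun i => ?_⟩, fun z hz => ⟨?_, fun i => hmax i z hz⟩⟩
  · have h := congrArg (starForm σ A i) (hsub _ (hmem i) _ hz₀)
    simp only [Fin.cons_succ, Matrix.mulVec_add, Pi.add_apply, mulVec_starMap, map_sub] at h ⊢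
    linarith [hbound _ (hmem i) i]
  · rw [Fin.cons_zero, hsub z hz z₀ hz₀, AddSubgroupClass.coe_sub]
    exact sub_mem (hw z hz) (hw z₀ hz₀)

variable (σ A b) in
/-- Membership of the index `i` in the candidate set of the tuple `v` of indices, with respect to
the family `g` of points. -/
def IsCandidate (g : ℕ → fieldK ζ) (v : Fin (l + 1) → ℕ) (i : ℕ) : Prop :=
  Feasible σ A b (fun q => g (v q)) ∧ Selected σ A (fun q => g (v q)) (g i)

variable (σ A b t) in
/-- The candidate sets for the points `t + g i`, `i < N`: polynomially many sets that are contained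
in `W°`-sets, such that every intersection of these points with a `W°`-set is contained in one of
them. -/
def candidateSets (g : ℕ → fieldK ζ) (N : ℕ) : Set (List ℂ) :=
  insert [] ((fun v => points (fun i => t + (g i : ℂ)) (IsCandidate σ A b g v) N) ''
    {v | ∀ q, v q < N})

variable {g : ℕ → fieldK ζ} {N : ℕ}

theorem exists_isWSet_of_mem_candidateSets {P : List ℂ} (hP : P ∈ candidateSets σ A b t g N) :
    ∃ Λ, IsWSet σ (polyhedron A b) Λ ∧ ∀ z ∈ P, z ∈ Λ := by
  obtain rfl | ⟨v, -, rfl⟩ := hP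
  · exact ⟨_, ⟨0, 0, rfl⟩, by simp⟩
  · by_cases hv : Feasible σ A b fun q => g (v q)
    · obtain ⟨Λ, hΛ, h⟩ := exists_isWSet_of_feasible (t := t) hv
      refine ⟨Λ, hΛ, fun z hz => ?_⟩
      obtain ⟨i, -, hi, rfl⟩ := mem_points.1 hz
      exact h _ hi.2
    · refine ⟨_, ⟨0, 0, rfl⟩, fun z hz => ?_⟩
      obtain ⟨i, -, hi, -⟩ := mem_points.1 hz
      exact absurd hi.1 hv

theorem exists_mem_candidateSets {F : Finset ℂ} {Λ : Set ℂ}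
    (hΛ : IsWSet σ (polyhedron A b) Λ) (hFΛ : (F : Set ℂ) ⊆ Λ)
    (hF : ∀ z ∈ F, ∃ i < N, z = t + (g i : ℂ)) :
    ∃ P ∈ candidateSets σ A b t g N, ∀ z ∈ F, z ∈ P := by
  obtain rfl | ⟨z₀, hz₀⟩ := F.eq_empty_or_nonempty
  · exact ⟨[], Set.mem_insert _ _, by simp⟩
  choose! i hi hiF using hF
  obtain ⟨v, hv, hfeas, hsel⟩ := exists_feasible_of_isWSet (σ := σ) (A := A) (b := b) (t := t)
    (F := F.image fun z => g (i z)) ⟨_, Finset.mem_image_of_mem _ hz₀⟩ hΛ (by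
      simp only [Finset.forall_mem_image]
      exact fun z hz => hiF z hz ▸ hFΛ hz)
  simp only [Finset.mem_image] at hv
  choose f hf hfv using hv
  obtain rfl : (fun q => g (i (f q))) = v := funext hfv
  exact ⟨_, .inr ⟨fun q => i (f q), fun q => hi _ (hf q), rfl⟩, fun z hz => mem_points.2
    ⟨i z, hi z hz, ⟨hfeas, hsel _ (Finset.mem_image_of_mem _ hz)⟩, (hiF z hz).symm⟩⟩

end Candidates

/-! ### The grid of intersection points -/

section FieldLists

variable {ζ : ℂ} {d : ℕ} (β : Module.Basis (Fin d) ℚ (fieldK ζ))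

/-- The real numbers that represent an element of `ℚ(ζ)` in memory. -/
def coords (z : fieldK ζ) : List ℝ := List.ofFn fun j => (β.repr z j : ℝ)

/-- Coordinate `j` of entry `i` of the list of elements of `ℚ(ζ)` in array `a`. -/
def coordExp (a : ℕ) (i : NExp) (j : Fin d) : RExp :=
  .cell a (.add (.mul (.const d) i) (.const j))

/-- The value of a linear form at entry `i` of the list of elements of `ℚ(ζ)` in array `a`. -/
def formExp (φ : fieldK ζ →ₗ[ℚ] ℝ) (a : ℕ) (i : NExp) : RExp :=
  .sum fun j : Fin d => .mul (coordExp a i j) (.const (φ (β j)))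

variable {β} {L : List (fieldK ζ)} {a : ℕ} {i : NExp} {σ : State}

theorem length_coords (z : fieldK ζ) : (coords β z).length = d := by simp [coords]

theorem length_flatMap_coords (L : List (fieldK ζ)) :
    (L.flatMap (coords β)).length = d * L.length := by
  simp [List.length_flatMap, length_coords, mul_comm]

theorem eval_coordExp (h : Stored (σ.mem a) 0 (L.flatMap (coords β))) (hi : i.eval σ < L.length)
    (j : Fin d) : (coordExp a i j).eval σ = β.repr (L.getD (i.eval σ) 0) j := by
  have := (h.flatMap_getElem length_coords hi) j (by simp [length_coords])
  simpa [coordExp, RExp.eval, NExp.eval, coords, hi] using this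

theorem eval_formExp (h : Stored (σ.mem a) 0 (L.flatMap (coords β))) (hi : i.eval σ < L.length)
    (φ : fieldK ζ →ₗ[ℚ] ℝ) : (formExp β φ a i).eval σ = φ (L.getD (i.eval σ) 0) := by
  conv_rhs => rw [← β.sum_repr (L.getD (i.eval σ) 0)]
  simp only [formExp, RExp.eval_sum, RExp.eval, eval_coordExp h hi, map_sum, map_smul]
  exact Finset.sum_congr rfl fun j _ => (Rat.smul_def _ _).symm

end FieldLists

section Grid

variable {ζ o o' : ℂ} {d : ℕ} (β : Module.Basis (Fin d) ℚ (fieldK ζ)) (π : Module.End ℚ (fieldK ζ))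

/-- The intersections of the lines in direction `o` through the points of `L` with the lines in
direction `o'` through the points of `L'`. -/
def intersections (hζ : star ζ ∈ fieldK ζ) (ho : o ∈ fieldK ζ) (ho' : o' ∈ fieldK ζ)
    (L L' : List (fieldK ζ)) : List (fieldK ζ) :=
  (L.product L').map fun p => intersection hζ ho ho' p.1 p.2

/-- Append the intersections of a line in the array `a` with the lines in the array `a'` to the
list in array 4, whose length is in register 3. Here `π` is the projection along the second
direction. -/
def gridRow (a a' : ℕ) : Prog :=
  .count 7 a' (.seq
    (.store 4 (.mul (.const d) (.reg 3)) (List.ofFn fun j =>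
      .add (coordExp a (.reg 6) j) (.sum fun j' => .mul (.const (β.repr (π (β j')) j))
        (.sub (coordExp a' (.reg 7) j') (coordExp a (.reg 6) j')))))
    (.setReg 3 (.add (.reg 3) (.const 1))))

/-- List the intersections of the lines in the arrays `a` and `a'`. -/
def grid (a a' : ℕ) : Prog :=
  .seq (.setReg 3 (.const 0)) (.count 6 a (gridRow β π a a'))

variable {hζ : star ζ ∈ fieldK ζ} {ho : o ∈ fieldK ζ} {ho' : o' ∈ fieldK ζ} {L L' : List (fieldK ζ)}
  {t z : ℂ}

theorem length_intersections : (intersections hζ ho ho' L L').length = L.length * L'.length :=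
  (List.length_map _).trans (List.length_product L L')

theorem intersections_take_succ {i : ℕ} (hi : i < L.length) :
    intersections hζ ho ho' (L.take (i + 1)) L' =
      intersections hζ ho ho' (L.take i) L' ++ L'.map (intersection hζ ho ho' L[i]) := by
  simp only [intersections, List.take_add_one, List.getElem?_eq_getElem hi, List.product,
    Option.toList_some, List.flatMap_append, List.flatMap_singleton, List.map_append, List.map_map]
  rfl

theorem nodup_intersections (h : LinearIndependent ℝ ![o, o'])
    (hL : (L.map fun x : fieldK ζ => lineThrough (t + x) o).Nodup)
    (hL' : (L'.map fun x : fieldK ζ => lineThrough (t + x) o').Nodup) :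
    (intersections hζ ho ho' L L').Nodup := by
  refine (hL.of_map.product hL'.of_map).map_on fun ⟨x, x'⟩ hx ⟨y, y'⟩ hy hxy => ?_
  rw [List.pair_mem_product] at hx hy
  obtain ⟨h₁, h₁'⟩ := intersection_mem_lines (hζ := hζ) (ho := ho) (ho' := ho') h x x'
  obtain ⟨h₂, h₂'⟩ := intersection_mem_lines (hζ := hζ) (ho := ho) (ho' := ho') h y y'
  rw [← hxy] at h₂ h₂'
  refine Prod.ext (List.inj_on_of_nodup_map hL hx.1 hy.1 ?_)
    (List.inj_on_of_nodup_map hL' hx.2 hy.2 ?_)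
  · exact lineThrough_eq_iff.2 (add_mem_line_add_iff.2 (mem_line_trans (mem_line_comm.1 h₁) h₂))
  · exact lineThrough_eq_iff.2 (add_mem_line_add_iff.2 (mem_line_trans (mem_line_comm.1 h₁') h₂'))

theorem exists_mem_intersections (h : LinearIndependent ℝ ![o, o'])
    (hz : ∃ x ∈ L, z ∈ line (t + x) o) (hz' : ∃ x ∈ L', z ∈ line (t + x) o') :
    ∃ w ∈ intersections hζ ho ho' L L', z = t + w := by
  obtain ⟨x, hx, hzx⟩ := hz
  obtain ⟨x', hx', hzx'⟩ := hz'
  obtain ⟨h₁, h₂⟩ := intersection_mem_lines (hζ := hζ) (ho := ho) (ho' := ho') h x x'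
  exact ⟨_, List.mem_map_of_mem (List.pair_mem_product.2 ⟨hx, hx'⟩), eq_of_mem_lines h hzx hzx'
    (add_mem_line_add_iff.2 h₁) (add_mem_line_add_iff.2 h₂)⟩

theorem regs_gridRow (a a' : ℕ) : (gridRow β π a a').regs = {3, 7} := by
  ext; simp [gridRow, Prog.regs]; tauto

theorem arrays_gridRow (a a' : ℕ) :
    (gridRow β π a a').arrays ⊆ {4} := by
  simpa only [gridRow, Prog.arrays_count, Prog.arrays, Set.union_empty] using
    Prog.arrays_store _ _ _

theorem regs_grid (a a' : ℕ) : (grid β π a a').regs = {3, 6, 7} := by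
  ext; simp [grid, Prog.regs, regs_gridRow]; tauto

theorem arrays_grid (a a' : ℕ) : (grid β π a a').arrays ⊆ {4} := by
  simpa only [grid, Prog.arrays_count, Prog.arrays, Set.empty_union] using arrays_gridRow β π a a'

/-- The list `P` is in array 4, and its length in register 3. -/
structure GridState (P : List (fieldK ζ)) (σ : State) : Prop where
  stored : Stored (σ.mem 4) 0 (P.flatMap (coords β))
  reg_three : σ.reg 3 = P.length

variable {β} {a a' B : ℕ} {σ : State} {P : List (fieldK ζ)}
  {O : List ℝ → List ℝ} {G : List ℝ → Prop}

theorem GridState.setReg {r : ℕ} (h : GridState β P σ) (v : ℕ) (hr : 3 ≠ r) :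
    GridState β P (σ.setReg r v) :=
  ⟨h.stored, by simp [hr, h.reg_three]⟩

theorem wp_gridRow (hσ : GridState β P σ) (hL : Stored (σ.mem a) 0 (L.flatMap (coords β)))
    (hi : σ.reg 6 < L.length) (hL' : Stored (σ.mem a') 0 (L'.flatMap (coords β)))
    (ha' : σ.reg a' = L'.length) (h4 : 4 < a) (h7 : 7 < a') (hB : L'.length ≤ B) :
    Wp O G B (gridRow β (projection hζ ho ho') a a')
      (GridState β (P ++ L'.map (intersection hζ ho ho' (L.getD (σ.reg 6) 0)))) σ := by
  refine (Wp.count (fun j => GridState β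
    (P ++ (L'.take j).map (intersection hζ ho ho' (L.getD (σ.reg 6) 0)))) hB ha' h7.ne'
    (by simp [Prog.regs]) (by simp [Prog.regs]; omega) (fun _ _ _ v h => h.setReg v (by simp)) ?_
    (by simpa using hσ)).mono fun τ h => by simpa using h
  rintro j hj τ rfl hτ h
  replace hτ : State.EqOutside {3, 7} {4} σ τ := hτ.mono (by simp [Prog.regs, Set.pair_comm]) (by
    simpa only [Prog.arrays, Set.union_empty] using Prog.arrays_store _ _ _)
  refine .seq (.mono (.store (xs := coords β (intersection hζ ho ho' (L.getD (σ.reg 6) 0)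
    (L'.getD (τ.reg 7) 0))) h.stored ?_ fun υ hυ => ?_) fun υ ⟨hυ, hf⟩ => .setReg ⟨?_, ?_⟩)
  · simp only [NExp.eval, h.reg_three, length_flatMap_coords]
  · have h6 : υ.reg 6 = σ.reg 6 := (hυ.reg 6 (by simp)).trans (hτ.reg 6 (by simp))
    have h7 : υ.reg 7 = τ.reg 7 := hυ.reg 7 (by simp)
    have hυ' := hτ.trans (hυ.mono (by simp) subset_rfl)
    rw [← hυ'.mem a (by grind)] at hL
    rw [← hυ'.mem a' (by grind)] at hL'
    have h₁ : NExp.eval υ (.reg 6) = σ.reg 6 := h6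
    have h₂ : NExp.eval υ (.reg 7) = τ.reg 7 := h7
    rw [List.map_ofFn, coords]
    refine congrArg List.ofFn (funext fun j => ?_)
    have e₁ := eval_coordExp hL (h₁.trans_lt hi)
    have e₂ := eval_coordExp hL' (h₂.trans_lt hj)
    simp only [h₁] at e₁
    simp only [h₂] at e₂
    simp only [Function.comp_apply, RExp.eval, RExp.eval_sum, e₁, e₂]
    rw [repr_intersection]
    push_cast
    rfl
  · simpa only [State.setReg_mem, List.take_add_one, List.getElem?_eq_getElem hj,
      Option.toList_some, List.map_append, List.map_singleton, ← List.append_assoc,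
      List.flatMap_append, List.flatMap_singleton, List.getD_eq_getElem _ 0 hj] using hυ
  · simp [NExp.eval, hf.reg 3, h.reg_three, hj.le, Nat.succ_le_of_lt hj, add_assoc]

theorem wp_grid (hL : Stored (σ.mem a) 0 (L.flatMap (coords β))) (ha : σ.reg a = L.length)
    (hL' : Stored (σ.mem a') 0 (L'.flatMap (coords β))) (ha' : σ.reg a' = L'.length)
    (h7 : 7 < a) (h7' : 7 < a') (hB : L.length ≤ B) (hB' : L'.length ≤ B) :
    Wp O G B (grid β (projection hζ ho ho') a a')
      (GridState β (intersections hζ ho ho' L L')) σ := by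
  refine .seq (.setReg ((Wp.count (fun i => GridState β (intersections hζ ho ho' (L.take i) L')) hB
    ?_ (by omega) (by simp [regs_gridRow]) ?_ (fun _ _ _ v h => h.setReg v (by simp)) ?_ ?_).mono
    fun τ h => by simpa using h))
  · rw [State.setReg_reg, if_neg (by omega), ha]
  · simp [regs_gridRow]
    omega
  · rintro i hi τ rfl hτ h
    replace hτ : State.EqOutside {3, 6, 7} {4} σ τ := (State.EqOutside.setReg (by simp) σ _).trans
      (hτ.mono (by simp [regs_gridRow]; grind) (arrays_gridRow _ _ _ _))
    rw [← hτ.mem a (by grind)] at hL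
    rw [← hτ.mem a' (by grind)] at hL'
    rw [← hτ.reg a' (by grind)] at ha'
    rw [intersections_take_succ hi, ← List.getD_eq_getElem _ 0 hi]
    exact wp_gridRow h hL hi hL' ha' (by omega) h7' hB'
  · exact ⟨by simp [intersections, List.product], by simp [length_intersections, NExp.eval]⟩

end Grid

/-! ### The search for a solution -/

section CandidateTest

variable {ζ : ℂ} {d k l : ℕ} (β : Module.Basis (Fin d) ℚ (fieldK ζ))
  (σ : Fin k → (fieldK ζ ≃ₐ[ℚ] fieldK ζ)) (A : Matrix (Fin l) (Fin k × Fin 2) ℝ) (b : Fin l → ℝ)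

/-- The expressions `x` and `y` for the real and imaginary part of the sum of the vector in array 5
and entry `i` of the list of elements of `ℚ(ζ)` in array `a`. -/
def pointExp (a : ℕ) (i : NExp) : RExp × RExp :=
  (.add (.cell 5 (.const 0)) (formExp β (Complex.reLm.restrictScalars ℚ ∘ₗ
      (fieldK ζ).val.toLinearMap) a i),
    .add (.cell 5 (.const 1)) (formExp β (Complex.imLm.restrictScalars ℚ ∘ₗ
      (fieldK ζ).val.toLinearMap) a i))

/-- The test whether the grid point with index in register 10 belongs to the candidate set of the
tuple in the registers `20, 21, …`. The list `Λ` decides feasibility as in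
`exists_feasibility_test`. -/
def candidateTest (Λ : List (Fin l → ℝ)) : Test :=
  .and (.all (Λ.map fun c => .realLt (.sum fun i => .mul (.const (c i))
      (.sub (formExp β (starForm σ A i) 4 (.reg (20 + i.succ))) (.const (interiorBound A b i))))
      (.const 0)))
    (.and (.all (List.ofFn fun j : Fin d =>
        .isInt (.sub (coordExp 4 (.reg 10) j) (coordExp 4 (.reg 20) j))))
      (.all (List.ofFn fun i => .not (.realLt (formExp β (starForm σ A i) 4 (.reg (20 + i.succ)))
        (formExp β (starForm σ A i) 4 (.reg 10))))))

variable {β σ A b} {P : List (fieldK ζ)} {S : State} {t : ℂ}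

theorem eval_pointExp {a : ℕ} {i : NExp} (hP : Stored (S.mem a) 0 (P.flatMap (coords β)))
    (hi : i.eval S < P.length) (hre : S.mem 5 0 = t.re) (him : S.mem 5 1 = t.im) :
    (pointExp β a i).1.eval S = (t + P.getD (i.eval S) 0 : ℂ).re ∧
      (pointExp β a i).2.eval S = (t + P.getD (i.eval S) 0 : ℂ).im := by
  constructor <;> simp only [pointExp, RExp.eval, eval_formExp hP hi] <;>
    simp [NExp.eval, hre, him, IntermediateField.coe_val]

theorem holds_candidateTest (hβ : ∀ z : fieldK ζ, (z : ℂ) ∈ ringO ζ ↔ ∀ j, ∃ n : ℤ, β.repr z j = n)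
    {Λ : List (Fin l → ℝ)}
    (hΛ : ∀ u, (∀ c ∈ Λ, c ⬝ᵥ u < 0) ↔ ∃ τ, ∀ i, u i < A.mulVec τ i)
    (hP : Stored (S.mem 4) 0 (P.flatMap (coords β))) {v : Fin (l + 1) → ℕ}
    (hv : ∀ q, v q < P.length) (hvS : ∀ q : Fin (l + 1), S.reg (20 + q) = v q)
    (hi : S.reg 10 < P.length) :
    (candidateTest β σ A b Λ).holds S ↔ IsCandidate σ A b (P.getD · 0) v (S.reg 10) := by
  have hform (φ : fieldK ζ →ₗ[ℚ] ℝ) (q : Fin (l + 1)) :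
      (formExp β φ 4 (.reg (20 + q))).eval S = φ (P.getD (v q) 0) := by
    rw [eval_formExp (i := .reg (20 + q)) hP ((hvS q).trans_lt (hv q)), NExp.eval, hvS]
  have hcoord (j : Fin d) : (coordExp 4 (.reg 20) j).eval S = β.repr (P.getD (v 0) 0) j := by
    rw [eval_coordExp (i := .reg 20) hP ((hvS 0).trans_lt (hv 0)), NExp.eval, ← hvS 0]
    rfl
  simp only [candidateTest, Test.holds, Test.holds_all, List.forall_mem_map,
    List.forall_mem_ofFn_iff, RExp.eval, RExp.eval_sum, hform, hcoord,
    eval_formExp (i := .reg 10) hP hi, eval_coordExp (i := .reg 10) hP hi, not_lt, IsCandidate,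
    Feasible, Selected, hβ, ← hΛ]
  refine and_congr Iff.rfl (and_congr (forall_congr' fun j => exists_congr fun n => ?_) Iff.rfl)
  rw [map_sub, Finsupp.sub_apply]
  exact_mod_cast Iff.rfl

end CandidateTest

/-- What the search uses about the form of the answers: they are positive if and only if there is a
solution, a positive answer remains correct for a weaker problem, and the length of an answer is
bounded in terms of the cardinality of the solutions. -/
structure AnswerFormat (Ans : List ℝ → (Finset ℂ → Prop) → Prop) : Prop where
  mono : ∀ {w sol sol'}, Ans w sol → Positive w → (∀ F, sol F → sol' F) → Ans w sol'
  not_exists : ∀ {w sol}, Ans w sol → ¬ Positive w → ¬ ∃ F, sol F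
  zero : ∀ {sol : Finset ℂ → Prop}, (¬ ∃ F, sol F) → Ans [0] sol
  ne_nil : ∀ {w sol}, Ans w sol → w ≠ []
  length_le : ∀ {w sol} {N : ℕ}, Ans w sol → (∀ F, sol F → F.card ≤ N) → w.length ≤ 1 + 2 * N

theorem answerFormat_decides : AnswerFormat fun w sol => Decides w (∃ F, sol F) where
  mono := by
    rintro w sol sol' (⟨⟨F, hF⟩, rfl⟩ | ⟨-, rfl⟩) hw h
    · exact .inl ⟨⟨F, h F hF⟩, rfl⟩
    · simp [Positive] at hw
  not_exists := by
    rintro w sol (⟨-, rfl⟩ | ⟨h, rfl⟩) hw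
    · simp [Positive] at hw
    · exact h
  zero := fun h => .inr ⟨h, rfl⟩
  ne_nil := by
    rintro w sol (⟨-, rfl⟩ | ⟨-, rfl⟩) <;> simp
  length_le := by
    rintro w sol N (⟨-, rfl⟩ | ⟨-, rfl⟩) - <;> simp

theorem Enumerates.length_eq {L : List ℂ} {F : Finset ℂ} (h : Enumerates L F) :
    L.length = F.card := by
  rw [← List.toFinset_card_of_nodup h.1]
  congr 1
  ext z
  rw [List.mem_toFinset, h.2]

theorem answerFormat_constructs : AnswerFormat Constructs where
  mono := by
    rintro w sol sol' (⟨F, L, hF, hL, rfl⟩ | ⟨-, rfl⟩) hw h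
    · exact .inl ⟨F, L, h F hF, hL, rfl⟩
    · simp [Positive] at hw
  not_exists := by
    rintro w sol (⟨_, _, _, _, rfl⟩ | ⟨h, rfl⟩) hw
    · simp [Positive] at hw
    · exact h
  zero := fun h => .inr ⟨h, rfl⟩
  ne_nil := by
    rintro w sol (⟨_, _, _, _, rfl⟩ | ⟨-, rfl⟩) <;> simp
  length_le := by
    rintro w sol N (⟨F, L, hF, hL, rfl⟩ | ⟨-, rfl⟩) h
    · have := h F hF
      rw [List.length_cons, length_encPoints, hL.length_eq]
      omega
    · simp

section Solve

variable {ζ : ℂ} {d k l m : ℕ} {σ : Fin k → (fieldK ζ ≃ₐ[ℚ] fieldK ζ)}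
  {A : Matrix (Fin l) (Fin k × Fin 2) ℝ} {b : Fin l → ℝ} {o : Fin m → ℂ} {t : ℂ}
  {O : List ℝ → List ℝ} {G : List ℝ → Prop} {B s : ℕ} {pre : List ℝ} {S : State}
  {Ans : List ℝ → (Finset ℂ → Prop) → Prop} {R : Finset ℂ → Prop}

theorem answers_of_searchState {g : ℕ → fieldK ζ} {N : ℕ} (hAns : AnswerFormat Ans)
    (hS : SearchState O pre (candidateSets σ A b t g N) S)
    (hO : ∀ P ∈ candidateSets σ A b t g N,
      Ans (O (queryWord pre P)) fun F => (∀ z ∈ F, z ∈ P) ∧ R F)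
    (hR : ∀ F, R F → ∀ z ∈ F, ∃ i < N, z = t + (g i : ℂ)) :
    Ans S.output fun F =>
      (∃ Λ, IsWSet σ (polyhedron A b) Λ ∧ (F : Set ℂ) ⊆ Λ) ∧ R F := by
  obtain ⟨hout, hneg⟩ | ⟨P, hP, hpos, hout⟩ := hS
  · rw [hout]
    refine hAns.zero fun ⟨F, ⟨Λ, hΛ, hFΛ⟩, hF⟩ => ?_
    obtain ⟨P, hP, hFP⟩ := exists_mem_candidateSets hΛ hFΛ (hR F hF)
    exact hAns.not_exists (hO P hP) (hneg P hP) ⟨F, hFP, hF⟩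
  · rw [hout]
    obtain ⟨Λ, hΛ, hPΛ⟩ := exists_isWSet_of_mem_candidateSets hP
    exact hAns.mono (hO P hP) hpos fun F hF => ⟨⟨Λ, hΛ, fun z hz => hPΛ z (hF.1 z hz)⟩, hF.2⟩

theorem nodup_points {pt : ℕ → ℂ} {N : ℕ} (hpt : Set.InjOn pt (Set.Iio N)) (M : ℕ → Prop) :
    (points pt M N).Nodup := by
  classical
  refine (List.nodup_range.filter _).map_on fun i hi j hj h => hpt ?_ ?_ h
  · simpa using (List.mem_filter.1 hi).1
  · simpa using (List.mem_filter.1 hj).1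

theorem wp_search_candidateSets {β : Module.Basis (Fin d) ℚ (fieldK ζ)} {P : List (fieldK ζ)}
    {Λ : List (Fin l → ℝ)}
    (hβ : ∀ z : fieldK ζ, (z : ℂ) ∈ ringO ζ ↔ ∀ j, ∃ n : ℤ, β.repr z j = n)
    (hΛ : ∀ u, (∀ c ∈ Λ, c ⬝ᵥ u < 0) ↔ ∃ τ, ∀ i, u i < A.mulVec τ i)
    (hS : SearchInput pre P.length S) (hP : Stored (S.mem 4) 0 (P.flatMap (coords β)))
    (hre : S.mem 5 0 = t.re) (him : S.mem 5 1 = t.im) (hB : pre.length + 2 + 4 * P.length ≤ B)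
    (hO : ∀ M, let w := queryWord pre (points (fun i => t + (P.getD i 0 : ℂ)) M P.length)
      G w ∧ O w ≠ [] ∧ (O w).length ≤ 1 + 2 * P.length) :
    Wp O G B (search (l + 1) (candidateTest β σ A b Λ) (pointExp β 4 (.reg 10)).1
      (pointExp β 4 (.reg 10)).2)
      (SearchState O pre (candidateSets σ A b t (P.getD · 0) P.length)) S := by
  refine wp_search hS (by omega) (fun v υ hv hvυ hυ χ hχ hi => ?_) (fun M => (hO M).1)
    (fun M => (hO M).2.1) fun M => ?_
  · have hmem (a : ℕ) (ha : a ∉ ({1, 2, 3} : Set ℕ)) : χ.mem a = S.mem a :=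
      (hχ.mem a ha).trans (hυ.mem a ha)
    rw [← hmem 4 (by simp)] at hP
    refine ⟨holds_candidateTest hβ hΛ hP hv (fun q => ?_) hi,
      fun _ => eval_pointExp (i := .reg 10) hP hi ?_ ?_⟩
    · rw [hχ.reg _ (by grind), hvυ]
    · rw [hmem 5 (by simp), hre]
    · rw [hmem 5 (by simp), him]
  · have hN := length_points_le (pt := fun i => t + (P.getD i 0 : ℂ)) (M := M) (N := P.length)
    have hw := (hO M).2.2
    rw [length_queryWord]
    beta_reduce
    omega

/-- The input of the search: the query prefix `pre` is in array 2, the translation vector `t` in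
array 5, and points of the lines in direction `i` (without `t`) in the array `20 + i`. -/
structure Prepared (β : Module.Basis (Fin d) ℚ (fieldK ζ)) (pre : List ℝ) (t : ℂ)
    (L : Fin m → List (fieldK ζ)) (S : State) : Prop where
  stored_pre : Stored (S.mem 2) 0 pre
  reg_two : S.reg 2 = pre.length
  re : S.mem 5 0 = t.re
  im : S.mem 5 1 = t.im
  stored : ∀ i : Fin m, Stored (S.mem (20 + i)) 0 ((L i).flatMap (coords β))
  reg : ∀ i : Fin m, S.reg (20 + i) = (L i).length

/-- The whole search, for the grid of the intersections of the lines in the directions `i₀` and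
`i₁`, where `π` is the projection along the second of them. -/
def solve (β : Module.Basis (Fin d) ℚ (fieldK ζ)) (π : Module.End ℚ (fieldK ζ)) (i₀ i₁ : Fin m)
    (c : Test) (K : ℕ) : Prog :=
  .seq (grid β π (20 + i₀) (20 + i₁))
    (search K c (pointExp β 4 (.reg 10)).1 (pointExp β 4 (.reg 10)).2)

theorem wp_solve {β : Module.Basis (Fin d) ℚ (fieldK ζ)} {i₀ i₁ : Fin m}
    {hζ : star ζ ∈ fieldK ζ} {ho : o i₀ ∈ fieldK ζ} {ho' : o i₁ ∈ fieldK ζ}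
    {L : Fin m → List (fieldK ζ)} {Λ : List (Fin l → ℝ)}
    (hβ : ∀ z : fieldK ζ, (z : ℂ) ∈ ringO ζ ↔ ∀ j, ∃ n : ℤ, β.repr z j = n)
    (hlin : LinearIndependent ℝ ![o i₀, o i₁])
    (hΛ : ∀ u, (∀ c ∈ Λ, c ⬝ᵥ u < 0) ↔ ∃ τ, ∀ i, u i < A.mulVec τ i)
    (hS : Prepared β pre t L S)
    (hL : ∀ i, ((L i).map fun x : fieldK ζ => lineThrough (t + x) (o i)).Nodup)
    (hs : ∀ i, (L i).length ≤ s) (hB : pre.length + 2 + 4 * s ^ 2 ≤ B)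
    (hAns : AnswerFormat Ans) (hR : ∀ F, R F → ∀ z ∈ F, ∀ i, ∃ x ∈ L i, z ∈ line (t + x) (o i))
    (hO : ∀ P : List ℂ, P.Nodup → P.length ≤ s ^ 2 →
      G (queryWord pre P) ∧ Ans (O (queryWord pre P)) fun F => (∀ z ∈ F, z ∈ P) ∧ R F) :
    Wp O G B (solve β (projection hζ ho ho') i₀ i₁ (candidateTest β σ A b Λ) (l + 1))
      (fun τ => Ans τ.output fun F =>
        (∃ Λ, IsWSet σ (polyhedron A b) Λ ∧ (F : Set ℂ) ⊆ Λ) ∧ R F) S := by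
  have hsB : s ≤ B := (Nat.le_self_pow two_ne_zero s).trans (by omega)
  refine .seq ((wp_grid (hζ := hζ) (ho := ho) (ho' := ho') (hS.stored i₀) (hS.reg i₀)
    (hS.stored i₁) (hS.reg i₁) (by omega) (by omega) ((hs _).trans hsB)
    ((hs _).trans hsB)).frame.mono fun τ ⟨hgrid, hf⟩ => ?_)
  replace hf : State.EqOutside {3, 6, 7} {4} S τ :=
    hf.mono (regs_grid ..).subset (arrays_grid ..)
  set P := intersections hζ ho ho' (L i₀) (L i₁) with hP
  have hnodup : P.Nodup := nodup_intersections hlin (hL i₀) (hL i₁)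
  have hlen : P.length ≤ s ^ 2 := by
    rw [hP, length_intersections, sq]
    exact Nat.mul_le_mul (hs i₀) (hs i₁)
  have hpoints (M : ℕ → Prop) : (points (fun i => t + (P.getD i 0 : ℂ)) M P.length).Nodup := by
    refine nodup_points (fun i hi j hj h => ?_) M
    rw [Set.mem_Iio] at hi hj
    simpa [hi, hj, hnodup.getElem_inj_iff] using h
  have hquery (M : ℕ → Prop) :=
    hO _ (hpoints M) ((length_points_le (pt := fun i => t + (P.getD i 0 : ℂ))).trans hlen)
  refine (wp_search_candidateSets (t := t) (P := P) hβ hΛ ⟨?_, ?_, hgrid.reg_three⟩ hgrid.stored ?_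
    ?_ (by omega) fun M => ⟨(hquery M).1, hAns.ne_nil (hquery M).2, ?_⟩).mono fun υ hυ =>
      answers_of_searchState hAns hυ ?_ fun F hF z hz => ?_
  · rw [hf.mem 2 (by simp)]
    exact hS.stored_pre
  · rw [hf.reg 2 (by simp), hS.reg_two]
  · rw [hf.mem 5 (by simp), hS.re]
  · rw [hf.mem 5 (by simp), hS.im]
  · refine hAns.length_le (hquery M).2 fun F hF => ?_
    refine (Finset.card_le_card fun z hz => List.mem_toFinset.2 (hF.1 z hz)).trans ?_
    exact (List.toFinset_card_le _).trans length_points_le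
  · rintro _ (rfl | ⟨v, -, rfl⟩)
    · exact (hO [] List.nodup_nil (Nat.zero_le _)).2
    · exact (hquery _).2
  · obtain ⟨w, hw, rfl⟩ := exists_mem_intersections (hζ := hζ) (ho := ho) (ho' := ho') hlin
      (hR F hF z hz i₀) (hR F hF z hz i₁)
    obtain ⟨i, hi, rfl⟩ := List.mem_iff_getElem.1 hw
    exact ⟨i, hi, by rw [List.getD_eq_getElem _ 0 hi]⟩

end Solve

/-! ### Reading the input -/

section ReadList

variable {ζ : ℂ} {d : ℕ} (β : Module.Basis (Fin d) ℚ (fieldK ζ))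

/-- The part of the input from the address in register 5 on is `u`, and the query prefix that has
been written so far is `w`. -/
structure Transfer (u w : List ℝ) (σ : State) : Prop where
  rest : Stored (σ.mem 0) (σ.reg 5) u
  written : Stored (σ.mem 2) 0 w
  reg_two : σ.reg 2 = w.length

/-- Append the values of a list of expressions to the query prefix. -/
def emit (es : List RExp) : Prog :=
  .seq (.store 2 (.reg 2) es) (.setReg 2 (.add (.reg 2) (.const es.length)))

/-- Read a point of `ℚ(ζ)`, given by its coordinates, and `k` further numbers. Save the coordinates
as entry `σ.reg 6` of a list in array `a`, and append the planar coordinates of the point,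
translated by the vector in array 5, and the further numbers to the query prefix. -/
def readEntry (a k : ℕ) : Prog :=
  .seq (.store a (.mul (.const d) (.reg 6))
      (List.ofFn fun j : Fin d => .cell 0 (.add (.reg 5) (.const j))))
    (.seq (emit ((pointExp β a (.reg 6)).1 :: (pointExp β a (.reg 6)).2 ::
        List.ofFn fun j : Fin k => .cell 0 (.add (.add (.reg 5) (.const d)) (.const j))))
      (.setReg 5 (.add (.add (.reg 5) (.const d)) (.const k))))

/-- Read a list as in `readEntry`, preceded by its length, which is saved in register `a`. -/
def readList (a k : ℕ) : Prog :=
  .seq (.readNat a 0 (.reg 5)) (.seq (.setReg 5 (.add (.reg 5) (.const 1)))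
    (.seq (emit [.ofNat (.reg a)]) (.count 6 a (readEntry β a k))))

variable {β} {O : List ℝ → List ℝ} {G : List ℝ → Prop} {B a k : ℕ} {σ : State} {t : ℂ}
  {u v w xs : List ℝ} {es : List RExp} {L : List (fieldK ζ)} {x : fieldK ζ}
  {E : List (fieldK ζ × List ℝ)}

theorem regs_emit (es : List RExp) : (emit es).regs = {2} := by
  simp [emit, Prog.regs]

theorem arrays_emit (es : List RExp) : (emit es).arrays ⊆ {2} := by
  simpa only [emit, Prog.arrays, Set.union_empty] using Prog.arrays_store _ _ _

theorem regs_readEntry (a k : ℕ) : (readEntry β a k).regs = {2, 5} := by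
  ext; simp [readEntry, Prog.regs, regs_emit]; tauto

theorem arrays_readEntry (a k : ℕ) : (readEntry β a k).arrays ⊆ {2, a} := by
  simp only [readEntry, Prog.arrays, Set.union_empty]
  exact Set.union_subset ((Prog.arrays_store _ _ _).trans (by simp))
    ((arrays_emit _).trans (by simp))

theorem regs_readList (a k : ℕ) : (readList β a k).regs = {2, 5, 6, a} := by
  ext; simp [readList, Prog.regs, regs_emit, regs_readEntry]; tauto

theorem arrays_readList (a k : ℕ) : (readList β a k).arrays ⊆ {2, a} := by
  simp only [readList, Prog.arrays, Prog.arrays_readNat, Prog.arrays_count, Set.empty_union]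
  exact Set.union_subset ((arrays_emit _).trans (by simp)) (arrays_readEntry a k)

theorem Transfer.congr {R A : Set ℕ} {τ : State} (h : Transfer u w σ)
    (hτ : State.EqOutside R A σ τ) (h5 : 5 ∉ R) (h2 : 2 ∉ R) (h0 : 0 ∉ A) (h2' : 2 ∉ A) :
    Transfer u w τ where
  rest := by rw [hτ.mem 0 h0, hτ.reg 5 h5]; exact h.rest
  written := by rw [hτ.mem 2 h2']; exact h.written
  reg_two := by rw [hτ.reg 2 h2, h.reg_two]

theorem wp_emit (h : Transfer u w σ)
    (hes : ∀ τ, State.EqOutside ∅ {2} σ τ → es.map (RExp.eval τ) = xs) :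
    Wp O G B (emit es) (Transfer u (w ++ xs)) σ := by
  refine .seq ((Wp.store (i := .reg 2) h.written h.reg_two hes).mono fun τ ⟨hw, hτ⟩ =>
    .setReg ⟨?_, hw, ?_⟩)
  · rw [State.setReg_mem, hτ.mem 0 (by simp), State.setReg_reg, if_neg (by simp),
      hτ.reg 5 (by simp)]
    exact h.rest
  · simp [NExp.eval, hτ.reg 2, h.reg_two, ← hes σ (.refl σ)]

theorem wp_readEntry (ha : 7 < a) (h : Transfer (coords β x ++ (v ++ u)) w σ)
    (hv : v.length = k) (hL : Stored (σ.mem a) 0 (L.flatMap (coords β))) (h6 : σ.reg 6 = L.length)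
    (hre : σ.mem 5 0 = t.re) (him : σ.mem 5 1 = t.im) :
    Wp O G B (readEntry β a k) (fun τ => Transfer u (w ++ ((t + x).re :: (t + x).im :: v)) τ ∧
      Stored (τ.mem a) 0 ((L ++ [x]).flatMap (coords β))) σ := by
  obtain ⟨hx, hvu⟩ := stored_append.1 h.rest
  obtain ⟨hv', hu⟩ := stored_append.1 hvu
  rw [length_coords] at hv' hu
  rw [hv] at hu
  refine .seq ((Wp.store (xs := coords β x) hL ?_ fun τ hτ => ?_).mono fun τ ⟨hLx, hτ⟩ =>
    .seq ((wp_emit (xs := (t + x).re :: (t + x).im :: v)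
      (h.congr hτ (by simp) (by simp) (by grind) (by grind)) fun υ hυ => ?_).frame.mono
        fun υ ⟨hυ, hf⟩ => .setReg ⟨⟨?_, hυ.written, ?_⟩, ?_⟩))
  · rw [length_flatMap_coords, ← h6]
    rfl
  · rw [← hx.ofFn_eq (length_coords x), List.map_ofFn]
    simp [RExp.eval, NExp.eval, hτ.mem 0 (by grind), hτ.reg 5, Function.comp_def]
  · have hυa : Stored (υ.mem a) 0 ((L ++ [x]).flatMap (coords β)) := by
      rw [hυ.mem a (by grind)]
      simpa using hLx
    have hυ6 : υ.reg 6 = L.length := by rw [hυ.reg 6 (by simp), hτ.reg 6 (by simp), h6]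
    have hυτ : υ.mem 0 = σ.mem 0 ∧ υ.mem 5 = σ.mem 5 ∧ υ.reg 5 = σ.reg 5 := by
      simp [hυ.mem 0, hυ.mem 5, hυ.reg 5, hτ.reg 5, hτ.mem 0 (by grind), hτ.mem 5 (by grind)]
    obtain ⟨hxre, hxim⟩ := eval_pointExp (i := .reg 6) (t := t) hυa (by simp [NExp.eval, hυ6])
      (by rw [hυτ.2.1, hre]) (by rw [hυτ.2.1, him])
    rw [List.map_cons, List.map_cons, hxre, hxim, List.map_ofFn, ← hv'.ofFn_eq hv]
    simp [RExp.eval, NExp.eval, hυτ, hυ6, Function.comp_def]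
  · have hυ0 : υ.mem 0 = σ.mem 0 := by
      rw [hf.mem 0 fun h => by simpa using arrays_emit _ h, hτ.mem 0 (by grind)]
    have hυ5 : υ.reg 5 = σ.reg 5 := by rw [hf.reg 5 (by simp [regs_emit]), hτ.reg 5 (by simp)]
    simpa [NExp.eval, hυ0, hυ5] using hu
  · simpa using hυ.reg_two
  · have hυa : υ.mem a = τ.mem a := hf.mem a fun h => by have := arrays_emit _ h; grind
    simpa [hυa] using hLx

theorem wp_count_readEntry (ha : 7 < a) (hE : ∀ e ∈ E, e.2.length = k) (hB : E.length ≤ B)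
    (h : Transfer ((E.flatMap fun e => coords β e.1 ++ e.2) ++ u) w σ) (hn : σ.reg a = E.length)
    (hre : σ.mem 5 0 = t.re) (him : σ.mem 5 1 = t.im) :
    Wp O G B (.count 6 a (readEntry β a k)) (fun τ =>
      Transfer u (w ++ E.flatMap fun e => (t + e.1).re :: (t + e.1).im :: e.2) τ ∧
      Stored (τ.mem a) 0 ((E.map Prod.fst).flatMap (coords β))) σ := by
  refine (Wp.count (fun j τ =>
    Transfer (((E.drop j).flatMap fun e => coords β e.1 ++ e.2) ++ u)
      (w ++ (E.take j).flatMap fun e => (t + e.1).re :: (t + e.1).im :: e.2) τ ∧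
    Stored (τ.mem a) 0 (((E.take j).map Prod.fst).flatMap (coords β))) hB hn (by omega)
    (by simp [regs_readEntry]) (by simp [regs_readEntry]; omega)
    (fun j _ τ v hτ => ⟨hτ.1.congr (.setReg (Set.mem_singleton 6) _ _) (by simp) (by simp)
      (Set.notMem_empty _) (Set.notMem_empty _), hτ.2⟩) (fun j hj τ h6 hτ ⟨hT, hL⟩ => ?_)
    ⟨by simpa using h, by simp⟩).mono fun τ ⟨hT, hL⟩ => ⟨by simpa using hT, by simpa using hL⟩
  have hτ5 : τ.mem 5 = σ.mem 5 :=
    hτ.mem 5 fun h => by have := arrays_readEntry a k h; grind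
  rw [List.drop_eq_getElem_cons hj, List.flatMap_cons, List.append_assoc,
    List.append_assoc] at hT
  refine (wp_readEntry (t := t) ha hT (hE _ (List.getElem_mem hj)) hL ?_ ?_ ?_).mono
    fun υ ⟨hυ, hυL⟩ => ⟨?_, ?_⟩
  · simp [h6, hj.le]
  · rw [hτ5, hre]
  · rw [hτ5, him]
  · rwa [List.take_succ_eq_append_getElem hj, List.flatMap_append, List.flatMap_singleton,
      ← List.append_assoc]
  · rwa [List.take_succ_eq_append_getElem hj, List.map_append, List.map_singleton]

theorem wp_readList (ha : 7 < a) (hE : ∀ e ∈ E, e.2.length = k) (hB : E.length ≤ B)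
    (h : Transfer ((E.length : ℝ) :: (E.flatMap fun e => coords β e.1 ++ e.2) ++ u) w σ)
    (hre : σ.mem 5 0 = t.re) (him : σ.mem 5 1 = t.im) :
    Wp O G B (readList β a k) (fun τ => Transfer u
        (w ++ (E.length : ℝ) :: E.flatMap fun e => (t + e.1).re :: (t + e.1).im :: e.2) τ ∧
      Stored (τ.mem a) 0 ((E.map Prod.fst).flatMap (coords β)) ∧ τ.reg a = E.length) σ := by
  rw [List.cons_append] at h
  obtain ⟨hlen, hrest⟩ := stored_cons.1 h.rest
  refine .seq ((Wp.readNat hB (fun v => by simp [NExp.eval]; omega) hlen).mono fun _ hτ => ?_)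
  subst hτ
  refine .seq (.setReg (.seq ?_))
  set τ := (σ.setReg a E.length).setReg 5 _
  have hτT : Transfer ((E.flatMap fun e => coords β e.1 ++ e.2) ++ u) w τ :=
    ⟨by simpa [τ, NExp.eval, show 5 ≠ a by omega] using hrest, h.written,
      by simpa [τ, show 2 ≠ a by omega] using h.reg_two⟩
  have hτa : τ.reg a = E.length := by simp [τ, show a ≠ 5 by omega]
  refine (wp_emit hτT (xs := [(E.length : ℝ)]) fun υ hυ => ?_).frame.mono fun υ ⟨hυT, hυ⟩ => ?_
  · simp [RExp.eval, NExp.eval, hυ.reg a, hτa]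
  replace hυ := hυ.mono (regs_emit _).subset (arrays_emit _)
  have hυa : υ.reg a = E.length := (hυ.reg a (by grind)).trans hτa
  refine (wp_count_readEntry (t := t) ha hE hB hυT hυa ?_ ?_).frame.mono
    fun χ ⟨⟨hT, hL⟩, hχ⟩ => ⟨by simpa using hT, hL, ?_⟩
  · simpa [τ, hυ.mem 5] using hre
  · simpa [τ, hυ.mem 5] using him
  · rw [hχ.reg a (by simp [regs_readEntry]; omega), hυa]

end ReadList

section Prepare

variable {ζ : ℂ} {d m : ℕ} {β : Module.Basis (Fin d) ℚ (fieldK ζ)}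

/-- List the lines in all directions, by the programs `p i`, compute the maximal number of lines in
one direction in register 4, and write it to cell 0 of the query prefix. -/
def prepare (p : Fin m → Prog) : Prog :=
  .seq (.block (List.ofFn fun i => .seq (p i)
      (.setReg 4 (.add (.reg 4) (.sub (.reg (20 + i)) (.reg 4))))))
    (.setCell 2 (.const 0) (.ofNat (.reg 4)))

/-- The lists of lines in the first `j` directions are in memory, and register 4 contains their
maximal length. -/
structure LinesStored (β : Module.Basis (Fin d) ℚ (fieldK ζ)) (L : Fin m → List (fieldK ζ)) (j : ℕ)
    (σ : State) : Prop where
  stored : ∀ i : Fin m, (i : ℕ) < j → Stored (σ.mem (20 + i)) 0 ((L i).flatMap (coords β))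
  reg : ∀ i : Fin m, (i : ℕ) < j → σ.reg (20 + i) = (L i).length
  reg_four_le : ∀ x, σ.reg 4 ≤ x ↔ ∀ i : Fin m, (i : ℕ) < j → (L i).length ≤ x

variable {O : List ℝ → List ℝ} {G : List ℝ → Prop} {B j s : ℕ} {σ τ : State} {t : ℂ} {w : List ℝ}
  {L : Fin m → List (fieldK ζ)} {p : Fin m → Prog} {i : Fin m}

theorem LinesStored.succ (h : LinesStored β L i σ)
    (hτ : State.EqOutside {2, 5, 6, 7, 9, 20 + (i : ℕ)} {2, 20 + (i : ℕ)} σ τ)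
    (hL : Stored (τ.mem (20 + i)) 0 ((L i).flatMap (coords β)))
    (hn : τ.reg (20 + i) = (L i).length) :
    LinesStored β L (i + 1)
      (τ.setReg 4 ((NExp.add (.reg 4) (.sub (.reg (20 + i)) (.reg 4))).eval τ)) := by
  have hlt (q : Fin m) : (q : ℕ) < i + 1 ↔ (q : ℕ) < i ∨ q = i := by
    rw [Nat.lt_succ_iff_lt_or_eq, Fin.ext_iff]
  refine ⟨fun q hq => ?_, fun q hq => ?_, fun x => ?_⟩
  · obtain hq | rfl := (hlt q).1 hq
    · rw [State.setReg_mem, hτ.mem _ (by simp; omega)]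
      exact h.stored q hq
    · exact hL
  · rw [State.setReg_reg, if_neg (by omega)]
    obtain hq | rfl := (hlt q).1 hq
    · rw [hτ.reg _ (by simp; omega), h.reg q hq]
    · exact hn
  · simp only [hlt, or_imp, forall_and, forall_eq, ← h.reg_four_le, State.setReg_reg, if_pos,
      NExp.eval, hn, hτ.reg 4 (by simp; omega)]
    omega

theorem wp_prepare (Inv : ℕ → State → Prop)
    (hregs : ∀ i, (p i).regs ⊆ {2, 5, 6, 7, 9, 20 + (i : ℕ)})
    (harrays : ∀ i, (p i).arrays ⊆ {2, 20 + (i : ℕ)})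
    (hInv : ∀ i τ v, Inv i τ → Inv i (τ.setReg 4 v))
    (hp : ∀ i : Fin m, ∀ τ, τ.mem 5 = σ.mem 5 → Inv i τ → Wp O G B (p i) (fun υ => Inv (i + 1) υ ∧
      Stored (υ.mem (20 + i)) 0 ((L i).flatMap (coords β)) ∧ υ.reg (20 + i) = (L i).length) τ)
    (h₀ : Inv 0 σ) (h4 : σ.reg 4 = 0) (hre : σ.mem 5 0 = t.re) (him : σ.mem 5 1 = t.im)
    (hw : ∀ τ, Inv m τ → Stored (τ.mem 2) 0 (0 :: w) ∧ τ.reg 2 = w.length + 1)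
    (hs : (Finset.univ.sup fun i => (L i).length) = s) :
    Wp O G B (prepare p) (Prepared β (s :: w) t L) σ := by
  refine .seq (.mono (Wp.block_ofFn (fun j τ => Inv j τ ∧ LinesStored β L j τ ∧ τ.mem 5 = σ.mem 5)
    (fun i τ ⟨hτ, hL, h5⟩ => ?step) ⟨h₀, ⟨by simp, by simp, by simp [h4]⟩, rfl⟩)
      fun τ ⟨hτ, hL, h5⟩ => .setCell ?last)
  case step =>
    refine .seq ((hp i τ h5 hτ).frame.mono fun υ ⟨⟨hυ, hυL, hυn⟩, hf⟩ => .setReg ?_)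
    replace hf := hf.mono (hregs i) (harrays i)
    exact ⟨hInv _ _ _ hυ, hL.succ hf hυL hυn, (hf.mem 5 (by grind)).trans h5⟩
  case last =>
    obtain ⟨hτw, hτ2⟩ := hw τ hτ
    have hmax : τ.reg 4 = s :=
      hs ▸ eq_of_forall_ge_iff fun x => by simp [hL.reg_four_le, Finset.sup_le_iff]
    refine ⟨?_, by simp [hτ2], by simp [h5, hre], by simp [h5, him], fun i => ?_, fun i => ?_⟩
    · simpa [RExp.eval, NExp.eval, hmax] using
        Stored.update_append (v := []) hτw (τ.reg 4 : ℝ) (i := 0) rfl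
    · rw [State.setCell_mem, if_neg (by omega)]
      exact hL.stored i i.2
    · exact hL.reg i i.2

end Prepare

/-! ### Consistency and reconstruction -/

section Data

variable {ζ : ℂ} {d k l m : ℕ} {σ : Fin k → (fieldK ζ ≃ₐ[ℚ] fieldK ζ)}
  {A : Matrix (Fin l) (Fin k × Fin 2) ℝ} {b : Fin l → ℝ} {o : Fin m → ℂ}

theorem ListsData.support_eq {o : ℂ} {L : List (ℂ × ℕ)} {p : LineIn o → ℕ} (h : ListsData L p) :
    Function.support p = {ℓ | ℓ ∈ L.map fun e => lineThrough e.1 o} := by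
  ext ℓ
  rw [Set.mem_ofPred_eq, List.mem_map]
  constructor
  · intro hℓ
    obtain ⟨e, he, heℓ, -⟩ := (h.2.2 ℓ _ hℓ).1 rfl
    exact ⟨e, he, heℓ⟩
  · rintro ⟨e, he, rfl⟩
    rw [Function.mem_support, (h.2.2 _ e.2 (h.2.1 e he)).2 ⟨e, he, rfl, rfl⟩]
    exact h.2.1 e he

theorem ncard_setOf_mem_list {α : Type*} {L : List α} (h : L.Nodup) :
    {x | x ∈ L}.ncard = L.length := by
  classical
  rw [← List.toFinset_card_of_nodup h, ← Set.ncard_coe_finset, List.coe_toFinset]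

theorem ListsData.ncard_support {o : ℂ} {L : List (ℂ × ℕ)} {p : LineIn o → ℕ}
    (h : ListsData L p) : (Function.support p).ncard = L.length := by
  rw [h.support_eq, ncard_setOf_mem_list h.1, List.length_map]

theorem enumerates_toFinset {P : List ℂ} (h : P.Nodup) : Enumerates P P.toFinset :=
  ⟨h, fun _ => List.mem_toFinset.symm⟩

theorem length_encData (L : List (ℂ × ℕ)) : (encData L).length = 3 * L.length + 1 := by
  simp [encData, List.length_flatMap, mul_comm]

theorem length_flatten_encData_le {D : Fin m → List (ℂ × ℕ)} {s : ℕ}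
    (h : ∀ i, (D i).length ≤ s) :
    (List.ofFn fun i => encData (D i)).flatten.length ≤ m * (3 * s + 1) := by
  rw [List.length_flatten, List.map_ofFn, List.sum_ofFn]
  refine (Finset.sum_le_card_nsmul _ _ (3 * s + 1) fun i _ => ?_).trans (by simp)
  simpa [length_encData] using h i

theorem le_maxSupport (p : ∀ i, LineIn (o i) → ℕ) (i : Fin m) :
    (Function.support (p i)).ncard ≤ maxSupport p :=
  Finset.le_sup (f := fun i => (Function.support (p i)).ncard) (Finset.mem_univ i)

theorem ListsData.exists_mem_line {o : ℂ} {L : List (ℂ × ℕ)} {p : LineIn o → ℕ}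
    (h : ListsData L p) {F : Finset ℂ} (hF : xray o F = p) {z : ℂ} (hz : z ∈ F) :
    ∃ e ∈ L, z ∈ line e.1 o := by
  have hp : lineThrough z o ∈ Function.support p := hF ▸ xray_ne_zero_iff.2 ⟨z, hz, rfl⟩
  rw [h.support_eq, Set.mem_ofPred_eq, List.mem_map] at hp
  obtain ⟨e, he, hez⟩ := hp
  exact ⟨e, he, lineThrough_eq_iff.1 hez.symm⟩

theorem coords_modulePoint (hζ : IsIntegral ℤ ζ) (hd : (minpoly ℤ ζ).natDegree = d)
    (c : Fin d → ℤ) : coords (coordBasis hζ hd) (modulePoint ζ c) = encCoords c := by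
  simp [coords, encCoords, repr_modulePoint]

/-- The program for consistency and reconstruction. -/
def solveData (β : Module.Basis (Fin d) ℚ (fieldK ζ)) (π : Module.End ℚ (fieldK ζ))
    (i₀ i₁ : Fin m) (c : Test) (K : ℕ) : Prog :=
  .seq (.setReg 2 (.const 1))
    (.seq (prepare fun i : Fin m => readList β (20 + i) 1) (solve β π i₀ i₁ c K))

theorem wp_readList_encCoordData {O : List ℝ → List ℝ} {G : List ℝ → Prop} {B a : ℕ}
    {u w : List ℝ} {S : State} (hζ : IsIntegral ℤ ζ) (hd : (minpoly ℤ ζ).natDegree = d)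
    {L : List ((Fin d → ℤ) × ℕ)} (ha : 7 < a) (hB : L.length ≤ B)
    (h : Transfer (encCoordData L ++ u) w S) (hre : S.mem 5 0 = 0) (him : S.mem 5 1 = 0) :
    Wp O G B (readList (coordBasis hζ hd) a 1) (fun T =>
      Transfer u (w ++ encData (L.map fun e => (ofCoords ζ e.1, e.2))) T ∧
      Stored (T.mem a) 0
        ((L.map fun e => modulePoint ζ e.1).flatMap (coords (coordBasis hζ hd))) ∧
      T.reg a = L.length) S := by
  refine (wp_readList (t := 0) (u := u) (w := w)
    (E := L.map fun e => (modulePoint ζ e.1, [(e.2 : ℝ)])) ha ?_ (by simpa using hB) ?_ hre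
    him).mono fun T hT => ?_
  · simp only [List.forall_mem_map, List.length_singleton, implies_true]
  · simpa only [List.length_map, List.flatMap_map, coords_modulePoint, encCoordData] using h
  · simpa only [List.length_map, List.flatMap_map, List.map_map, Function.comp_def, zero_add,
      encData, modulePoint] using hT

theorem wp_prepare_readList {O : List ℝ → List ℝ} {G : List ℝ → Prop} {B s : ℕ}
    (hζ : IsIntegral ℤ ζ) (hd : (minpoly ℤ ζ).natDegree = d)
    {L : Fin m → List ((Fin d → ℤ) × ℕ)} (hB : ∀ i, (L i).length ≤ B)
    (hs : (Finset.univ.sup fun i => (L i).length) = s) :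
    Wp O G B (prepare fun i : Fin m => readList (coordBasis hζ hd) (20 + i) 1)
      (Prepared (coordBasis hζ hd) (s ::
        (List.ofFn fun i => encData ((L i).map fun e => (ofCoords ζ e.1, e.2))).flatten) 0
        fun i => (L i).map fun e => modulePoint ζ e.1)
      ((State.init (List.ofFn fun i => encCoordData (L i)).flatten).setReg 2 1) := by
  refine wp_prepare (fun j => Transfer ((List.ofFn fun i => encCoordData (L i)).drop j).flatten
      (0 :: ((List.ofFn fun i => encData ((L i).map fun e => (ofCoords ζ e.1, e.2))).take
        j).flatten))
    (fun i => by rw [regs_readList]; grind) (fun i => arrays_readList _ _)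
    (fun i τ v h => ⟨h.rest, h.written, h.reg_two⟩)
    (fun i τ h5 hτ => ?_) ⟨?_, ?_, ?_⟩ (by simp [State.init]) (by simp [State.init])
    (by simp [State.init]) (fun τ hτ => ?_) (by simpa using hs)
  · simp only [State.setReg_mem, State.init] at h5
    refine (wp_readList_encCoordData (L := L i)
      (u := ((List.ofFn fun i => encCoordData (L i)).drop (i + 1)).flatten)
      (w := 0 :: ((List.ofFn fun i => encData ((L i).map fun e =>
        (ofCoords ζ e.1, e.2))).take i).flatten) hζ hd (by omega) (hB i) ?_ (by simp [h5])
      (by simp [h5])).mono fun υ ⟨hυ, hL, hn⟩ => ⟨?_, hL, by simpa using hn⟩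
    · simpa [List.drop_eq_getElem_cons] using hτ
    · simpa [List.take_add_one] using hυ
  · simpa [State.init] using stored_init _
  · simp [State.init]
  · simp
  · simpa [List.take_of_length_le] using And.intro hτ.written hτ.reg_two

theorem exists_anchoredData {O : List ℝ → List ℝ} {Ans : List ℝ → (Finset ℂ → Prop) → Prop}
    (hO : ∀ (J : AnchoredData o) q, J.IsDescribed q → Ans (O q) J.IsSolution)
    {I : ModuleData ζ o} {D : Fin m → List (ℂ × ℕ)} (hD : ∀ i, ListsData (D i) (I.p i))
    {P : List ℂ} (hP : P.Nodup) (hPs : P.length ≤ maxSupport I.p ^ 2) {q : List ℝ}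
    (hq : q = queryWord (maxSupport I.p :: (List.ofFn fun i => encData (D i)).flatten) P) :
    (∃ J : AnchoredData o, J.IsDescribed q ∧ J.s ≤ maxSupport I.p) ∧
      Ans (O q) fun F => (∀ z ∈ F, z ∈ P) ∧ ∀ i, xray (o i) F = I.p i := by
  let J : AnchoredData o := ⟨maxSupport I.p, I.p, I.finite, le_maxSupport I.p, P.toFinset,
    (List.toFinset_card_le P).trans hPs⟩
  have hJ : J.IsDescribed q := ⟨D, P, hD, enumerates_toFinset hP, by
    rw [hq, queryWord, List.cons_append]⟩
  have hsol : J.IsSolution = fun F => (∀ z ∈ F, z ∈ P) ∧ ∀ i, xray (o i) F = I.p i := by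
    funext F
    simp only [AnchoredData.IsSolution, Finset.subset_iff, List.mem_toFinset, J]
  exact ⟨⟨J, hJ, le_rfl⟩, hsol ▸ hO J q hJ⟩

theorem polyBounded_dataBound (m : ℕ) :
    PolyBounded fun s => 4 * s ^ 2 + m * (3 * s + 1) + s + 3 := by
  simp only [sq]
  exact ((((PolyBounded.const 4).mul (.mul .id .id)).add
    ((PolyBounded.const m).mul (((PolyBounded.const 3).mul .id).add (.const 1)))).add .id).add
    (.const 3)

theorem wp_solveData {O : List ℝ → List ℝ} {Ans : List ℝ → (Finset ℂ → Prop) → Prop}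
    {hstar : star ζ ∈ fieldK ζ} {i₀ i₁ : Fin m} {ho₀ : o i₀ ∈ fieldK ζ} {ho₁ : o i₁ ∈ fieldK ζ}
    {Λ : List (Fin l → ℝ)} (hζ : IsIntegral ℤ ζ) (hd : (minpoly ℤ ζ).natDegree = d)
    (hlin : LinearIndependent ℝ ![o i₀, o i₁])
    (hΛ : ∀ u, (∀ c ∈ Λ, c ⬝ᵥ u < 0) ↔ ∃ τ, ∀ i, u i < A.mulVec τ i)
    (hAns : AnswerFormat Ans)
    (hO : ∀ (J : AnchoredData o) q, J.IsDescribed q → Ans (O q) J.IsSolution)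
    {I : ModuleData ζ o} {w : List ℝ} (hw : I.IsDescribed d w) :
    Wp O (fun q => ∃ J : AnchoredData o, J.IsDescribed q ∧ J.s ≤ maxSupport I.p)
      (4 * maxSupport I.p ^ 2 + m * (3 * maxSupport I.p + 1) + maxSupport I.p + 3)
      (solveData (coordBasis hζ hd) (projection hstar ho₀ ho₁) i₀ i₁
        (candidateTest (coordBasis hζ hd) σ A b Λ) (l + 1))
      (fun τ => Ans τ.output (IsSolution σ (polyhedron A b) I.p)) (State.init w) := by
  obtain ⟨L, hL, rfl⟩ := hw
  have hcard (i : Fin m) : (Function.support (I.p i)).ncard = (L i).length := by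
    rw [(hL i).ncard_support, List.length_map]
  have hs : maxSupport I.p = Finset.univ.sup fun i => (L i).length := by
    simp only [maxSupport, hcard]
  have hle (i : Fin m) : (L i).length ≤ maxSupport I.p :=
    hcard i ▸ le_maxSupport I.p i
  refine .seq (.setReg (.seq ((wp_prepare_readList hζ hd (fun i => (hle i).trans ?_) hs.symm).mono
    fun τ hτ => ?_)))
  · omega
  refine (wp_solve (R := fun F => ∀ i, xray (o i) F = I.p i) (fun _ => mem_ringO_iff hζ hd) hlin
    hΛ hτ (fun i => ?_) (fun i => by simpa using hle i) ?_ hAns (fun F hF z hz i => ?_)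
    fun P hP hPs => ?_)
  · have := (hL i).1
    simpa [modulePoint, Function.comp_def] using this
  · have hlen := length_flatten_encData_le fun i => by
      simpa only [List.length_map] using (hL i).ncard_support ▸ le_maxSupport I.p i
    rw [List.length_cons]
    omega
  · obtain ⟨e, he, hze⟩ := (hL i).exists_mem_line (hF i) hz
    obtain ⟨c, hc, rfl⟩ := List.mem_map.1 he
    exact ⟨_, List.mem_map_of_mem hc, by simpa [modulePoint] using hze⟩
  · exact exists_anchoredData hO hL hP hPs rfl

theorem polySolvableWithOracle_consistency {i₀ i₁ : Fin m} (hζ : IsIntegral ℤ ζ)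
    (hstar : star ζ ∈ fieldK ζ) (hd : (minpoly ℤ ζ).natDegree = d) (ho₀ : o i₀ ∈ fieldK ζ)
    (ho₁ : o i₁ ∈ fieldK ζ) (hlin : LinearIndependent ℝ ![o i₀, o i₁]) :
    PolySolvableWithOracle (consistency d σ (polyhedron A b) o) (anchoredConsistency o) := by
  obtain ⟨Λ, hΛ⟩ := exists_feasibility_test A
  exact polySolvableWithOracle_of_wp (polyBounded_dataBound m) fun O hO I w hw =>
    wp_solveData (hstar := hstar) (ho₀ := ho₀) (ho₁ := ho₁) hζ hd hlin hΛ answerFormat_decides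
      (fun J q hq => hO J q hq) hw

theorem polySolvableWithOracle_reconstruction {i₀ i₁ : Fin m} (hζ : IsIntegral ℤ ζ)
    (hstar : star ζ ∈ fieldK ζ) (hd : (minpoly ℤ ζ).natDegree = d) (ho₀ : o i₀ ∈ fieldK ζ)
    (ho₁ : o i₁ ∈ fieldK ζ) (hlin : LinearIndependent ℝ ![o i₀, o i₁]) :
    PolySolvableWithOracle (reconstruction d σ (polyhedron A b) o) (anchoredReconstruction o) := by
  obtain ⟨Λ, hΛ⟩ := exists_feasibility_test A
  exact polySolvableWithOracle_of_wp (polyBounded_dataBound m) fun O hO I w hw =>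
    wp_solveData (hstar := hstar) (ho₀ := ho₀) (ho₁ := ho₁) hζ hd hlin hΛ answerFormat_constructs
      (fun J q hq => hO J q hq) hw

end Data

/-! ### Uniqueness -/

section DistinctBy

variable {α γ : Type*} {f : α → γ} {L : List α} {x : α}

open Classical in
/-- The list `L`, without the entries at which `f` takes a value that it has taken before. -/
def distinctBy (f : α → γ) (L : List α) : List α :=
  (L.reverse.pwFilter (f · ≠ f ·)).reverse

theorem mem_map_distinctBy {y : γ} : y ∈ (distinctBy f L).map f ↔ y ∈ L.map f := by
  classical
  have hsub := List.pwFilter_sublist (R := (f · ≠ f ·)) (l := L.reverse)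
  constructor <;> rintro hy <;> obtain ⟨x, hx, rfl⟩ := List.mem_map.1 hy
  · refine List.mem_map_of_mem (List.mem_reverse.1 (hsub.subset ?_))
    simpa [distinctBy] using hx
  · by_contra hfx
    refine (List.forall_mem_pwFilter (R := (f · ≠ f ·)) (fun hxz => ?_) x L.reverse).1 ?_ x
      (List.mem_reverse.2 hx) rfl
    · exact not_and_or.1 fun h => hxz (h.1.trans h.2)
    · exact fun b hb hab => hfx (hab ▸ List.mem_map_of_mem (by simpa [distinctBy] using hb))

theorem nodup_map_distinctBy (f : α → γ) (L : List α) : ((distinctBy f L).map f).Nodup := by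
  classical
  rw [distinctBy, List.map_reverse, List.nodup_reverse]
  exact List.pairwise_map.2 (List.pairwise_pwFilter _)

theorem length_distinctBy_le (f : α → γ) (L : List α) : (distinctBy f L).length ≤ L.length := by
  classical
  simpa [distinctBy] using (List.pwFilter_sublist (R := (f · ≠ f ·)) (l := L.reverse)).length_le

theorem distinctBy_append_singleton_of_mem (h : f x ∈ (distinctBy f L).map f) :
    distinctBy f (L ++ [x]) = distinctBy f L := by
  classical
  obtain ⟨y, hy, hyx⟩ := List.mem_map.1 h
  rw [distinctBy, List.reverse_append, List.reverse_singleton, List.singleton_append,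
    List.pwFilter_cons_of_neg fun hx => ?_, distinctBy]
  exact hx y (by simpa [distinctBy] using hy) hyx.symm

theorem distinctBy_append_singleton_of_notMem (h : f x ∉ (distinctBy f L).map f) :
    distinctBy f (L ++ [x]) = distinctBy f L ++ [x] := by
  classical
  rw [distinctBy, List.reverse_append, List.reverse_singleton, List.singleton_append,
    List.pwFilter_cons_of_pos, List.reverse_cons, distinctBy]
  exact fun y hy hxy => h (hxy ▸ List.mem_map_of_mem (by simpa [distinctBy] using hy))

end DistinctBy

section ListDistinct

variable {ζ : ℂ} {d : ℕ} (β : Module.Basis (Fin d) ℚ (fieldK ζ)) (φ : fieldK ζ →ₗ[ℚ] ℝ)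

/-- Let register 9 tell whether `φ` takes its value at entry `σ.reg 6` of the list in array 8 also
at an entry of the list in array `a`. -/
def scan (a : ℕ) : Prog :=
  .seq (.setReg 9 (.const 0)) (.count 7 a (.ite
    (.realEq (formExp β φ 8 (.reg 6)) (formExp β φ a (.reg 7))) (.setReg 9 (.const 1)) .skip))

/-- Append entry `σ.reg 6` of the list in array 8 to the list in array `a`, whose length is in
register `a`. -/
def copyEntry (a : ℕ) : Prog :=
  .seq (.store a (.mul (.const d) (.reg a)) (List.ofFn fun j : Fin d => coordExp 8 (.reg 6) j))
    (.setReg a (.add (.reg a) (.const 1)))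

/-- Copy the list in array 8 to array `a`, without the entries at which `φ` takes a value that it
has taken before. -/
def listDistinct (a : ℕ) : Prog :=
  .seq (.setReg a (.const 0)) (.count 6 8 (.seq (scan β φ a) (.ite (.natEq (.reg 9) (.const 0))
    (copyEntry (d := d) a) .skip)))

theorem regs_scan (a : ℕ) : (scan β φ a).regs = {7, 9} := by
  ext; simp [scan, Prog.regs]

theorem arrays_scan (a : ℕ) : (scan β φ a).arrays = ∅ := by
  simp [scan, Prog.arrays]

theorem regs_copyEntry (a : ℕ) : (copyEntry (d := d) a).regs = {a} := by
  simp [copyEntry, Prog.regs]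

theorem arrays_copyEntry (a : ℕ) : (copyEntry (d := d) a).arrays ⊆ {a} := by
  simpa only [copyEntry, Prog.arrays, Set.union_empty] using Prog.arrays_store _ _ _

theorem regs_listDistinct (a : ℕ) : (listDistinct β φ a).regs = {6, 7, 9, a} := by
  ext; simp [listDistinct, Prog.regs, regs_scan, regs_copyEntry]

theorem arrays_listDistinct (a : ℕ) : (listDistinct β φ a).arrays ⊆ {a} := by
  simpa [listDistinct, Prog.arrays, arrays_scan] using arrays_copyEntry a

variable {β φ} {O : List ℝ → List ℝ} {G : List ℝ → Prop} {B a : ℕ} {σ : State}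
  {L M : List (fieldK ζ)}

theorem wp_scan (ha : 9 < a) (hL : Stored (σ.mem 8) 0 (L.flatMap (coords β)))
    (hi : σ.reg 6 < L.length) (hM : Stored (σ.mem a) 0 (M.flatMap (coords β)))
    (hn : σ.reg a = M.length) (hB : M.length ≤ B) :
    Wp O G B (scan β φ a) (fun τ => τ.reg 9 = 0 ↔ φ (L.getD (σ.reg 6) 0) ∉ M.map φ) σ := by
  refine .seq (.setReg (.mono (Wp.count
    (fun j τ => τ.reg 9 = 0 ↔ φ (L.getD (σ.reg 6) 0) ∉ (M.take j).map φ) hB ?_ (by omega)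
    (by simp [Prog.regs]) (by simp [Prog.regs]; omega) (fun j _ τ v h => by simpa using h)
    (fun j hj τ h7 hτ h => ?_) (by simp [NExp.eval])) fun τ h => by simpa using h))
  · simpa [show a ≠ 9 by omega] using hn
  · simp only [Prog.regs, Prog.arrays, Set.union_empty] at hτ
    have h6 : NExp.eval τ (.reg 6) = σ.reg 6 := by simp [NExp.eval, hτ.reg 6]
    have hx := eval_formExp (i := .reg 6) (φ := φ) (by rwa [hτ.mem 8 (by simp)]) (h6.trans_lt hi)
    have hy := eval_formExp (i := .reg 7) (φ := φ) (by rwa [hτ.mem a (by simp)]) (h7.trans_lt hj)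
    rw [h6] at hx
    rw [show NExp.eval τ (.reg 7) = j from h7, List.getD_eq_getElem _ 0 hj] at hy
    rw [List.take_succ_eq_append_getElem hj, List.map_append, List.mem_append, List.map_singleton,
      List.mem_singleton]
    refine .ite (fun hc => .setReg ?_) fun hc => .skip ?_
    · simp only [Test.holds, hx, hy] at hc
      simp only [hc, State.setReg_reg, if_pos, NExp.eval, or_true, not_true, one_ne_zero]
    · simp only [Test.holds, hx, hy] at hc
      simpa only [hc, or_false] using h

theorem wp_copyEntry (ha : 8 < a) (hL : Stored (σ.mem 8) 0 (L.flatMap (coords β)))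
    (hi : σ.reg 6 < L.length) (hM : Stored (σ.mem a) 0 (M.flatMap (coords β)))
    (hn : σ.reg a = M.length) :
    Wp O G B (copyEntry (d := d) a) (fun τ =>
      Stored (τ.mem a) 0 ((M ++ [L.getD (σ.reg 6) 0]).flatMap (coords β)) ∧
      τ.reg a = (M ++ [L.getD (σ.reg 6) 0]).length) σ := by
  rw [List.flatMap_append, List.flatMap_singleton, List.length_append, List.length_singleton]
  refine .seq ((Wp.store hM ?_ fun τ hτ => ?_).mono fun τ ⟨hτL, hτ⟩ => .setReg ⟨hτL, ?_⟩)
  · rw [length_flatMap_coords, ← hn]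
    rfl
  · have h6 : NExp.eval τ (.reg 6) = σ.reg 6 := hτ.reg 6 (by simp)
    rw [List.map_ofFn, coords]
    refine congrArg List.ofFn (funext fun q => ?_)
    rw [← hτ.mem 8 (by grind)] at hL
    rw [Function.comp_apply, eval_coordExp hL (h6.trans_lt hi), h6]
  · simp [NExp.eval, hτ.reg a, hn]

theorem wp_listDistinct (ha : 9 < a) (hL : Stored (σ.mem 8) 0 (L.flatMap (coords β)))
    (hn : σ.reg 8 = L.length) (hB : L.length ≤ B) :
    Wp O G B (listDistinct β φ a) (fun τ =>
      Stored (τ.mem a) 0 ((distinctBy φ L).flatMap (coords β)) ∧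
      τ.reg a = (distinctBy φ L).length) σ := by
  refine .seq (.setReg (.mono (Wp.count (fun j τ =>
    Stored (τ.mem a) 0 ((distinctBy φ (L.take j)).flatMap (coords β)) ∧
      τ.reg a = (distinctBy φ (L.take j)).length) hB ?_ (by omega)
    (by simp [Prog.regs, regs_scan, regs_copyEntry]; omega)
    (by simp [Prog.regs, regs_scan, regs_copyEntry]; omega)
    (fun j _ τ v h => by rwa [State.setReg_mem, State.setReg_reg, if_neg (by omega)])
    (fun j hj τ h6 hτ ⟨hM, hMn⟩ => ?_) (by simp [distinctBy, NExp.eval]))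
    fun τ h => by simpa using h))
  · simpa [show 8 ≠ a by omega] using hn
  have hτ8 : τ.mem 8 = σ.mem 8 := hτ.mem 8 fun h => by
    simp only [Prog.arrays, arrays_scan, Set.union_empty, Set.empty_union] at h
    have := arrays_copyEntry _ h
    grind
  have hlen := (length_distinctBy_le φ (L.take j)).trans
    ((List.length_take_le _ _).trans (hj.le.trans hB))
  rw [← hτ8] at hL
  rw [List.take_succ_eq_append_getElem hj]
  refine .seq ((wp_scan (φ := φ) ha hL (h6 ▸ hj) hM hMn hlen).frame.mono fun υ ⟨hυ, hf⟩ => ?_)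
  rw [regs_scan, arrays_scan] at hf
  rw [h6, List.getD_eq_getElem _ 0 hj] at hυ
  rw [← hf.mem a (by simp)] at hM
  rw [← hf.reg a (by grind)] at hMn
  rw [← hf.mem 8 (by simp)] at hL
  refine .ite (fun hc => ?new) fun hc => .skip ?old
  case old =>
    rw [distinctBy_append_singleton_of_mem (not_not.1 (mt hυ.2 hc))]
    exact ⟨hM, hMn⟩
  case new =>
    have h6' : υ.reg 6 = j := (hf.reg 6 (by simp)).trans h6
    rw [distinctBy_append_singleton_of_notMem (hυ.1 hc)]
    simpa only [h6', List.getD_eq_getElem _ 0 hj] using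
      wp_copyEntry (by omega) hL (h6' ▸ hj) hM hMn

end ListDistinct

section Transverse

variable {ζ o t : ℂ} {F : Finset ℂ} {L : List (fieldK ζ)}

/-- A linear form that separates the lines in direction `o ≠ 0`. -/
def transverse (o : ℂ) : fieldK ζ →ₗ[ℚ] ℝ :=
  (Complex.imLm.restrictScalars ℚ ∘ₗ LinearMap.mulRight ℚ (star o)) ∘ₗ (fieldK ζ).val.toLinearMap

theorem lineThrough_add_eq_iff_transverse_eq (ho : o ≠ 0) {x y : fieldK ζ} :
    lineThrough (t + x) o = lineThrough (t + y) o ↔ transverse o x = transverse o y := by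
  rw [lineThrough_eq_iff, mem_line_iff_im_eq_zero ho, add_sub_add_left_eq_sub, sub_mul,
    Complex.sub_im, sub_eq_zero]
  rfl

theorem nodup_map_lineThrough_distinctBy (ho : o ≠ 0) (L : List (fieldK ζ)) :
    ((distinctBy (transverse o) L).map fun x : fieldK ζ => lineThrough (t + x) o).Nodup :=
  List.pairwise_map.2 <| (List.pairwise_map.1 (nodup_map_distinctBy (transverse o) L)).imp
    (mt (lineThrough_add_eq_iff_transverse_eq ho).1)

theorem support_xray_eq_distinctBy (ho : o ≠ 0) (hF : ∀ z, z ∈ F ↔ ∃ x ∈ L, t + (x : ℂ) = z) :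
    Function.support (xray o F) =
      {ℓ | ℓ ∈ (distinctBy (transverse o) L).map fun x : fieldK ζ => lineThrough (t + x) o} := by
  have hmem (x : fieldK ζ) : (∃ y ∈ distinctBy (transverse o) L, transverse o y = transverse o x) ↔
      ∃ y ∈ L, transverse o y = transverse o x := by
    simpa only [List.mem_map] using mem_map_distinctBy (f := transverse o) (L := L)
  ext ℓ
  simp only [support_xray, Set.mem_image, Finset.mem_coe, hF, Set.mem_ofPred_eq, List.mem_map]
  constructor
  · rintro ⟨-, ⟨x, hx, rfl⟩, rfl⟩
    obtain ⟨y, hy, hyx⟩ := (hmem x).2 ⟨x, hx, rfl⟩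
    exact ⟨y, hy, (lineThrough_add_eq_iff_transverse_eq ho).2 hyx⟩
  · rintro ⟨x, hx, rfl⟩
    obtain ⟨y, hy, hyx⟩ := (hmem x).1 ⟨x, hx, rfl⟩
    exact ⟨_, ⟨y, hy, rfl⟩, (lineThrough_add_eq_iff_transverse_eq ho).2 hyx⟩

theorem card_le_ncard_support_mul_ncard_support {o' : ℂ} (h : LinearIndependent ℝ ![o, o'])
    (F : Finset ℂ) : F.card ≤
      (Function.support (xray o F)).ncard * (Function.support (xray o' F)).ncard := by
  rw [support_xray, support_xray, ← Set.ncard_prod, ← Set.ncard_coe_finset]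
  refine Set.ncard_le_ncard_of_injOn (fun z => (lineThrough z o, lineThrough z o'))
    (fun z hz => ⟨⟨z, hz, rfl⟩, ⟨z, hz, rfl⟩⟩) (fun x _ y _ hxy => ?_)
    ((F.finite_toSet.image _).prod (F.finite_toSet.image _))
  obtain ⟨hx, hx'⟩ := Prod.ext_iff.1 hxy
  exact eq_of_mem_lines h (lineThrough_eq_iff.1 hx) (lineThrough_eq_iff.1 hx')
    (mem_line_self y o) (mem_line_self y o')

end Transverse

section SetData

variable {ζ t : ℂ} {d k l m : ℕ} {σ : Fin k → (fieldK ζ ≃ₐ[ℚ] fieldK ζ)}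
  {A : Matrix (Fin l) (Fin k × Fin 2) ℝ} {b : Fin l → ℝ} {o : Fin m → ℂ}
  {O : List ℝ → List ℝ} {G : List ℝ → Prop} {B s : ℕ} {F : Finset ℂ}

/-- Save the translation vector in array 5 and the list of points in array 8, and write the list to
the query prefix, behind a free cell. -/
def readSet (β : Module.Basis (Fin d) ℚ (fieldK ζ)) : Prog :=
  .seq (.setCell 5 (.const 0) (.cell 0 (.const 0)))
    (.seq (.setCell 5 (.const 1) (.cell 0 (.const 1)))
      (.seq (.setReg 5 (.const 2)) (.seq (.setReg 2 (.const 1)) (readList β 8 0))))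

/-- The program for uniqueness. -/
def solveSet (β : Module.Basis (Fin d) ℚ (fieldK ζ)) (π : Module.End ℚ (fieldK ζ)) (o : Fin m → ℂ)
    (i₀ i₁ : Fin m) (c : Test) (K : ℕ) : Prog :=
  .seq (readSet β) (.seq (prepare fun i : Fin m => listDistinct β (transverse (o i)) (20 + i))
    (solve β π i₀ i₁ c K))

theorem wp_readSet (hζ : IsIntegral ℤ ζ) (hd : (minpoly ℤ ζ).natDegree = d)
    {L : List (Fin d → ℤ)} (hB : L.length ≤ B) :
    Wp O G B (readSet (coordBasis hζ hd)) (fun τ =>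
      (Transfer [] (0 :: (L.length : ℝ) :: encPoints (L.map fun c => t + ofCoords ζ c)) τ ∧
        Stored (τ.mem 8) 0 ((L.map (modulePoint ζ)).flatMap (coords (coordBasis hζ hd))) ∧
        τ.reg 8 = L.length) ∧ τ.reg 4 = 0 ∧ τ.mem 5 0 = t.re ∧ τ.mem 5 1 = t.im)
      (State.init (t.re :: t.im :: (L.length : ℝ) :: L.flatMap encCoords)) := by
  refine .seq (.setCell (.seq (.setCell (.seq (.setReg (.seq (.setReg ?_)))))))
  refine (wp_readList (t := t) (u := []) (w := [0]) (E := L.map fun c => (modulePoint ζ c, []))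
    (by omega) (by simp) (by simpa using hB) ⟨?_, ?_, ?_⟩ ?_ ?_).frame.mono fun τ ⟨hτ, hf⟩ => ?_
  · simpa [List.flatMap_map, coords_modulePoint, State.init, NExp.eval, RExp.eval] using
      (stored_cons.1 (stored_cons.1
        (stored_init (t.re :: t.im :: (L.length : ℝ) :: L.flatMap encCoords))).2).2
  · simp [State.init, NExp.eval, RExp.eval]
  · simp [State.init, NExp.eval, RExp.eval]
  · simp [State.init, NExp.eval, RExp.eval]
  · simp [State.init, NExp.eval, RExp.eval]
  · replace hf := hf.mono (regs_readList _ _).subset (arrays_readList _ _)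
    rw [hf.reg 4 (by simp), hf.mem 5 (by simp)]
    refine ⟨?_, ?_⟩
    · simpa [encPoints, List.flatMap_map, List.map_map, modulePoint, Function.comp_def] using hτ
    · simp [State.init, NExp.eval, RExp.eval]

theorem wp_prepare_listDistinct {β : Module.Basis (Fin d) ℚ (fieldK ζ)} {S : State} {w : List ℝ}
    {L : List (fieldK ζ)} (hL : Stored (S.mem 8) 0 (L.flatMap (coords β)))
    (hn : S.reg 8 = L.length) (hB : L.length ≤ B) (hw : Transfer [] (0 :: w) S) (h4 : S.reg 4 = 0)
    (hre : S.mem 5 0 = t.re) (him : S.mem 5 1 = t.im)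
    (hs : (Finset.univ.sup fun i => (distinctBy (transverse (o i)) L).length) = s) :
    Wp O G B (prepare fun i : Fin m => listDistinct β (transverse (o i)) (20 + i))
      (Prepared β (s :: w) t fun i => distinctBy (transverse (o i)) L) S := by
  refine wp_prepare (fun _ τ => Stored (τ.mem 8) 0 (L.flatMap (coords β)) ∧ τ.reg 8 = L.length ∧
      Stored (τ.mem 2) 0 (0 :: w) ∧ τ.reg 2 = w.length + 1)
    (fun i => by rw [regs_listDistinct]; grind)
    (fun i => (arrays_listDistinct _ _ _).trans (Set.subset_insert _ _))
    (fun _ _ _ h => by simpa using h) (fun i τ _ ⟨hτL, hτn, hτw, hτ2⟩ => ?_)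
    ⟨hL, hn, hw.written, hw.reg_two⟩ h4 hre him (fun τ hτ => hτ.2.2) hs
  refine (wp_listDistinct (by omega) hτL hτn hB).frame.mono fun υ ⟨hυ, hf⟩ => ⟨?_, hυ⟩
  replace hf := hf.mono (regs_listDistinct _ _ _).subset (arrays_listDistinct _ _ _)
  rw [hf.mem 8 (by simp; omega), hf.mem 2 (by simp; omega), hf.reg 8 (by simp; omega),
    hf.reg 2 (by simp; omega)]
  exact ⟨hτL, hτn, hτw, hτ2⟩

theorem exists_anchoredSet (hO : (anchoredUniqueness o).SolvedBy O) {L P : List ℂ}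
    (hL : Enumerates L F) (hP : P.Nodup)
    (hPs : P.length ≤ maxSupport (fun i => xray (o i) F) ^ 2) {q : List ℝ}
    (hq : q = queryWord (maxSupport (fun i => xray (o i) F) :: L.length :: encPoints L) P) :
    (∃ J, (anchoredUniqueness o).Describes q J ∧
      (anchoredUniqueness o).size J ≤ maxSupport fun i => xray (o i) F) ∧
      Decides (O q) (∃ F', (∀ z ∈ F', z ∈ P) ∧ F' ≠ F ∧ ∀ i, xray (o i) F' = xray (o i) F) := by
  let J : AnchoredSet o := ⟨maxSupport fun i => xray (o i) F, F,
    le_maxSupport fun i => xray (o i) F, P.toFinset, (List.toFinset_card_le P).trans hPs⟩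
  have hJ : (anchoredUniqueness o).Describes q J := ⟨L, P, hL, enumerates_toFinset hP, by
    rw [hq, queryWord, List.cons_append, List.cons_append]⟩
  have hans : Decides (O q) (∃ F', F' ≠ F ∧ F' ⊆ P.toFinset ∧
    ∀ i, xray (o i) F' = xray (o i) F) := hO J q hJ
  refine ⟨⟨J, hJ, le_rfl⟩, ?_⟩
  simpa only [Finset.subset_iff, List.mem_toFinset, and_left_comm] using hans

theorem maxSupport_xray_eq_sup_length (ho : ∀ i, o i ≠ 0) {L : List (fieldK ζ)}
    (hF : ∀ z, z ∈ F ↔ ∃ x ∈ L, t + (x : ℂ) = z) :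
    (maxSupport fun i => xray (o i) F) =
      Finset.univ.sup fun i => (distinctBy (transverse (o i)) L).length := by
  refine Finset.sup_congr rfl fun i _ => ?_
  rw [support_xray_eq_distinctBy (ho i) hF,
    ncard_setOf_mem_list (nodup_map_lineThrough_distinctBy (ho i) L), List.length_map]

theorem exists_mem_distinctBy_mem_line {o : ℂ} (ho : o ≠ 0) {L : List (fieldK ζ)}
    (hF : ∀ z, z ∈ F ↔ ∃ x ∈ L, t + (x : ℂ) = z) {F' : Finset ℂ} (h : xray o F' = xray o F)
    {z : ℂ} (hz : z ∈ F') : ∃ x ∈ distinctBy (transverse o) L, z ∈ line (t + x) o := by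
  have hzF : lineThrough z o ∈ Function.support (xray o F) := h ▸ xray_ne_zero_iff.2 ⟨z, hz, rfl⟩
  rw [support_xray_eq_distinctBy ho hF, Set.mem_ofPred_eq, List.mem_map] at hzF
  obtain ⟨x, hx, hxz⟩ := hzF
  exact ⟨x, hx, lineThrough_eq_iff.1 hxz.symm⟩

theorem card_le_maxSupport_sq {i₀ i₁ : Fin m} (hlin : LinearIndependent ℝ ![o i₀, o i₁])
    (F : Finset ℂ) : F.card ≤ (maxSupport fun i => xray (o i) F) ^ 2 := by
  rw [sq]
  exact (card_le_ncard_support_mul_ncard_support hlin F).trans (Nat.mul_le_mul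
    (le_maxSupport (fun i => xray (o i) F) i₀) (le_maxSupport (fun i => xray (o i) F) i₁))

theorem polyBounded_setBound : PolyBounded fun s => 6 * s ^ 2 + s + 4 := by
  simp only [sq]
  exact (((PolyBounded.const 6).mul (.mul .id .id)).add .id).add (.const 4)

theorem wp_solveSet {hstar : star ζ ∈ fieldK ζ} {i₀ i₁ : Fin m} {ho₀ : o i₀ ∈ fieldK ζ}
    {ho₁ : o i₁ ∈ fieldK ζ} {Λ : List (Fin l → ℝ)} (hζ : IsIntegral ℤ ζ)
    (hd : (minpoly ℤ ζ).natDegree = d) (ho : ∀ i, o i ≠ 0)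
    (hlin : LinearIndependent ℝ ![o i₀, o i₁])
    (hΛ : ∀ u, (∀ c ∈ Λ, c ⬝ᵥ u < 0) ↔ ∃ τ, ∀ i, u i < A.mulVec τ i)
    (hO : (anchoredUniqueness o).SolvedBy O) {L : List (Fin d → ℤ)}
    (hL : Enumerates (L.map fun c => t + ofCoords ζ c) F)
    (hs : (maxSupport fun i => xray (o i) F) = s) :
    Wp O (fun q => ∃ J, (anchoredUniqueness o).Describes q J ∧ (anchoredUniqueness o).size J ≤ s)
      (6 * s ^ 2 + s + 4)
      (solveSet (coordBasis hζ hd) (projection hstar ho₀ ho₁) o i₀ i₁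
        (candidateTest (coordBasis hζ hd) σ A b Λ) (l + 1))
      (fun τ => Decides τ.output (∃ F', F' ≠ F ∧
        IsSolution σ (polyhedron A b) (fun i => xray (o i) F) F'))
      (State.init (t.re :: t.im :: (L.length : ℝ) :: L.flatMap encCoords)) := by
  set X := L.map (modulePoint ζ) with hX
  have hF (z : ℂ) : z ∈ F ↔ ∃ x ∈ X, t + (x : ℂ) = z := by
    simp [← hL.2, hX, modulePoint]
  have hsup := (maxSupport_xray_eq_sup_length ho hF).symm.trans hs
  have hlen : L.length ≤ s ^ 2 := by
    have := hL.length_eq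
    rw [List.length_map] at this
    exact this ▸ hs ▸ card_le_maxSupport_sq hlin F
  have hXlen : X.length = L.length := List.length_map _
  refine .seq ((wp_readSet (t := t) hζ hd (by omega)).mono
    fun τ ⟨⟨hT, h8, hn⟩, h4, hre, him⟩ => .seq ((wp_prepare_listDistinct (L := X) h8
      (by rw [hn, hXlen]) (by omega) hT h4 hre him hsup).mono fun υ hυ => ?_))
  refine (wp_solve (R := fun F' => F' ≠ F ∧ ∀ i, xray (o i) F' = xray (o i) F)
    (fun _ => mem_ringO_iff hζ hd) hlin hΛ hυ
    (fun i => nodup_map_lineThrough_distinctBy (ho i) X)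
    (fun i => hsup ▸ Finset.le_sup (f := fun i => (distinctBy (transverse (o i)) X).length)
      (Finset.mem_univ i))
    ?_ answerFormat_decides
    (fun F' hF' z hz i => exists_mem_distinctBy_mem_line (ho i) hF (hF'.2 i) hz)
    fun P hP hPs => ?_).mono fun χ hχ => ?_
  · simp only [List.length_cons, length_encPoints, List.length_map]
    omega
  · subst hs
    exact exists_anchoredSet hO hL hP hPs (by simp)
  · simpa only [IsSolution, and_left_comm] using hχ

theorem polySolvableWithOracle_uniqueness {i₀ i₁ : Fin m} (hζ : IsIntegral ℤ ζ)
    (hstar : star ζ ∈ fieldK ζ) (hd : (minpoly ℤ ζ).natDegree = d) (ho : ∀ i, o i ≠ 0)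
    (ho₀ : o i₀ ∈ fieldK ζ) (ho₁ : o i₁ ∈ fieldK ζ)
    (hlin : LinearIndependent ℝ ![o i₀, o i₁]) :
    PolySolvableWithOracle (uniqueness d σ (polyhedron A b) o) (anchoredUniqueness o) := by
  obtain ⟨Λ, hΛ⟩ := exists_feasibility_test A
  exact polySolvableWithOracle_of_wp polyBounded_setBound fun O hO F w ⟨t, L, hL, hw⟩ =>
    hw ▸ wp_solveSet (hstar := hstar) (ho₀ := ho₀) (ho₁ := ho₁) hζ hd ho hlin hΛ hO hL rfl

end SetData

section RootsOfUnity

variable {ζ : ℂ} {n : ℕ}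

theorem natDegree_minpoly_of_isPrimitiveRoot (hn : 0 < n) (hζ : IsPrimitiveRoot ζ n) :
    (minpoly ℤ ζ).natDegree = n.totient := by
  rw [← Polynomial.cyclotomic_eq_minpoly hζ hn, Polynomial.natDegree_cyclotomic]

theorem star_mem_fieldK_of_norm_eq_one (h : ‖ζ‖ = 1) : star ζ ∈ fieldK ζ := by
  rw [← starRingEnd_apply, ← Complex.inv_eq_conj h]
  exact inv_mem (IntermediateField.mem_adjoin_simple_self ℚ ζ)

theorem linearIndependent_pair_of_ne_mul {x y : ℂ} (hy : y ≠ 0) (h : ∀ r : ℝ, x ≠ r * y) :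
    LinearIndependent ℝ ![x, y] :=
  linearIndependent_fin2.2 ⟨hy, fun r hr => h r (by simpa using hr.symm)⟩

end RootsOfUnity

end ModelSet

end

theorem theorem3_general {ζ : ℂ} (hζ : IsIntegral ℤ ζ) (hstar : star ζ ∈ ModelSet.fieldK ζ)
    {d : ℕ} (hd : (minpoly ℤ ζ).natDegree = d) {k l m : ℕ}
    (σ : Fin k → (ModelSet.fieldK ζ ≃ₐ[ℚ] ModelSet.fieldK ζ))
    (A : Matrix (Fin l) (Fin k × Fin 2) ℝ) (b : Fin l → ℝ) {o : Fin m → ℂ}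
    (ho : ∀ i, o i ≠ 0) {i₀ i₁ : Fin m} (ho₀ : o i₀ ∈ ModelSet.fieldK ζ)
    (ho₁ : o i₁ ∈ ModelSet.fieldK ζ) (hlin : LinearIndependent ℝ ![o i₀, o i₁]) :
    RealRAM.PolySolvableWithOracle
      (ModelSet.consistency d σ (ModelSet.polyhedron A b) o) (ModelSet.anchoredConsistency o) ∧
    RealRAM.PolySolvableWithOracle
      (ModelSet.reconstruction d σ (ModelSet.polyhedron A b) o)
      (ModelSet.anchoredReconstruction o) ∧
    RealRAM.PolySolvableWithOracle
      (ModelSet.uniqueness d σ (ModelSet.polyhedron A b) o) (ModelSet.anchoredUniqueness o) :=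
  ⟨ModelSet.polySolvableWithOracle_consistency hζ hstar hd ho₀ ho₁ hlin,
    ModelSet.polySolvableWithOracle_reconstruction hζ hstar hd ho₀ ho₁ hlin,
    ModelSet.polySolvableWithOracle_uniqueness hζ hstar hd ho ho₀ ho₁ hlin⟩

theorem theorem3 (n : ℕ) (hn : 3 ≤ n) (ζ : ℂ) (hζ : IsPrimitiveRoot ζ n)
    (σ : Fin (Nat.totient n / 2 - 1) → (ModelSet.fieldK ζ ≃ₐ[ℚ] ModelSet.fieldK ζ))
    (hσ : ModelSet.IsStarChoice ζ σ)
    (l : ℕ) (A : Matrix (Fin l) (Fin (Nat.totient n / 2 - 1) × Fin 2) ℝ) (b : Fin l → ℝ)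
    (hW : ModelSet.IsWindow (ModelSet.polyhedron A b))
    (m : ℕ) (hm : 2 ≤ m) (o : Fin m → ℂ)
    (ho : ∀ i, o i ∈ ModelSet.ringO ζ ∧ o i ≠ 0)
    (hpar : ∀ i j, i ≠ j → ∀ r : ℝ, o i ≠ (r : ℂ) * o j) :
    RealRAM.PolySolvableWithOracle
      (ModelSet.consistency (Nat.totient n) σ (ModelSet.polyhedron A b) o)
      (ModelSet.anchoredConsistency o) ∧
    RealRAM.PolySolvableWithOracle
      (ModelSet.reconstruction (Nat.totient n) σ (ModelSet.polyhedron A b) o)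
      (ModelSet.anchoredReconstruction o) ∧
    RealRAM.PolySolvableWithOracle
      (ModelSet.uniqueness (Nat.totient n) σ (ModelSet.polyhedron A b) o)
      (ModelSet.anchoredUniqueness o) := by
  obtain ⟨i₀, i₁, hne⟩ := (Fin.nontrivial_iff_two_le.2 hm).exists_pair_ne
  exact theorem3_general (hζ.isIntegral (by omega))
    (ModelSet.star_mem_fieldK_of_norm_eq_one (hζ.norm'_eq_one (by omega)))
    (ModelSet.natDegree_minpoly_of_isPrimitiveRoot (by omega) hζ) σ A b (fun i => (ho i).2)
    (ModelSet.ringO_le_fieldK (ho i₀).1) (ModelSet.ringO_le_fieldK (ho i₁).1)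
    (ModelSet.linearIndependent_pair_of_ne_mul (ho i₁).2 (hpar i₀ i₁ hne))
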